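/- \textbf{Setting.} Consider the Cayley graph of $\mathbb Z^2$ with generators $(\pm1,0),(0,\pm1)$. Let $\mathcal T$ be the set of infinite connected subgraphs $T$ of it that contain the vertex $0$. For $T\in\mathcal T$ let $B_T(0,N)$ be the open ball of radius $N$ about $0$ for the path metric of $T$ (each edge being an interval of length $1$). Equip $\mathcal T$ with the Gromov--Hausdorff ultrametric $d(T,T')=e^{-R(T,T')}$, where $R(T,T')=\sup\{N\ge 1: B_T(0,N)=B_{T'}(0,N)\}\in\mathbb N\cup\{\infty\}$ (with $\sup\emptyset=0$ and $e^{-\infty}=0$). Let $\mathcal R$ be the equivalence relation on $\mathcal T$ which identifies $T$ with $T-v$ for every vertex $v$ of $T$. Let $T_1$ be the tree with the six edges joining $(0,0)$ to $(\pm1,0)$ and to $(0,\pm1)$, and $(0,1)$ to $(0,2)$, and $(0,-1)$ to $(0,-2)$. Given $T_n$, let $T_{n+1}$ be obtained from the union of the images of $T_n+(0,2^n)$ under the rotations about $0$ of angles $0,\pi/2,\pi,3\pi/2$ by pruning the two terminal edges contained in the horizontal axis, that is, by removing the vertices $(\pm2^{n+1},0)$ and the edges ending there. The Kenyon tree is $T_\infty=\bigcup_{n\ge1}T_n$.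 It belongs to $\mathcal T$, and $X=\overline{\mathcal R[T_\infty]}\subset\mathcal T$ is the Ghys--Kenyon minimal set, a transversal of the Ghys--Kenyon lamination, with the equivalence relation induced by $\mathcal R$. A Borel measure $\mu$ is invariant for an equivalence relation if every Borel isomorphism $\varphi:A\to B$ between Borel sets whose graph is contained in the relation satisfies $\mu(\varphi^{-1}(B'))=\mu(B')$ for all Borel $B'\subset B$. Two measured equivalence relations $(\mathcal S,Z,\mu)$ and $(\mathcal S',Z',\mu')$ are orbit equivalent if there are saturated Borel sets $A\subset Z$ and $A'\subset Z'$ of full measure and a Borel isomorphism $\varphi:A\to A'$ such that $\varphi(\mathcal S[x])=\mathcal S'[\varphi(x)]$ for $\mu$-almost every $x\in A$ and the measures $\varphi_*(\mu|_A)$ and $\mu'|_{A'}$ are equivalent (have the same null sets). They are stably orbit equivalent if there are Borel sets $A\subset Z$ and $A'\subset Z'$ whose saturations have full measure and such that the induced measured equivalence relations on $A$ and $A'$ are orbit equivalent. \textbf{Theorem.} There is exactly one Borel probability measure $\mu$ on $X$ which is invariant for $\mathcal R$ (the transverse dynamics is uniquely ergodic). Moreover, $(\mathcal R,X,\mu)$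 is stably orbit equivalent (a) to the cofinal relation on $\{0,1\}^{\mathbb N}$ (two sequences being equivalent if they agree from some index on) with the equidistributed Bernoulli probability measure, and (b) to the equivalence relation generated by $x\mapsto x+1$ on the ring $\mathbb Z_2$ of $2$-adic integers with its Haar probability measure. That is, the measurable transverse dynamics of the Ghys--Kenyon lamination is represented by the binary odometer. -/

import Mathlib

open MeasureTheory Set

noncomputable section

namespace GhysKenyon

/-! ### The Cayley graph of `ℤ²` and its automorphisms -/

/-- The Cayley graph of `ℤ²` for the generators `(±1, 0), (0, ±1)`. -/
def grid : SimpleGraph (ℤ × ℤ) where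
  Adj p q := q - p ∈ ({(1, 0), (-1, 0), (0, 1), (0, -1)} : Set (ℤ × ℤ))
  symm := by
    constructor
    rintro ⟨a, b⟩ ⟨c, d⟩ h
    simp only [Set.mem_insert_iff, Set.mem_singleton_iff, Prod.mk_sub_mk, Prod.mk.injEq] at h ⊢
    omega
  loopless := ⟨by rintro ⟨a, b⟩ h; simp [Prod.ext_iff] at h⟩

/-- Translation by `v`, as an automorphism of the grid. -/
def shift (v : ℤ × ℤ) : grid ≃g grid where
  toEquiv := Equiv.addRight v
  map_rel_iff' := by intro a b; simp [grid]

/-- Rotation by `π / 2` about the origin, as an automorphism of the grid. -/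
def rot : grid ≃g grid where
  toFun p := (-p.2, p.1)
  invFun p := (p.2, -p.1)
  left_inv p := by simp
  right_inv p := by simp
  map_rel_iff' := by
    rintro ⟨a, b⟩ ⟨c, d⟩
    simp only [grid, Equiv.coe_fn_mk, Set.mem_insert_iff, Set.mem_singleton_iff,
      Prod.mk_sub_mk, Prod.mk.injEq]
    omega

lemma shift_apply (v p : ℤ × ℤ) : shift v p = p + v := rfl

lemma rot_apply (p : ℤ × ℤ) : rot p = (-p.2, p.1) := rfl

/-- The translated subgraph `T + v`. -/
def translate (T : grid.Subgraph) (v : ℤ × ℤ) : grid.Subgraph := T.map (shift v).toHom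

lemma translate_zero (T : grid.Subgraph) : translate T 0 = T := by
  have : (shift 0).toHom = SimpleGraph.Hom.id := by
    ext p <;> simp [shift]
  rw [translate, this, SimpleGraph.Subgraph.map_id]

lemma translate_translate (T : grid.Subgraph) (v w : ℤ × ℤ) :
    translate (translate T v) w = translate T (v + w) := by
  have : (shift w).toHom.comp (shift v).toHom = (shift (v + w)).toHom := by
    ext p <;> simp [shift, add_assoc]
  rw [translate, translate, translate, ← this, SimpleGraph.Subgraph.map_comp]

lemma mem_verts_translate {T : grid.Subgraph} {v p : ℤ × ℤ} :
    p ∈ (translate T v).verts ↔ p - v ∈ T.verts := by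
  constructor
  · rintro ⟨q, hq, rfl⟩
    have : (shift v).toHom q - v = q := by simp [shift]
    rwa [this]
  · intro h
    exact ⟨p - v, h, by simp [shift]⟩

/-! ### The space of infinite connected subgraphs through the origin -/

/-- The Gromov-Hausdorff space of infinite connected subgraphs of the grid that contain `0`. -/
@[ext] structure GHSpace where
  graph : grid.Subgraph
  zero_mem : (0 : ℤ × ℤ) ∈ graph.verts
  connected : graph.Connected
  infinite : graph.verts.Infinite

namespace GHSpace

/-- The edges that meet the open ball of radius `N` about `0` for the path metric of `T`,
every edge having length one. The ball determines this set and conversely when `1 ≤ N`. -/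
def ball (T : GHSpace) (N : ℕ) : Set (Sym2 (ℤ × ℤ)) :=
  {e | e ∈ T.graph.edgeSet ∧ ∃ v ∈ e, T.graph.spanningCoe.dist 0 v < N}

/-- `R(T, T') = sup {N ≥ 1 | B_T(0, N) = B_{T'}(0, N)}`, with `sup ∅ = 0`. -/
def agreement (T T' : GHSpace) : ℕ∞ :=
  ⨆ N ∈ {N : ℕ | 1 ≤ N ∧ T.ball N = T'.ball N}, (N : ℕ∞)

/-- `d(T, T') = exp (- R(T, T'))`, with `exp (-∞) = 0`. -/
def ghDist (T T' : GHSpace) : ℝ :=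
  if agreement T T' = ⊤ then 0 else Real.exp (-((agreement T T').toNat : ℝ))

lemma reachable (T : GHSpace) {v : ℤ × ℤ} (hv : v ∈ T.graph.verts) :
    T.graph.spanningCoe.Reachable 0 v := by
  have h := T.connected.coe.preconnected ⟨0, T.zero_mem⟩ ⟨v, hv⟩
  exact h.map (⟨Subtype.val, fun {a b} h => h⟩ : T.graph.coe →g T.graph.spanningCoe)

lemma dist_le_of_ball_eq {T T' : GHSpace} {N : ℕ} (h : T.ball N = T'.ball N) :
    ∀ (k : ℕ) (v : ℤ × ℤ), v ∈ T.graph.verts → T.graph.spanningCoe.dist 0 v = k → k ≤ N →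
      v ∈ T'.graph.verts ∧ T'.graph.spanningCoe.dist 0 v ≤ k := by
  intro k
  induction k with
  | zero =>
    intro v hv hd _
    have : (0 : ℤ × ℤ) = v := (T.reachable hv).dist_eq_zero_iff.1 hd
    subst this
    exact ⟨T'.zero_mem, by simp⟩
  | succ k ih =>
    intro v hv hd hk
    obtain ⟨p, hp⟩ := (T.reachable hv).exists_walk_length_eq_dist
    have hpos : ¬ p.reverse.Nil := by
      intro hn
      have := SimpleGraph.Walk.length_eq_zero_iff.2 hn
      rw [SimpleGraph.Walk.length_reverse] at this
      omega
    obtain ⟨u, hvu, q, hq⟩ := SimpleGraph.Walk.not_nil_iff.1 hpos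
    have hlen : q.length = k := by
      have := congrArg SimpleGraph.Walk.length hq
      simp at this
      omega
    have hadj : T.graph.Adj v u := hvu
    have hu : u ∈ T.graph.verts := hadj.snd_mem
    have hdu : T.graph.spanningCoe.dist 0 u = k := by
      have h1 : T.graph.spanningCoe.dist 0 u ≤ k := by
        have := SimpleGraph.dist_le q.reverse
        simpa [hlen] using this
      obtain ⟨w, hw⟩ := (T.reachable hu).exists_walk_length_eq_dist
      have h2 := SimpleGraph.dist_le (w.concat hvu.symm)
      rw [SimpleGraph.Walk.length_concat] at h2
      omega
    obtain ⟨hu', hdu'⟩ := ih u hu hdu (by omega)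
    have he : s(v, u) ∈ T.ball N := by
      refine ⟨hadj, u, by simp, ?_⟩
      omega
    rw [h] at he
    have hadj' : T'.graph.Adj v u := he.1
    refine ⟨hadj'.fst_mem, ?_⟩
    obtain ⟨w, hw⟩ := (T'.reachable hu').exists_walk_length_eq_dist
    have hs : T'.graph.spanningCoe.Adj u v := hadj'.symm
    have h2 := SimpleGraph.dist_le (w.concat hs)
    rw [SimpleGraph.Walk.length_concat] at h2
    omega

lemma ball_subset_of_ball_eq {T T' : GHSpace} {M N : ℕ} (hMN : M ≤ N)
    (h : T.ball N = T'.ball N) : T.ball M ⊆ T'.ball M := by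
  rintro e ⟨he, v, hv, hd⟩
  have heN : e ∈ T.ball N := ⟨he, v, hv, by omega⟩
  have hvT : v ∈ T.graph.verts := T.graph.mem_verts_of_mem_edge he hv
  have := dist_le_of_ball_eq h _ v hvT rfl (by omega)
  rw [h] at heN
  exact ⟨heN.1, v, hv, by omega⟩

lemma ball_eq_of_le {T T' : GHSpace} {M N : ℕ} (hMN : M ≤ N)
    (h : T.ball N = T'.ball N) : T.ball M = T'.ball M :=
  (ball_subset_of_ball_eq hMN h).antisymm (ball_subset_of_ball_eq hMN h.symm)

lemma le_agreement_iff {T T' : GHSpace} {N : ℕ} (hN : 1 ≤ N) :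
    (N : ℕ∞) ≤ agreement T T' ↔ T.ball N = T'.ball N := by
  constructor
  · intro h
    by_contra hne
    have : agreement T T' ≤ ((N - 1 : ℕ) : ℕ∞) := by
      refine iSup₂_le fun M hM => ?_
      have : ¬ N ≤ M := fun hNM => hne (ball_eq_of_le hNM hM.2)
      exact_mod_cast (by omega : M ≤ N - 1)
    have h2 := h.trans this
    have h3 : N ≤ N - 1 := by exact_mod_cast h2
    omega
  · intro h
    exact le_iSup₂ (f := fun (N : ℕ) (_ : N ∈ {N : ℕ | 1 ≤ N ∧ T.ball N = T'.ball N}) =>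
      (N : ℕ∞)) N ⟨hN, h⟩

lemma agreement_self (T : GHSpace) : agreement T T = ⊤ := by
  refine ENat.eq_top_iff_forall_ge.2 fun n => ?_
  have := (le_agreement_iff (T := T) (T' := T) (N := n + 1) (by omega)).2 rfl
  exact le_trans (by exact_mod_cast n.le_succ) this

lemma agreement_comm (T T' : GHSpace) : agreement T T' = agreement T' T := by
  simp only [agreement, eq_comm]

lemma min_agreement_le (T T' T'' : GHSpace) :
    min (agreement T T') (agreement T' T'') ≤ agreement T T'' := by
  refine ENat.forall_natCast_le_iff_le.1 fun n hn => ?_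
  rcases Nat.eq_zero_or_pos n with rfl | hpos
  · simp
  · rw [le_min_iff, le_agreement_iff hpos, le_agreement_iff hpos] at hn
    exact (le_agreement_iff hpos).2 (hn.1.trans hn.2)

lemma adj_of_agreement_eq_top {T T' : GHSpace} (h : agreement T T' = ⊤) {u v : ℤ × ℤ}
    (huv : T.graph.Adj u v) : T'.graph.Adj u v := by
  set N := T.graph.spanningCoe.dist 0 u + 1 with hN
  have hb : T.ball N = T'.ball N := (le_agreement_iff (by omega)).1 (by rw [h]; exact le_top)
  have he : s(u, v) ∈ T.ball N := ⟨huv, u, by simp, by omega⟩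
  rw [hb] at he
  exact he.1

lemma exists_adj (T : GHSpace) {v : ℤ × ℤ} (hv : v ∈ T.graph.verts) :
    ∃ u, T.graph.Adj v u := by
  obtain ⟨w, hw, hne⟩ := T.infinite.exists_notMem_finset {v}
  have hr : T.graph.spanningCoe.Reachable v w :=
    (T.reachable hv).symm.trans (T.reachable hw)
  obtain ⟨p⟩ := hr
  cases p with
  | nil => simp at hne
  | cons h _ => exact ⟨_, h⟩

lemma eq_of_agreement_eq_top {T T' : GHSpace} (h : agreement T T' = ⊤) : T = T' := by
  have h' : agreement T' T = ⊤ := by rwa [agreement_comm]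
  ext u v
  · constructor
    · intro hu
      obtain ⟨v, hv⟩ := T.exists_adj hu
      exact (adj_of_agreement_eq_top h hv).fst_mem
    · intro hu
      obtain ⟨v, hv⟩ := T'.exists_adj hu
      exact (adj_of_agreement_eq_top h' hv).fst_mem
  · exact ⟨adj_of_agreement_eq_top h, adj_of_agreement_eq_top h'⟩

lemma ghDist_le_of_agreement_le {S S' T T' : GHSpace}
    (h : agreement S S' ≤ agreement T T') : ghDist T T' ≤ ghDist S S' := by
  unfold ghDist
  by_cases hT : agreement T T' = ⊤
  · rw [if_pos hT]
    split_ifs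
    · exact le_rfl
    · positivity
  · have hS : agreement S S' ≠ ⊤ := fun hS => hT (top_le_iff.1 (hS ▸ h))
    rw [if_neg hT, if_neg hS]
    have := ENat.toNat_le_toNat h hT
    have h2 : ((agreement S S').toNat : ℝ) ≤ (agreement T T').toNat := by exact_mod_cast this
    gcongr

lemma ghDist_le_max (T T' T'' : GHSpace) :
    ghDist T T'' ≤ max (ghDist T T') (ghDist T' T'') := by
  rcases min_le_iff.1 (min_agreement_le T T' T'') with h | h
  · exact le_max_of_le_left (ghDist_le_of_agreement_le h)
  · exact le_max_of_le_right (ghDist_le_of_agreement_le h)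

lemma ghDist_nonneg (T T' : GHSpace) : 0 ≤ ghDist T T' := by
  unfold ghDist
  split_ifs <;> positivity

/-- The Gromov-Hausdorff ultrametric. -/
instance : MetricSpace GHSpace where
  dist := ghDist
  dist_self T := by simp [ghDist, agreement_self]
  dist_comm T T' := by simp only [ghDist, agreement_comm]
  dist_triangle T T' T'' := by
    refine (ghDist_le_max T T' T'').trans (max_le ?_ ?_)
    · linarith [ghDist_nonneg T' T'']
    · linarith [ghDist_nonneg T T']
  eq_of_dist_eq_zero {T T'} h := by
    by_contra hne
    have h1 : agreement T T' ≠ ⊤ := fun h => hne (eq_of_agreement_eq_top h)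
    have h2 : ghDist T T' = 0 := h
    rw [ghDist, if_neg h1] at h2
    exact (Real.exp_pos _).ne' h2

instance : MeasurableSpace GHSpace := borel GHSpace

instance : BorelSpace GHSpace := ⟨rfl⟩

/-- The equivalence relation that identifies `T` with `T - v` for every vertex `v` of `T`. -/
def leafRel : Setoid GHSpace where
  r T T' := ∃ v ∈ T.graph.verts, T'.graph = translate T.graph (-v)
  iseqv := by
    refine ⟨fun T => ⟨0, T.zero_mem, by rw [neg_zero, translate_zero]⟩, ?_, ?_⟩
    · rintro T T' ⟨v, hv, h⟩
      refine ⟨-v, ?_, ?_⟩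
      · rw [h, mem_verts_translate]
        simpa using T.zero_mem
      · rw [h, translate_translate]
        simp [translate_zero]
    · rintro T T' T'' ⟨v, hv, h⟩ ⟨w, hw, h'⟩
      refine ⟨v + w, ?_, ?_⟩
      · rw [h, mem_verts_translate] at hw
        have : w - -v = v + w := by abel
        rwa [this] at hw
      · rw [h', h, translate_translate]
        congr 1
        abel

end GHSpace

/-! ### The Kenyon tree -/

/-- The first tree: a cross whose vertical arms have length two. -/
def kenyonSeed : grid.Subgraph :=
  (⊤ : grid.Subgraph).induce {(0, 0), (1, 0), (-1, 0), (0, 1), (0, -1), (0, 2), (0, -2)}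

/-- From the tree of size `r`: translate by `(0, r)`, take the union of the images under the
rotations of angle `0, π/2, π, 3π/2`, and prune the two terminal edges on the horizontal axis
(together with their terminal vertices). -/
def kenyonStep (r : ℤ) (T : grid.Subgraph) : grid.Subgraph :=
  (⨆ k : Fin 4, (translate T (0, r)).map (rot ^ (k : ℕ)).toHom).deleteVerts
    {(2 * r, 0), (-(2 * r), 0)}

/-- `kenyonFinite n` is the tree `T_{n+1}`. -/
def kenyonFinite : ℕ → grid.Subgraph
  | 0 => kenyonSeed
  | n + 1 => kenyonStep (2 ^ (n + 1)) (kenyonFinite n)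

/-- The Kenyon tree `T_∞ = ⋃ T_n`. -/
def kenyonTree : grid.Subgraph := ⨆ n, kenyonFinite n

/-- The image of `p` in the `k`-th rotated copy of the translate by `(0, r)`. -/
def copy (r : ℤ) (k : Fin 4) (p : ℤ × ℤ) : ℤ × ℤ := (rot ^ (k : ℕ)) (p + (0, r))

lemma copy_zero (r a b : ℤ) : copy r 0 (a, b) = (a, b + r) := by
  simp [copy]

lemma copy_one (r a b : ℤ) : copy r 1 (a, b) = (-(b + r), a) := by
  simp [copy, rot_apply]

lemma copy_two (r a b : ℤ) : copy r 2 (a, b) = (-a, -(b + r)) := by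
  simp [copy, pow_succ, rot_apply]

lemma copy_three (r a b : ℤ) : copy r 3 (a, b) = (b + r, -a) := by
  simp [copy, pow_succ, rot_apply]

lemma mem_kenyonStep {r : ℤ} {T : grid.Subgraph} {v : ℤ × ℤ} :
    v ∈ (kenyonStep r T).verts ↔
      (∃ k, ∃ p ∈ T.verts, copy r k p = v) ∧ v ≠ (2 * r, 0) ∧ v ≠ (-(2 * r), 0) := by
  simp only [kenyonStep, SimpleGraph.Subgraph.deleteVerts_verts, SimpleGraph.Subgraph.verts_iSup,
    translate, SimpleGraph.Subgraph.map_verts, Set.mem_sdiff, Set.mem_iUnion, Set.image_image,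
    Set.mem_image, Set.mem_insert_iff, Set.mem_singleton_iff, not_or]
  rfl

lemma adj_kenyonStep {r : ℤ} {T : grid.Subgraph} {k : Fin 4} {p q : ℤ × ℤ} (h : T.Adj p q)
    (hp1 : copy r k p ≠ (2 * r, 0)) (hp2 : copy r k p ≠ (-(2 * r), 0))
    (hq1 : copy r k q ≠ (2 * r, 0)) (hq2 : copy r k q ≠ (-(2 * r), 0)) :
    (kenyonStep r T).Adj (copy r k p) (copy r k q) := by
  have key : (⨆ k : Fin 4, (translate T (0, r)).map (rot ^ (k : ℕ)).toHom).Adj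
      (copy r k p) (copy r k q) := by
    rw [SimpleGraph.Subgraph.iSup_adj]
    exact ⟨k, p + (0, r), q + (0, r), ⟨p, q, h, rfl, rfl⟩, rfl, rfl⟩
  rw [kenyonStep, SimpleGraph.Subgraph.deleteVerts_adj]
  refine ⟨key.fst_mem, ?_, key.snd_mem, ?_, key⟩ <;>
    simp [*]

/-- What the induction on the finite trees carries along. -/
structure KenyonInv (r : ℤ) (T : grid.Subgraph) : Prop where
  diamond : ∀ a b : ℤ, (a, b) ∈ T.verts → |a| + |b| ≤ r
  zero_mem : (0 : ℤ × ℤ) ∈ T.verts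
  bot_mem : ((0, -r) : ℤ × ℤ) ∈ T.verts
  top_adj : T.Adj (0, r - 1) (0, r)
  reach : ∀ v ∈ T.verts, v ≠ (0, r) →
    (T.deleteVerts {(0, r)}).spanningCoe.Reachable (0, -r) v

lemma kenyonInv_seed : KenyonInv 2 kenyonSeed := by
  have hv : ∀ a b : ℤ, (a, b) ∈ kenyonSeed.verts ↔
      (a = 0 ∧ -2 ≤ b ∧ b ≤ 2) ∨ (b = 0 ∧ -1 ≤ a ∧ a ≤ 1) := by
    intro a b
    simp only [kenyonSeed, SimpleGraph.Subgraph.induce_verts, Set.mem_insert_iff,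
      Set.mem_singleton_iff, Prod.mk.injEq]
    omega
  have hadj : ∀ a b c d : ℤ, (a, b) ∈ kenyonSeed.verts → (c, d) ∈ kenyonSeed.verts →
      grid.Adj (a, b) (c, d) → kenyonSeed.Adj (a, b) (c, d) := by
    intro a b c d h1 h2 h3
    exact ⟨h1, h2, by simpa using h3⟩
  have hd : ∀ a b c d : ℤ, (a, b) ∈ kenyonSeed.verts → (c, d) ∈ kenyonSeed.verts →
      grid.Adj (a, b) (c, d) → b < 2 → d < 2 →
      (kenyonSeed.deleteVerts {((0 : ℤ), (2 : ℤ))}).spanningCoe.Reachable (a, b) (c, d) := by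
    intro a b c d h1 h2 h3 hb hd
    refine SimpleGraph.Adj.reachable ?_
    rw [SimpleGraph.Subgraph.spanningCoe_adj, SimpleGraph.Subgraph.deleteVerts_adj]
    refine ⟨h1, ?_, h2, ?_, hadj _ _ _ _ h1 h2 h3⟩ <;>
      simp only [Set.mem_singleton_iff, Prod.mk.injEq] <;> omega
  have r1 := hd 0 (-2) 0 (-1) (by rw [hv]; omega) (by rw [hv]; omega) (by simp [grid])
    (by omega) (by omega)
  have r2 := r1.trans (hd 0 (-1) 0 0 (by rw [hv]; omega) (by rw [hv]; omega) (by simp [grid])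
    (by omega) (by omega))
  have r3 := r2.trans (hd 0 0 0 1 (by rw [hv]; omega) (by rw [hv]; omega) (by simp [grid])
    (by omega) (by omega))
  have r4 := r2.trans (hd 0 0 1 0 (by rw [hv]; omega) (by rw [hv]; omega) (by simp [grid])
    (by omega) (by omega))
  have r5 := r2.trans (hd 0 0 (-1) 0 (by rw [hv]; omega) (by rw [hv]; omega) (by simp [grid])
    (by omega) (by omega))
  refine ⟨?_, (hv 0 0).2 (by omega), (hv _ _).2 (by omega), ?_, ?_⟩
  · intro a b h
    rw [hv] at h
    rcases h with h | h <;> rcases abs_cases a with h1 | h1 <;> rcases abs_cases b with h2 | h2 <;>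
      omega
  · exact hadj _ _ _ _ ((hv _ _).2 (by omega)) ((hv _ _).2 (by omega)) (by simp [grid])
  · rintro ⟨a, b⟩ hm hne
    rw [hv] at hm
    have hne' : ¬ (a = 0 ∧ b = 2) := by simpa using hne
    have hcases : (a = 0 ∧ b = -2) ∨ (a = 0 ∧ b = -1) ∨ (a = 0 ∧ b = 0) ∨ (a = 0 ∧ b = 1) ∨
        (a = 1 ∧ b = 0) ∨ (a = -1 ∧ b = 0) := by omega
    rcases hcases with ⟨rfl, rfl⟩ | ⟨rfl, rfl⟩ | ⟨rfl, rfl⟩ | ⟨rfl, rfl⟩ | ⟨rfl, rfl⟩ | ⟨rfl, rfl⟩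
    · exact SimpleGraph.Reachable.refl _
    · exact r1
    · exact r2
    · exact r3
    · exact r4
    · exact r5

lemma copy_ne {r a b : ℤ} (hr : 0 < r) (k : Fin 4) (hd : |a| + |b| ≤ r) (hne : (a, b) ≠ (0, r)) :
    copy r k (a, b) ≠ (2 * r, 0) ∧ copy r k (a, b) ≠ (-(2 * r), 0) ∧
      copy r k (a, b) ≠ (0, 2 * r) := by
  have hne' : ¬ (a = 0 ∧ b = r) := by simpa using hne
  fin_cases k <;>
    simp only [Fin.zero_eta, Fin.mk_one, Fin.reduceFinMk, copy_zero, copy_one, copy_two,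
      copy_three, ne_eq, Prod.mk.injEq] <;>
    rcases abs_cases a with h1 | h1 <;> rcases abs_cases b with h2 | h2 <;> omega

lemma copy_bot (r : ℤ) (k : Fin 4) : copy r k (0, -r) = 0 := by
  fin_cases k <;> simp [copy_zero, copy_one, copy_two, copy_three]

lemma KenyonInv.step {r : ℤ} (hr : 0 < r) {T : grid.Subgraph} (h : KenyonInv r T) :
    KenyonInv (2 * r) (kenyonStep r T) := by
  have hreach : ∀ (k : Fin 4) (p : ℤ × ℤ), p ∈ T.verts → p ≠ (0, r) →
      ((kenyonStep r T).deleteVerts {(0, 2 * r)}).spanningCoe.Reachable 0 (copy r k p) := by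
    intro k p hp hne
    have := (h.reach p hp hne).map (G' :=
      ((kenyonStep r T).deleteVerts {((0 : ℤ), 2 * r)}).spanningCoe)
      ⟨copy r k, by
        rintro ⟨a, b⟩ ⟨c, d⟩ hab
        rw [SimpleGraph.Subgraph.spanningCoe_adj, SimpleGraph.Subgraph.deleteVerts_adj] at hab
        obtain ⟨ha, ha', hb, hb', hab⟩ := hab
        have e1 := copy_ne hr k (h.diamond _ _ ha) ha'
        have e2 := copy_ne hr k (h.diamond _ _ hb) hb'
        have e3 := adj_kenyonStep hab e1.1 e1.2.1 e2.1 e2.2.1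
        rw [SimpleGraph.Subgraph.spanningCoe_adj, SimpleGraph.Subgraph.deleteVerts_adj]
        exact ⟨e3.fst_mem, e1.2.2, e3.snd_mem, e2.2.2, e3⟩⟩
    rwa [RelHom.coeFn_mk, copy_bot] at this
  have hpos : (0, r - 1) ∈ T.verts := h.top_adj.fst_mem
  have hne1 : ((0 : ℤ), r - 1) ≠ (0, r) := by simp
  have hbotadj : (kenyonStep r T).Adj (0, -(r - 1 + r)) (0, -(r + r)) := by
    have := adj_kenyonStep (r := r) (k := 2) h.top_adj (by simp [copy_two]; omega)
      (by simp [copy_two]; omega) (by simp [copy_two]; omega) (by simp [copy_two]; omega)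
    simpa [copy_two] using this
  have hbot : ((kenyonStep r T).deleteVerts {((0 : ℤ), 2 * r)}).spanningCoe.Reachable
      0 (0, -(2 * r)) := by
    have h1 := hreach 2 _ hpos hne1
    rw [copy_two, neg_zero] at h1
    refine h1.trans (SimpleGraph.Adj.reachable ?_)
    rw [SimpleGraph.Subgraph.spanningCoe_adj, SimpleGraph.Subgraph.deleteVerts_adj, two_mul]
    refine ⟨hbotadj.fst_mem, ?_, hbotadj.snd_mem, ?_, hbotadj⟩ <;>
      simp only [Set.mem_singleton_iff, Prod.mk.injEq] <;> omega
  refine ⟨?_, ?_, ?_, ?_, ?_⟩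
  · intro a b hab
    obtain ⟨⟨k, ⟨c, d⟩, hcd, hk⟩, -⟩ := mem_kenyonStep.1 hab
    have hd := h.diamond c d hcd
    fin_cases k <;>
      simp only [Fin.zero_eta, Fin.mk_one, Fin.reduceFinMk, copy_zero, copy_one, copy_two,
        copy_three, Prod.mk.injEq] at hk <;>
      rcases abs_cases a with h1 | h1 <;> rcases abs_cases b with h2 | h2 <;>
      rcases abs_cases c with h3 | h3 <;> rcases abs_cases d with h4 | h4 <;> omega
  · refine mem_kenyonStep.2 ⟨⟨0, (0, -r), h.bot_mem, copy_bot r 0⟩, ?_, ?_⟩ <;>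
      simp only [ne_eq, Prod.ext_iff, Prod.fst_zero, Prod.snd_zero] <;> omega
  · have := hbotadj.snd_mem
    rwa [← two_mul] at this
  · have := adj_kenyonStep (r := r) (k := 0) h.top_adj (by simp [copy_zero]; omega)
      (by simp [copy_zero]; omega) (by simp [copy_zero]; omega) (by simp [copy_zero]; omega)
    rw [copy_zero, copy_zero] at this
    have e1 : r - 1 + r = 2 * r - 1 := by ring
    have e2 : r + r = 2 * r := by ring
    rwa [e1, e2] at this
  · intro v hv hne
    obtain ⟨⟨k, p, hp, rfl⟩, hv1, hv2⟩ := mem_kenyonStep.1 hv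
    refine hbot.symm.trans ?_
    by_cases hpt : p = (0, r)
    · subst hpt
      fin_cases k
      · exact absurd (by simp [copy_zero, two_mul]) hne
      · exact absurd (by simp [copy_one, two_mul]) hv2
      · have : copy r 2 (0, r) = (0, -(2 * r)) := by simp [copy_two, two_mul]
        simpa only [Fin.reduceFinMk, this] using hbot
      · exact absurd (by simp [copy_three, two_mul]) hv1
    · exact hreach k p hp hpt

lemma kenyonInv_finite (n : ℕ) : KenyonInv (2 ^ (n + 1)) (kenyonFinite n) := by
  induction n with
  | zero => simpa [kenyonFinite] using kenyonInv_seed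
  | succ n ih =>
    have := ih.step (by positivity)
    rw [pow_succ' (2 : ℤ) (n + 1)]
    exact this

lemma KenyonInv.reachable {r : ℤ} {T : grid.Subgraph} (h : KenyonInv r T) {v : ℤ × ℤ}
    (hr : 0 < r) (hv : v ∈ T.verts) : T.spanningCoe.Reachable 0 v := by
  have hle : (T.deleteVerts {(0, r)}).spanningCoe ≤ T.spanningCoe := by
    intro a b hab
    rw [SimpleGraph.Subgraph.spanningCoe_adj, SimpleGraph.Subgraph.deleteVerts_adj] at hab
    exact hab.2.2.2.2
  have h0 : ∀ w ∈ T.verts, w ≠ (0, r) → T.spanningCoe.Reachable 0 w := by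
    intro w hw hne
    have hz : (0 : ℤ × ℤ) ≠ (0, r) := by
      simp only [ne_eq, Prod.ext_iff, Prod.fst_zero, Prod.snd_zero]
      omega
    exact ((h.reach 0 h.zero_mem hz).mono hle).symm.trans ((h.reach w hw hne).mono hle)
  by_cases hne : v = (0, r)
  · subst hne
    refine (h0 _ h.top_adj.fst_mem (by simp)).trans (SimpleGraph.Adj.reachable ?_)
    exact h.top_adj
  · exact h0 v hv hne

lemma kenyonTree_reachable {v : ℤ × ℤ} (hv : v ∈ kenyonTree.verts) :
    kenyonTree.spanningCoe.Reachable 0 v := by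
  rw [kenyonTree, SimpleGraph.Subgraph.verts_iSup] at hv
  obtain ⟨n, hn⟩ := Set.mem_iUnion.1 hv
  refine ((kenyonInv_finite n).reachable (by positivity) hn).mono ?_
  exact SimpleGraph.Subgraph.spanningCoe_le_of_le (le_iSup kenyonFinite n)

lemma connected_of_reachable {T : grid.Subgraph} (h0 : (0 : ℤ × ℤ) ∈ T.verts)
    (h : ∀ v ∈ T.verts, T.spanningCoe.Reachable 0 v) : T.Connected := by
  have key : ∀ {u v : ℤ × ℤ} (_ : T.spanningCoe.Walk u v) (hu : u ∈ T.verts) (hv : v ∈ T.verts),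
      T.coe.Reachable ⟨u, hu⟩ ⟨v, hv⟩ := by
    intro u v p
    induction p with
    | nil => intro hu hv; exact SimpleGraph.Reachable.refl _
    | @cons u w v huw p ih =>
      intro hu hv
      have huw' : T.Adj u w := huw
      have : T.coe.Adj ⟨u, hu⟩ ⟨w, huw'.snd_mem⟩ := huw'
      exact this.reachable.trans (ih _ hv)
  rw [SimpleGraph.Subgraph.connected_iff]
  refine ⟨⟨?_⟩, ⟨0, h0⟩⟩
  rintro ⟨u, hu⟩ ⟨v, hv⟩
  obtain ⟨p⟩ := h u hu
  obtain ⟨q⟩ := h v hv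
  exact (key p h0 hu).symm.trans (key q h0 hv)

lemma kenyonTree_zero_mem : (0 : ℤ × ℤ) ∈ kenyonTree.verts := by
  rw [kenyonTree, SimpleGraph.Subgraph.verts_iSup]
  exact Set.mem_iUnion.2 ⟨0, (kenyonInv_finite 0).zero_mem⟩

lemma kenyonTree_infinite : kenyonTree.verts.Infinite := by
  refine Set.infinite_of_injective_forall_mem (f := fun n : ℕ => ((0 : ℤ), (2 : ℤ) ^ (n + 1))) ?_ ?_
  · intro m n hmn
    simp only [Prod.mk.injEq, true_and] at hmn
    have := pow_right_injective₀ (by norm_num : (0 : ℤ) < 2) (by norm_num) hmn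
    omega
  · intro n
    rw [kenyonTree, SimpleGraph.Subgraph.verts_iSup]
    exact Set.mem_iUnion.2 ⟨n, (kenyonInv_finite n).top_adj.snd_mem⟩

/-- The Kenyon tree, as a point of the Gromov-Hausdorff space. -/
def kenyonPoint : GHSpace where
  graph := kenyonTree
  zero_mem := kenyonTree_zero_mem
  connected := connected_of_reachable kenyonTree_zero_mem fun _ hv => kenyonTree_reachable hv
  infinite := kenyonTree_infinite

/-- The Ghys-Kenyon minimal set: the closure of the equivalence class of the Kenyon tree. -/
def ghysKenyonSet : Set GHSpace := closure {T | GHSpace.leafRel kenyonPoint T}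

/-- The equivalence relation induced on the Ghys-Kenyon minimal set. -/
def ghysKenyonRel : Setoid ghysKenyonSet := Setoid.comap Subtype.val GHSpace.leafRel

/-! ### Measured equivalence relations -/

section Measured

universe u v

variable {X : Type u} {Y : Type v} [MeasurableSpace X] [MeasurableSpace Y]

/-- `μ` is invariant for `r`: every Borel isomorphism between Borel subsets whose graph is
contained in `r` preserves `μ`. -/
def IsInvariant (r : Setoid X) (μ : Measure X) : Prop :=
  ∀ (A B : Set X), MeasurableSet A → MeasurableSet B → ∀ φ : A ≃ᵐ B,
    (∀ x : A, r (x : X) (φ x : X)) →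
      ∀ B' : Set X, MeasurableSet B' → B' ⊆ B →
        μ (Subtype.val '' {x : A | (φ x : X) ∈ B'}) = μ B'

/-- The saturation of `A` for `r`. -/
def saturation (r : Setoid X) (A : Set X) : Set X := {x | ∃ a ∈ A, r a x}

/-- Orbit equivalence of `(r, X, μ)` and `(s, Y, ν)`. -/
def OrbitEquivalent (r : Setoid X) (μ : Measure X) (s : Setoid Y) (ν : Measure Y) : Prop :=
  ∃ (A : Set X) (B : Set Y),
    MeasurableSet A ∧ MeasurableSet B ∧ saturation r A = A ∧ saturation s B = B ∧
    μ Aᶜ = 0 ∧ ν Bᶜ = 0 ∧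
    ∃ φ : A ≃ᵐ B,
      (∀ᵐ x : A ∂(μ.comap Subtype.val),
        φ '' {z : A | r (x : X) (z : X)} = {y : B | s (φ x : Y) (y : Y)}) ∧
      (μ.comap Subtype.val).map φ ≪ ν.comap Subtype.val ∧
      ν.comap Subtype.val ≪ (μ.comap Subtype.val).map φ

/-- Stable orbit equivalence of `(r, X, μ)` and `(s, Y, ν)`: there are Borel sets with saturations
of full measure on which the induced measured equivalence relations are orbit equivalent. -/
def StablyOrbitEquivalent (r : Setoid X) (μ : Measure X) (s : Setoid Y) (ν : Measure Y) : Prop :=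
  ∃ (A : Set X) (B : Set Y),
    MeasurableSet A ∧ MeasurableSet B ∧ μ (saturation r A)ᶜ = 0 ∧ ν (saturation s B)ᶜ = 0 ∧
    OrbitEquivalent
      (Setoid.comap (Subtype.val : A → X) r) (μ.comap Subtype.val)
      (Setoid.comap (Subtype.val : B → Y) s) (ν.comap Subtype.val)

end Measured

/-! ### The binary odometer -/

/-- The cofinal relation on `{0,1}^ℕ`. -/
def cofinalRel : Setoid (ℕ → Fin 2) where
  r α β := ∃ n, ∀ m, n ≤ m → α m = β m
  iseqv := by
    refine ⟨fun α => ⟨0, fun _ _ => rfl⟩, ?_, ?_⟩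
    · rintro α β ⟨n, h⟩
      exact ⟨n, fun m hm => (h m hm).symm⟩
    · rintro α β γ ⟨n, h⟩ ⟨k, h'⟩
      exact ⟨max n k, fun m hm =>
        (h m ((le_max_left _ _).trans hm)).trans (h' m ((le_max_right _ _).trans hm))⟩

/-- The equidistributed (Bernoulli) probability measure on `{0,1}^ℕ`. -/
def coinMeasure : Measure (ℕ → Fin 2) :=
  Measure.infinitePi fun _ => ProbabilityTheory.uniformOn Set.univ

/-- The equivalence relation on the `2`-adic integers generated by `x ↦ x + 1`. -/
def odometerRel : Setoid ℤ_[2] := Relation.EqvGen.setoid fun x y => y = x + 1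

instance : MeasurableSpace ℤ_[2] := borel ℤ_[2]

instance : BorelSpace ℤ_[2] := ⟨rfl⟩

/-- The Haar probability measure on the `2`-adic integers. -/
def haarTwoAdic : Measure ℤ_[2] := Measure.addHaarMeasure ⊤

end GhysKenyon

end

/-!
The Kenyon tree has a closed description: it is the subgraph of the grid induced on the origin and
the points of `ℤ²` whose two coordinates have different `2`-adic valuations (`mem_kenyonTree`,
`kenyonTree_adj`). The condition makes sense on the completion `Plane = ℤ_[2] × ℤ_[2]` of `ℤ²`,
where it defines an open set of `sites`. A point `z` of the plane is an *address* of a pointed graph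
`T` if `T` is drawn on the graph of sites as seen from `z`; the tree `T_∞ - v` has address `v`, and
moving the base point of `T` by `v` adds `v` to the address.

*The address map.* Addresses exist on the whole minimal set `X`, by compactness of the plane
(`exists_isAddress`). They are unique and depend continuously on `T`: from every site one can climb
along straight segments to sites divisible by any power of two, and a finite pattern recognizes
these (`deep_of_pattern`, `IsAddress.eventually_deep_sub`). If neither the sum nor the difference of
the coordinates of `z` is an integer, then the graph of sites seen from `z` is connected
(`siteGraph_reachable`). It follows that over the set `goodSites` of generic sites, whose complement
in the set of sites is Haar null, the address map is a Borel isomorphism which carries the relation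
on `X` to the orbit relation of `ℤ²` acting by translations. The normalized Haar measure of
`goodSites` therefore gives an invariant probability measure on `X` (`isInvariant_treeMeasure`).

*Unique ergodicity.* The image `ρ` on the plane of an invariant probability measure is invariant
under unit translations between subsets of the set of sites, and is carried by the sites. All
residue classes modulo `2ⁿ⁺¹` that consist of sites can be moved to the class of `(2ⁿ, 0)` or to
that of `(0, 2ⁿ)`. Let `αₙ` and `βₙ` be the masses of these two. Dividing each class in four and
moving the parts yields `αₙ = 2 αₙ₊₁ + 2 βₙ₊₁ = βₙ`
(`LocallyInvariant.measure_cylinder_horizontal`), so these masses are all determined by the first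
one, and this one by the total mass (`LocallyInvariant.unique`). Hence `ρ` is the normalized Haar
measure of the set of sites, and the measure on `X` is determined because the address map is
injective over the generic sites.

*Orbit equivalence.* Interleaving the binary digits of the two coordinates identifies the plane,
with its Haar measure, with the Bernoulli space and, by reading the result as a `2`-adic integer,
with `ℤ_[2]`. As adding an integer to a `2`-adic integer that is not an integer changes only
finitely many digits, and conversely, the orbits of `ℤ²` through generic points are the cofinality
classes and the orbits of the odometer, respectively (`cofinal_interleave_iff_exists`,
`odometer_merge_iff`).
-/

noncomputable section

namespace GhysKenyon

open Filter Topology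

/-! ### Divisibility by powers of two in the `2`-adic integers -/

lemma exists_int_approx (x : ℤ_[2]) (n : ℕ) : ∃ k : ℤ, (2 : ℤ_[2]) ^ n ∣ x - k := by
  have h := PadicInt.appr_spec n x
  rw [Ideal.mem_span_singleton] at h
  exact ⟨(x.appr n : ℤ), by simpa using h⟩

lemma pow_dvd_intCast {n : ℕ} {k : ℤ} : (2 : ℤ_[2]) ^ n ∣ (k : ℤ_[2]) ↔ (2 : ℤ) ^ n ∣ k := by
  simpa using PadicInt.pow_p_dvd_int_iff (p := 2) n k

lemma eq_zero_of_forall_pow_dvd {x : ℤ_[2]} (h : ∀ n : ℕ, (2 : ℤ_[2]) ^ n ∣ x) : x = 0 := by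
  by_contra hx
  have hf : FiniteMultiplicity (2 : ℤ_[2]) x := by
    refine FiniteMultiplicity.of_not_isUnit ?_ hx
    exact_mod_cast PadicInt.prime_p.not_isUnit
  obtain ⟨n, hn⟩ := hf
  exact hn (h _)

lemma int_eq_zero_of_forall_pow_dvd {k : ℤ} (h : ∀ n : ℕ, (2 : ℤ) ^ n ∣ k) : k = 0 := by
  have := eq_zero_of_forall_pow_dvd (x := (k : ℤ_[2])) fun n => pow_dvd_intCast.2 (h n)
  exact_mod_cast this

/-- Modulo `2 ^ (n + 1)` there is only one odd multiple of `2 ^ n`. -/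
lemma pow_succ_dvd_sub {x y : ℤ_[2]} {n : ℕ} (hx : (2 : ℤ_[2]) ^ n ∣ x) (hy : (2 : ℤ_[2]) ^ n ∣ y)
    (hx' : ¬ (2 : ℤ_[2]) ^ (n + 1) ∣ x) (hy' : ¬ (2 : ℤ_[2]) ^ (n + 1) ∣ y) :
    (2 : ℤ_[2]) ^ (n + 1) ∣ x - y := by
  have odd : ∀ x : ℤ_[2], (2 : ℤ_[2]) ^ n ∣ x → ¬ (2 : ℤ_[2]) ^ (n + 1) ∣ x →
      (2 : ℤ_[2]) ^ (n + 1) ∣ x - 2 ^ n := by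
    rintro x ⟨u, rfl⟩ h
    obtain ⟨k, hk⟩ := exists_int_approx u 1
    rw [pow_one] at hk
    have hodd : Odd k := by
      by_contra hev
      rw [Int.not_odd_iff_even, even_iff_two_dvd] at hev
      have h2 : (2 : ℤ_[2]) ∣ (k : ℤ_[2]) := by
        have := (pow_dvd_intCast (n := 1) (k := k)).2 (by simpa using hev)
        simpa using this
      have h3 : (2 : ℤ_[2]) ∣ u := by simpa using dvd_add hk h2
      exact h (by rw [pow_succ]; exact mul_dvd_mul_left _ h3)
    obtain ⟨m, rfl⟩ := hodd
    have h4 : (2 : ℤ_[2]) ∣ u - 1 := by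
      have : u - 1 = (u - ((2 * m + 1 : ℤ) : ℤ_[2])) + 2 * m := by push_cast; ring
      rw [this]
      exact dvd_add hk (dvd_mul_right _ _)
    have : (2 : ℤ_[2]) ^ n * u - 2 ^ n = 2 ^ n * (u - 1) := by ring
    rw [this, pow_succ]
    exact mul_dvd_mul_left _ h4
  have := dvd_sub (odd x hx hx') (odd y hy hy')
  simpa using this

lemma not_pow_succ_dvd_pow (n : ℕ) : ¬ (2 : ℤ_[2]) ^ (n + 1) ∣ 2 ^ n := by
  have := pow_dvd_intCast (n := n + 1) (k := 2 ^ n)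
  push_cast at this
  rw [this]
  intro h
  have h2 := Int.le_of_dvd (by positivity) h
  have : (0 : ℤ) < 2 ^ n := by positivity
  rw [pow_succ] at h2
  linarith

/-! ### The product of two copies of the `2`-adic integers and its open set of sites -/

/-- Two copies of the `2`-adic integers: the completion of `ℤ²` along the subgroups `2ⁿℤ²`. -/
abbrev Plane : Type := ℤ_[2] × ℤ_[2]

/-- The embedding of `ℤ²` in its completion. -/
def emb : ℤ × ℤ →+ Plane := (Int.castAddHom ℤ_[2]).prodMap (Int.castAddHom ℤ_[2])

@[simp] lemma emb_fst (p : ℤ × ℤ) : (emb p).1 = (p.1 : ℤ_[2]) := rfl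

@[simp] lemma emb_snd (p : ℤ × ℤ) : (emb p).2 = (p.2 : ℤ_[2]) := rfl

lemma emb_injective : Function.Injective emb := by
  intro p q h
  have h1 := congrArg Prod.fst h
  have h2 := congrArg Prod.snd h
  simp only [emb_fst, emb_snd, Int.cast_inj] at h1 h2
  exact Prod.ext h1 h2

/-- Both coordinates are multiples of `2 ^ n`. -/
def Deep (n : ℕ) (z : Plane) : Prop := (2 : ℤ_[2]) ^ n ∣ z.1 ∧ (2 : ℤ_[2]) ^ n ∣ z.2

lemma Deep.add {n : ℕ} {z w : Plane} (hz : Deep n z) (hw : Deep n w) : Deep n (z + w) :=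
  ⟨dvd_add hz.1 hw.1, dvd_add hz.2 hw.2⟩

lemma Deep.neg {n : ℕ} {z : Plane} (hz : Deep n z) : Deep n (-z) :=
  ⟨(dvd_neg).2 hz.1, (dvd_neg).2 hz.2⟩

lemma Deep.sub {n : ℕ} {z w : Plane} (hz : Deep n z) (hw : Deep n w) : Deep n (z - w) :=
  ⟨dvd_sub hz.1 hw.1, dvd_sub hz.2 hw.2⟩

lemma Deep.mono {m n : ℕ} (h : m ≤ n) {z : Plane} (hz : Deep n z) : Deep m z :=
  ⟨(pow_dvd_pow _ h).trans hz.1, (pow_dvd_pow _ h).trans hz.2⟩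

lemma deep_zero (z : Plane) : Deep 0 z := by simp [Deep]

lemma eq_zero_of_forall_deep {z : Plane} (h : ∀ n, Deep n z) : z = 0 :=
  Prod.ext (eq_zero_of_forall_pow_dvd fun n => (h n).1)
    (eq_zero_of_forall_pow_dvd fun n => (h n).2)

lemma exists_emb_approx (z : Plane) (n : ℕ) : ∃ p : ℤ × ℤ, Deep n (z - emb p) := by
  obtain ⟨k, hk⟩ := exists_int_approx z.1 n
  obtain ⟨l, hl⟩ := exists_int_approx z.2 n
  exact ⟨(k, l), hk, hl⟩

lemma deep_emb {n : ℕ} {p : ℤ × ℤ} : Deep n (emb p) ↔ (2 : ℤ) ^ n ∣ p.1 ∧ (2 : ℤ) ^ n ∣ p.2 := by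
  simp [Deep, pow_dvd_intCast]

/-- The points whose two coordinates have different `2`-adic valuations. -/
def sites : Set Plane := {z | ¬ ∀ n : ℕ, (2 : ℤ_[2]) ^ n ∣ z.1 ↔ (2 : ℤ_[2]) ^ n ∣ z.2}

lemma zero_notMem_sites : (0 : Plane) ∉ sites := by simp [sites]

lemma swap_mem_sites {z : Plane} : z.swap ∈ sites ↔ z ∈ sites := by
  simp [sites, iff_comm]

lemma mem_sites_of_dvd {z : Plane} {n : ℕ} (h1 : (2 : ℤ_[2]) ^ n ∣ z.1)
    (h2 : ¬ (2 : ℤ_[2]) ^ n ∣ z.2) : z ∈ sites := fun h => h2 ((h n).1 h1)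

lemma mem_sites_of_dvd' {z : Plane} {n : ℕ} (h1 : ¬ (2 : ℤ_[2]) ^ n ∣ z.1)
    (h2 : (2 : ℤ_[2]) ^ n ∣ z.2) : z ∈ sites := fun h => h1 ((h n).2 h2)

lemma notMem_sites_of_deep {z : Plane} {n : ℕ} (hz : Deep n z)
    (h1 : ¬ (2 : ℤ_[2]) ^ (n + 1) ∣ z.1) (h2 : ¬ (2 : ℤ_[2]) ^ (n + 1) ∣ z.2) : z ∉ sites := by
  simp only [sites, mem_ofPred_eq, not_not]
  intro m
  rcases le_or_gt m n with hm | hm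
  · exact iff_of_true ((pow_dvd_pow _ hm).trans hz.1) ((pow_dvd_pow _ hm).trans hz.2)
  · exact iff_of_false (fun h => h1 ((pow_dvd_pow _ hm).trans h))
      (fun h => h2 ((pow_dvd_pow _ hm).trans h))

/-- Being a site, and not being one, are locally constant properties away from `0`. -/
lemma exists_forall_mem_sites_iff {z : Plane} (hz : z ≠ 0) :
    ∃ n, ∀ z' : Plane, Deep n (z' - z) → (z' ∈ sites ↔ z ∈ sites) ∧ z' ≠ 0 := by
  have key : ∀ (m n : ℕ) (z' : Plane), m ≤ n → Deep n (z' - z) →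
      (((2 : ℤ_[2]) ^ m ∣ z'.1 ↔ (2 : ℤ_[2]) ^ m ∣ z.1) ∧
        ((2 : ℤ_[2]) ^ m ∣ z'.2 ↔ (2 : ℤ_[2]) ^ m ∣ z.2)) := by
    intro m n z' hmn h
    have h' := h.mono hmn
    constructor
    · have := (dvd_add_right (a := (2 : ℤ_[2]) ^ m) (b := z'.1 - z.1) (c := z.1) h'.1)
      simpa using this
    · have := (dvd_add_right (a := (2 : ℤ_[2]) ^ m) (b := z'.2 - z.2) (c := z.2) h'.2)
      simpa using this
  by_cases hs : z ∈ sites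
  · obtain ⟨n, hn⟩ := not_forall.1 hs
    refine ⟨n, fun z' h => ?_⟩
    obtain ⟨h1, h2⟩ := key n n z' le_rfl h
    have : z' ∈ sites := fun h => hn (by rw [← h1, ← h2]; exact h n)
    refine ⟨iff_of_true this hs, ?_⟩
    rintro rfl
    exact zero_notMem_sites this
  · have hz' : ∃ n, ¬ Deep n z := by
      by_contra! h
      exact hz (eq_zero_of_forall_deep h)
    obtain ⟨n, hn⟩ := hz'
    simp only [sites, mem_ofPred_eq, not_not] at hs
    have hn1 : ¬ (2 : ℤ_[2]) ^ n ∣ z.1 := fun h => hn ⟨h, (hs n).1 h⟩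
    have hn2 : ¬ (2 : ℤ_[2]) ^ n ∣ z.2 := fun h => hn ⟨(hs n).2 h, h⟩
    refine ⟨n, fun z' h => ⟨iff_of_false ?_ (by simpa [sites] using hs), ?_⟩⟩
    · simp only [sites, mem_ofPred_eq, not_not]
      intro m
      rcases le_or_gt m n with hm | hm
      · obtain ⟨h1, h2⟩ := key m n z' hm h
        rw [h1, h2]
        exact hs m
      · obtain ⟨h1, h2⟩ := key n n z' le_rfl h
        exact iff_of_false (fun h => hn1 (h1.1 ((pow_dvd_pow _ hm.le).trans h)))
          (fun h => hn2 (h2.1 ((pow_dvd_pow _ hm.le).trans h)))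
    · rintro rfl
      obtain ⟨h1, h2⟩ := key n n 0 le_rfl h
      exact hn1 (h1.1 (dvd_zero _))

/-- A nonzero integer of absolute value less than `2 ^ n` is not a multiple of `2 ^ n`. -/
lemma not_pow_dvd_of_abs_lt {n : ℕ} {j : ℤ} (h0 : j ≠ 0) (hj : |j| < 2 ^ n) :
    ¬ (2 : ℤ_[2]) ^ n ∣ (j : ℤ_[2]) := by
  rw [pow_dvd_intCast]
  exact fun h => h0 (Int.eq_zero_of_abs_lt_dvd h hj)

lemma deep_add_horizontal_mem_sites {w : Plane} {n : ℕ} (hw : Deep n w) {j : ℤ} (h0 : j ≠ 0)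
    (hj : |j| < 2 ^ n) : w + emb (j, 0) ∈ sites := by
  refine mem_sites_of_dvd' (n := n) ?_ ?_
  · simp only [Prod.fst_add, emb_fst]
    rw [dvd_add_right hw.1]
    exact not_pow_dvd_of_abs_lt h0 hj
  · simpa using hw.2

lemma deep_add_vertical_mem_sites {w : Plane} {n : ℕ} (hw : Deep n w) {j : ℤ} (h0 : j ≠ 0)
    (hj : |j| < 2 ^ n) : w + emb (0, j) ∈ sites := by
  refine mem_sites_of_dvd (n := n) ?_ ?_
  · simpa using hw.1
  · simp only [Prod.snd_add, emb_snd]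
    rw [dvd_add_right hw.2]
    exact not_pow_dvd_of_abs_lt h0 hj

/-- If both coordinates are multiples of `2 ^ m`, they cannot have equal valuations both before and
after a translation of the first one by `2 ^ m`. -/
lemma mem_sites_or_add_horizontal {w : Plane} {m : ℕ} (hw : Deep m w) :
    w ∈ sites ∨ w + emb (2 ^ m, 0) ∈ sites := by
  by_cases h2 : (2 : ℤ_[2]) ^ (m + 1) ∣ w.2
  · by_cases h1 : (2 : ℤ_[2]) ^ (m + 1) ∣ w.1
    · right
      refine mem_sites_of_dvd' (n := m + 1) ?_ (by simpa using h2)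
      simp only [Prod.fst_add, emb_fst]
      rw [dvd_add_right h1]
      exact_mod_cast not_pow_succ_dvd_pow m
    · exact Or.inl (mem_sites_of_dvd' h1 h2)
  · by_cases h1 : (2 : ℤ_[2]) ^ (m + 1) ∣ w.1
    · exact Or.inl (mem_sites_of_dvd h1 h2)
    · right
      refine mem_sites_of_dvd (n := m + 1) ?_ (by simpa using h2)
      have := pow_succ_dvd_sub hw.1 (y := -2 ^ m) (by simp) h1
        (by rw [dvd_neg]; exact not_pow_succ_dvd_pow m)
      simpa using this

/-! ### The graph of sites -/

/-- The grid edges both of whose ends, translated by `z`, are sites. -/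
def siteGraph (z : Plane) : SimpleGraph (ℤ × ℤ) where
  Adj p q := grid.Adj p q ∧ z + emb p ∈ sites ∧ z + emb q ∈ sites
  symm := ⟨fun _ _ h => ⟨h.1.symm, h.2.2, h.2.1⟩⟩
  loopless := ⟨fun _ h => grid.loopless.irrefl _ h.1⟩

/-- The four neighbours of the origin. -/
def units : Set (ℤ × ℤ) := {(1, 0), (-1, 0), (0, 1), (0, -1)}

lemma grid_adj_iff {p q : ℤ × ℤ} : grid.Adj p q ↔ q - p ∈ units := Iff.rfl

lemma grid_adj_add {p e : ℤ × ℤ} (he : e ∈ units) : grid.Adj p (p + e) := by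
  rw [grid_adj_iff]; simpa using he

lemma neg_mem_units {e : ℤ × ℤ} (he : e ∈ units) : -e ∈ units := by
  simp only [units, mem_insert_iff, mem_singleton_iff] at he ⊢
  rcases he with rfl | rfl | rfl | rfl <;> simp

lemma siteGraph_reachable_segment {z : Plane} {q e : ℤ × ℤ} (he : e ∈ units) (k : ℕ)
    (h : ∀ i : ℕ, i ≤ k → z + emb (q + i • e) ∈ sites) :
    (siteGraph z).Reachable q (q + k • e) := by
  induction k with
  | zero => simp
  | succ k ih =>
    refine (ih fun i hi => h i (by omega)).trans (SimpleGraph.Adj.reachable ⟨?_, h k (by omega),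
      h (k + 1) le_rfl⟩)
    have : q + (k + 1) • e = q + k • e + e := by rw [succ_nsmul]; abel
    rw [this]
    exact grid_adj_add he

lemma deep_add_nsmul_mem_sites {w : Plane} {e : ℤ × ℤ} {n i : ℕ} (he : e ∈ units)
    (hd : Deep n w) (h0 : i ≠ 0) (hin : i < 2 ^ n) : w + emb (i • e) ∈ sites := by
  have h0 : (i : ℤ) ≠ 0 := by omega
  have habs : |(i : ℤ)| < 2 ^ n := by rw [Nat.abs_cast]; exact_mod_cast hin
  have h1 : |(-(i : ℤ))| < 2 ^ n := by rwa [abs_neg]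
  simp only [units, mem_insert_iff, mem_singleton_iff] at he
  rcases he with rfl | rfl | rfl | rfl
  · simpa using deep_add_horizontal_mem_sites hd h0 habs
  · simpa using deep_add_horizontal_mem_sites hd (neg_ne_zero.2 h0) h1
  · simpa using deep_add_vertical_mem_sites hd h0 habs
  · simpa using deep_add_vertical_mem_sites hd (neg_ne_zero.2 h0) h1

/-- From a site divisible by `2 ^ n`, straight segments of length `2 ^ n` in any direction consist
of sites, except perhaps at their end. -/
lemma siteGraph_reachable_of_deep {z : Plane} {q e : ℤ × ℤ} {n : ℕ} (he : e ∈ units)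
    (hd : Deep n (z + emb q)) (hq : z + emb q ∈ sites) {k : ℕ}
    (hk : k < 2 ^ n ∨ k = 2 ^ n ∧ z + emb (q + k • e) ∈ sites) :
    (siteGraph z).Reachable q (q + k • e) := by
  refine siteGraph_reachable_segment he k fun i hi => ?_
  rcases Nat.eq_zero_or_pos i with rfl | hpos
  · simpa using hq
  by_cases hin : i < 2 ^ n
  · rw [map_add, ← add_assoc]
    exact deep_add_nsmul_mem_sites he hd hpos.ne' hin
  · have : i = k := by omega
    subst this
    rcases hk with hk | hk
    · omega
    · exact hk.2

/-- The two points at horizontal distance `2 ^ n` from `w` are divisible by `2 ^ (n + 1)` and differ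
by `2 ^ (n + 1)`, so one of them is a site. -/
lemma exists_climb_horizontal {w : Plane} {n : ℕ} (hw : Deep n w)
    (h1 : ¬ (2 : ℤ_[2]) ^ (n + 1) ∣ w.1) (h2 : (2 : ℤ_[2]) ^ (n + 1) ∣ w.2) :
    ∃ e ∈ units, w + emb (2 ^ n • e) ∈ sites ∧ Deep (n + 1) (w + emb (2 ^ n • e)) := by
  have ha : (2 : ℤ_[2]) ^ (n + 1) ∣ w.1 - 2 ^ n :=
    pow_succ_dvd_sub hw.1 dvd_rfl h1 (not_pow_succ_dvd_pow n)
  have hm : Deep (n + 1) (w + emb (2 ^ n • (-1, 0))) := ⟨by simpa [← sub_eq_add_neg] using ha,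
    by simpa using h2⟩
  have hp : Deep (n + 1) (w + emb (2 ^ n • (1, 0))) := by
    refine ⟨?_, by simpa using h2⟩
    have : w.1 + (2 : ℤ_[2]) ^ n = w.1 - 2 ^ n + 2 ^ (n + 1) := by ring
    have h3 := dvd_add ha (dvd_refl ((2 : ℤ_[2]) ^ (n + 1)))
    rw [← this] at h3
    simpa using h3
  rcases mem_sites_or_add_horizontal hm with h | h
  · exact ⟨(-1, 0), by simp [units], h, hm⟩
  · refine ⟨(1, 0), by simp [units], ?_, hp⟩
    have e : w + emb (2 ^ n • (-1, 0)) + emb (2 ^ (n + 1), 0) = w + emb (2 ^ n • (1, 0)) := by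
      rw [add_assoc, ← map_add]
      congr 2
      ext <;> simp
      ring
    rwa [e] at h

/-- Each site divisible by `2 ^ n` is at distance `2 ^ n`, in one of the four directions, from a
site divisible by `2 ^ (n + 1)`. -/
lemma exists_climb {w : Plane} {n : ℕ} (hw : Deep n w) (hs : w ∈ sites)
    (hd : ¬ Deep (n + 1) w) :
    ∃ e ∈ units, w + emb (2 ^ n • e) ∈ sites ∧ Deep (n + 1) (w + emb (2 ^ n • e)) := by
  by_cases h1 : (2 : ℤ_[2]) ^ (n + 1) ∣ w.1
  · have h2 : ¬ (2 : ℤ_[2]) ^ (n + 1) ∣ w.2 := fun h2 => hd ⟨h1, h2⟩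
    obtain ⟨e, he, hs', hd'⟩ := exists_climb_horizontal (w := w.swap) ⟨hw.2, hw.1⟩ h2 h1
    have hsw : (w.swap + emb (2 ^ n • e)).swap = w + emb (2 ^ n • e.swap) := rfl
    refine ⟨e.swap, ?_, ?_, hd'.2, hd'.1⟩
    · simp only [units, mem_insert_iff, mem_singleton_iff] at he ⊢
      rcases he with rfl | rfl | rfl | rfl <;> simp
    · rw [← hsw]
      exact swap_mem_sites.2 hs'
  · by_cases h2 : (2 : ℤ_[2]) ^ (n + 1) ∣ w.2
    · exact exists_climb_horizontal hw h1 h2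
    · exact absurd hs (notMem_sites_of_deep hw h1 h2)

/-- Every site is joined to sites that are divisible by arbitrarily high powers of two. -/
lemma exists_reachable_deep {z : Plane} {p : ℤ × ℤ} (hp : z + emb p ∈ sites) (n : ℕ) :
    ∃ q, (siteGraph z).Reachable p q ∧ z + emb q ∈ sites ∧ Deep n (z + emb q) := by
  induction n with
  | zero => exact ⟨p, SimpleGraph.Reachable.refl _, hp, deep_zero _⟩
  | succ n ih =>
    obtain ⟨q, hpq, hq, hd⟩ := ih
    by_cases hd' : Deep (n + 1) (z + emb q)
    · exact ⟨q, hpq, hq, hd'⟩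
    · obtain ⟨e, he, hs, hd2⟩ := exists_climb hd hq hd'
      rw [add_assoc, ← map_add] at hs hd2
      exact ⟨q + 2 ^ n • e, hpq.trans (siteGraph_reachable_of_deep he hd hq (Or.inr ⟨rfl, hs⟩)),
        hs, hd2⟩

/-- The pattern `{0, (2ᵏ, 0), (0, 2ᵏ)}`, `k < n`, recognizes the multiples of `2 ^ n`: if `w` is a
multiple of `2 ^ k` but not of `2 ^ (k + 1)`, then the coordinates of one of `w`, `w + (2ᵏ, 0)` and
`w + (0, 2ᵏ)` are both odd multiples of `2 ^ k`. -/
lemma deep_of_pattern {w : Plane} {n : ℕ} (h0 : w ∈ sites ∨ w = 0)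
    (h1 : ∀ k < n, w + emb (2 ^ k, 0) ∈ sites ∨ w + emb (2 ^ k, 0) = 0)
    (h2 : ∀ k < n, w + emb (0, 2 ^ k) ∈ sites ∨ w + emb (0, 2 ^ k) = 0) : Deep n w := by
  have key : ∀ {w : Plane} {k : ℕ}, (w ∈ sites ∨ w = 0) → Deep k w →
      (2 : ℤ_[2]) ^ (k + 1) ∣ w.1 ∨ (2 : ℤ_[2]) ^ (k + 1) ∣ w.2 := by
    intro w k hw hd
    by_contra! h
    rcases hw with hw | rfl
    · exact notMem_sites_of_deep hd h.1 h.2 hw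
    · exact h.1 (dvd_zero _)
  induction n with
  | zero => exact deep_zero _
  | succ n ih =>
    have hd := ih (fun k hk => h1 k (by omega)) fun k hk => h2 k (by omega)
    have hn : Deep n (emb (2 ^ n, 0)) := by simp [deep_emb]
    have hn' : Deep n (emb (0, 2 ^ n)) := by simp [deep_emb]
    have k0 := key h0 hd
    have k1 := key (h1 n (by omega)) (hd.add hn)
    have k2 := key (h2 n (by omega)) (hd.add hn')
    simp only [Prod.fst_add, Prod.snd_add, emb_fst, emb_snd, Int.cast_zero, add_zero,
      Int.cast_pow, Int.cast_ofNat] at k1 k2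
    have nd := not_pow_succ_dvd_pow n
    have e1 : (2 : ℤ_[2]) ^ (n + 1) ∣ w.1 → ¬ (2 : ℤ_[2]) ^ (n + 1) ∣ w.1 + 2 ^ n :=
      fun h => by rwa [dvd_add_right h]
    have e2 : (2 : ℤ_[2]) ^ (n + 1) ∣ w.2 → ¬ (2 : ℤ_[2]) ^ (n + 1) ∣ w.2 + 2 ^ n :=
      fun h => by rwa [dvd_add_right h]
    by_cases hx : (2 : ℤ_[2]) ^ (n + 1) ∣ w.1 <;> by_cases hy : (2 : ℤ_[2]) ^ (n + 1) ∣ w.2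
    · exact ⟨hx, hy⟩
    · exact absurd (k1.resolve_left (e1 hx)) hy
    · exact absurd (k2.resolve_right (e2 hy)) hx
    · exact absurd k0 (by tauto)

/-! ### Connectedness of the graph of sites -/

lemma deep_add_diagonal_notMem_sites {w : Plane} {n : ℕ} (hw : Deep n w) {a b : ℤ}
    (hab : |a| = |b|) (h0 : a ≠ 0) (ha : |a| < 2 ^ n) : w + emb (a, b) ∉ sites := by
  simp only [sites, mem_ofPred_eq, not_not]
  have hb0 : b ≠ 0 := by rw [← abs_pos, ← hab]; exact abs_pos.2 h0
  have ha' := not_pow_dvd_of_abs_lt h0 ha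
  have hb' := not_pow_dvd_of_abs_lt hb0 (hab ▸ ha)
  rw [← dvd_add_right hw.1] at ha'
  rw [← dvd_add_right hw.2] at hb'
  intro m
  rcases le_or_gt m n with hm | hm
  · have hm' := hw.mono hm
    simp only [Prod.fst_add, Prod.snd_add, emb_fst, emb_snd]
    rw [dvd_add_right hm'.1, dvd_add_right hm'.2, pow_dvd_intCast, pow_dvd_intCast,
      ← dvd_abs, hab, dvd_abs]
  · exact iff_of_false (fun h => ha' ((pow_dvd_pow _ hm.le).trans h))
      (fun h => hb' ((pow_dvd_pow _ hm.le).trans h))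

/-- The sites of the open diamond of radius `2 ^ n` about a site divisible by `2 ^ n` are joined to
its centre: outside the diagonals, the diamond is the union of four diamonds of half the radius. -/
lemma siteGraph_reachable_of_diamond {z : Plane} (n : ℕ) :
    ∀ {q p : ℤ × ℤ}, Deep n (z + emb q) → z + emb q ∈ sites → z + emb p ∈ sites →
      |p.1 - q.1| + |p.2 - q.2| < 2 ^ n → (siteGraph z).Reachable q p := by
  induction n with
  | zero =>
    rintro ⟨a, b⟩ ⟨c, d⟩ - - - h
    simp only [pow_zero] at h
    have h1 := abs_nonneg (c - a)
    have h2 := abs_nonneg (d - b)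
    have h3 : |c - a| = 0 := by omega
    have h4 : |d - b| = 0 := by omega
    rw [abs_eq_zero] at h3 h4
    have e1 : a = c := by omega
    have e2 : b = d := by omega
    subst e1 e2
    exact SimpleGraph.Reachable.refl _
  | succ n ih =>
    intro q p hd hq hp h
    obtain ⟨⟨a, b⟩, rfl⟩ : ∃ d, p = q + d := ⟨p - q, by abel⟩
    simp only [Prod.fst_add, Prod.snd_add, add_sub_cancel_left] at h
    by_cases hab : |a| = |b|
    · by_cases h0 : a = 0
      · subst h0
        have : b = 0 := by simpa using hab.symm
        subst this
        simp [← Prod.zero_eq_mk]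
      · refine absurd hp ?_
        rw [map_add, ← add_assoc]
        exact deep_add_diagonal_notMem_sites hd hab h0
          (lt_of_le_of_lt (le_add_of_nonneg_right (abs_nonneg b)) h)
    · obtain ⟨e, he, hlt⟩ : ∃ e ∈ units, |a - 2 ^ n * e.1| + |b - 2 ^ n * e.2| < 2 ^ n := by
        have h2 : (2 : ℤ) ^ (n + 1) = 2 * 2 ^ n := by ring
        rw [h2] at h
        generalize (2 : ℤ) ^ n = r at h
        simp only [units, mem_insert_iff, mem_singleton_iff]
        rcases lt_or_gt_of_ne hab with hlt | hlt
        · rcases le_or_gt 0 b with hb | hb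
          · refine ⟨(0, 1), by simp, ?_⟩
            simp only [mul_zero, mul_one, sub_zero]
            rw [abs_of_nonneg hb] at *
            rcases abs_cases (b - r) with h3 | h3 <;> omega
          · refine ⟨(0, -1), by simp, ?_⟩
            simp only [mul_zero, mul_neg, mul_one, sub_zero, sub_neg_eq_add]
            rw [abs_of_neg hb] at *
            rcases abs_cases (b + r) with h3 | h3 <;> omega
        · rcases le_or_gt 0 a with hb | hb
          · refine ⟨(1, 0), by simp, ?_⟩
            simp only [mul_zero, mul_one, sub_zero]
            rw [abs_of_nonneg hb] at *
            rcases abs_cases (a - r) with h3 | h3 <;> omega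
          · refine ⟨(-1, 0), by simp, ?_⟩
            simp only [mul_zero, mul_neg, mul_one, sub_zero, sub_neg_eq_add]
            rw [abs_of_neg hb] at *
            rcases abs_cases (a + r) with h3 | h3 <;> omega
      have hpow : (2 : ℕ) ^ n < 2 ^ (n + 1) := Nat.pow_lt_pow_right (by norm_num) (by omega)
      have hs := deep_add_nsmul_mem_sites he hd (i := 2 ^ n) (by positivity) hpow
      have hdd : Deep n (emb (2 ^ n • e)) := by simp [deep_emb]
      have hd' := (hd.mono n.le_succ).add hdd
      rw [add_assoc, ← map_add] at hs hd'
      refine (siteGraph_reachable_of_deep he hd hq (Or.inl hpow)).trans (ih hd' hs hp ?_)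
      have e1 : (q + (a, b)).1 - (q + 2 ^ n • e).1 = a - 2 ^ n * e.1 := by simp
      have e2 : (q + (a, b)).2 - (q + 2 ^ n • e).2 = b - 2 ^ n * e.2 := by simp
      rwa [e1, e2]

/-- If `x` is not an integer, then, for large `n`, some integer translate of `x` is an odd multiple
of `2 ^ n`, the translation being far from `± 2 ^ n`. -/
lemma exists_centered_translate {x : ℤ_[2]} (hx : ∀ m : ℤ, x ≠ m) (M : ℕ) :
    ∃ N : ℕ, ∀ n ≥ N, ∃ s : ℤ, |s| + M < 2 ^ n ∧ (2 : ℤ_[2]) ^ n ∣ x + s ∧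
      ¬ (2 : ℤ_[2]) ^ (n + 1) ∣ x + s := by
  have hj : ∀ j : ℤ, ∃ n : ℕ, ¬ (2 : ℤ_[2]) ^ n ∣ x + j := by
    intro j
    by_contra! h
    have := eq_zero_of_forall_pow_dvd h
    exact hx (-j) (by push_cast; linear_combination this)
  choose f hf using hj
  -- For these `n` the translates of `x` by at most `M` are not multiples of `2 ^ (n + 1)`.
  refine ⟨(Finset.Icc (-(M : ℤ)) M).sup f, fun n hn => ?_⟩
  have hfar : ∀ j : ℤ, |j| ≤ M → ¬ (2 : ℤ_[2]) ^ (n + 1) ∣ x + j := by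
    intro j hjM h
    have h1 : f j ≤ n := (Finset.le_sup (Finset.mem_Icc.2 (abs_le.1 hjM))).trans hn
    exact hf j ((pow_dvd_pow _ (by omega)).trans h)
  obtain ⟨k, hk⟩ := exists_int_approx x (n + 1)
  have hr : (0 : ℤ) < 2 ^ (n + 1) := by positivity
  set t : ℤ := (-k) % 2 ^ (n + 1) with ht
  have ht0 : 0 ≤ t := Int.emod_nonneg _ hr.ne'
  have ht1 : t < 2 ^ (n + 1) := Int.emod_lt_of_pos _ hr
  have hxt : (2 : ℤ_[2]) ^ (n + 1) ∣ x + t := by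
    have h1 : (2 : ℤ) ^ (n + 1) ∣ k + t := by
      have := Int.emod_add_mul_ediv (-k) (2 ^ (n + 1))
      rw [← ht] at this
      exact ⟨-(-k / 2 ^ (n + 1)), by linarith⟩
    have h2 := dvd_add hk (pow_dvd_intCast.2 h1)
    have h3 : x - (k : ℤ_[2]) + ((k + t : ℤ) : ℤ_[2]) = x + t := by push_cast; ring
    rwa [h3] at h2
  have h1 : (M : ℤ) < t := by
    by_contra! h
    exact hfar t (by rwa [abs_of_nonneg ht0]) hxt
  have h2 : t < 2 ^ (n + 1) - M := by
    by_contra! h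
    refine hfar (t - 2 ^ (n + 1)) (by rw [abs_of_neg (by linarith)]; linarith) ?_
    have h3 : x + ((t - 2 ^ (n + 1) : ℤ) : ℤ_[2]) = x + t - 2 ^ (n + 1) := by push_cast; ring
    rw [h3]
    exact dvd_sub hxt dvd_rfl
  have h3 : x + ((t - 2 ^ n : ℤ) : ℤ_[2]) = x + t - 2 ^ n := by push_cast; ring
  refine ⟨t - 2 ^ n, ?_, ?_, ?_⟩
  · rw [pow_succ] at h2
    rcases abs_cases (t - 2 ^ n) with h4 | h4 <;> linarith
  · rw [h3]
    exact dvd_sub ((pow_dvd_pow _ n.le_succ).trans hxt) dvd_rfl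
  · rw [h3, dvd_sub_right hxt]
    exact not_pow_succ_dvd_pow n

/-- If neither the sum nor the difference of the coordinates of `z` is an integer, then the sites
form a connected graph: the boundaries of the diamonds about the odd multiples of `2 ^ n` are
diagonals, and these recede from the origin. -/
lemma siteGraph_reachable {z : Plane} (hz : z ∈ sites) (h1 : ∀ m : ℤ, z.1 + z.2 ≠ m)
    (h2 : ∀ m : ℤ, z.1 - z.2 ≠ m) {p : ℤ × ℤ} (hp : z + emb p ∈ sites) :
    (siteGraph z).Reachable 0 p := by
  obtain ⟨N₁, hN₁⟩ := exists_centered_translate h1 (p.1.natAbs + p.2.natAbs)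
  obtain ⟨N₂, hN₂⟩ := exists_centered_translate h2 (p.1.natAbs + p.2.natAbs)
  obtain ⟨n, hn1, hn2, hn3⟩ : ∃ n, n ≥ N₁ ∧ n ≥ N₂ ∧ 1 ≤ n :=
    ⟨max N₁ (max N₂ 1), by omega, by omega, by omega⟩
  obtain ⟨s, hs, hsd, hsn⟩ := hN₁ n hn1
  obtain ⟨t, ht, htd, htn⟩ := hN₂ n hn2
  -- The centre of the diamond is the point `(c, d)` with `c + d = s` and `c - d = t`.
  have hplus : (2 : ℤ_[2]) ^ (n + 1) ∣ (z.1 + z.2 + s) + (z.1 - z.2 + t) := by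
    have := pow_succ_dvd_sub hsd (dvd_neg.2 htd) hsn (by rwa [dvd_neg])
    rwa [sub_neg_eq_add] at this
  have hminus := pow_succ_dvd_sub hsd htd hsn htn
  have heven : (2 : ℤ) ∣ s + t := by
    have h3 : (2 : ℤ_[2]) ^ 1 ∣ ((s + t : ℤ) : ℤ_[2]) := by
      have h4 := (pow_dvd_pow (2 : ℤ_[2]) (show 1 ≤ n + 1 by omega)).trans hplus
      have h5 : (z.1 + z.2 + s) + (z.1 - z.2 + t) = 2 ^ 1 * z.1 + ((s + t : ℤ) : ℤ_[2]) := by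
        push_cast; ring
      rwa [h5, dvd_add_right (dvd_mul_right _ _)] at h4
    simpa using pow_dvd_intCast.1 h3
  obtain ⟨c, hc⟩ := heven
  obtain ⟨d, rfl⟩ : ∃ d, t = c - d := ⟨c - t, by ring⟩
  obtain rfl : s = c + d := by omega
  have two_ne : (2 : ℤ_[2]) ≠ 0 := two_ne_zero
  have hdeep : Deep n (z + emb (c, d)) := by
    constructor
    · rw [← mul_dvd_mul_iff_left two_ne, ← pow_succ']
      convert hplus using 1
      simp only [Prod.fst_add, emb_fst]
      push_cast
      ring
    · rw [← mul_dvd_mul_iff_left two_ne, ← pow_succ']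
      convert hminus using 1
      simp only [Prod.snd_add, emb_snd]
      push_cast
      ring
  have hsum : (z + emb (c, d)).1 + (z + emb (c, d)).2 = z.1 + z.2 + ((c + d : ℤ) : ℤ_[2]) := by
    simp only [Prod.fst_add, Prod.snd_add, emb_fst, emb_snd]
    push_cast
    ring
  rw [← hsum] at hsn
  have hsite : z + emb (c, d) ∈ sites := by
    by_cases hx : (2 : ℤ_[2]) ^ (n + 1) ∣ (z + emb (c, d)).1
    · exact mem_sites_of_dvd hx fun hy => hsn (dvd_add hx hy)
    · refine mem_sites_of_dvd' hx (by_contra fun hy => hsn ?_)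
      have := pow_succ_dvd_sub hdeep.1 (dvd_neg.2 hdeep.2) hx (by rwa [dvd_neg])
      rwa [sub_neg_eq_add] at this
  push_cast at hs ht
  -- As `|c| + |d|` is the maximum of `|s|` and `|t|`, the diamond contains the origin and `p`.
  have a1 : |c| + |d| + |p.1| + |p.2| < 2 ^ n := by
    generalize (2 : ℤ) ^ n = r at *
    rcases abs_cases c with h | h <;> rcases abs_cases d with h' | h' <;>
      rcases abs_cases (c + d) with h'' | h'' <;> rcases abs_cases (c - d) with h3 | h3 <;> omega
  refine (siteGraph_reachable_of_diamond n hdeep hsite (p := 0) (by simpa using hz) ?_).symm.trans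
    (siteGraph_reachable_of_diamond n hdeep hsite hp ?_)
  · simp only [Prod.fst_zero, Prod.snd_zero, zero_sub, abs_neg]
    linarith [abs_nonneg p.1, abs_nonneg p.2]
  · linarith [abs_sub p.1 c, abs_sub p.2 d]

/-! ### The vertices of the Kenyon tree -/

/-- The points of `ℤ²` whose coordinates have different `2`-adic valuations, and the origin. -/
def lattice : Set (ℤ × ℤ) := {p | emb p ∈ sites ∨ p = 0}

lemma mem_lattice_iff {a b : ℤ} : (a, b) ∈ lattice ↔
    (¬ ∀ n : ℕ, (2 : ℤ) ^ n ∣ a ↔ (2 : ℤ) ^ n ∣ b) ∨ a = 0 ∧ b = 0 := by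
  simp [lattice, sites, pow_dvd_intCast]

lemma mem_lattice_comm {a b : ℤ} : (a, b) ∈ lattice ↔ (b, a) ∈ lattice := by
  simp only [mem_lattice_iff, iff_comm, and_comm]

lemma neg_left_mem_lattice {a b : ℤ} : (-a, b) ∈ lattice ↔ (a, b) ∈ lattice := by
  simp only [mem_lattice_iff, dvd_neg, neg_eq_zero]

lemma neg_right_mem_lattice {a b : ℤ} : (a, -b) ∈ lattice ↔ (a, b) ∈ lattice := by
  simp only [mem_lattice_iff, dvd_neg, neg_eq_zero]

lemma zero_left_mem_lattice (b : ℤ) : ((0 : ℤ), b) ∈ lattice := by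
  rw [mem_lattice_iff]
  by_cases hb : b = 0
  · exact Or.inr ⟨rfl, hb⟩
  · refine Or.inl fun h => hb (int_eq_zero_of_forall_pow_dvd fun n => (h n).1 (dvd_zero _))

lemma eq_zero_of_abs_eq_of_mem_lattice {a b : ℤ} (hab : |a| = |b|) (h : (a, b) ∈ lattice) :
    a = 0 ∧ b = 0 := by
  rw [mem_lattice_iff] at h
  refine h.resolve_left fun h => h fun n => ?_
  rw [← dvd_abs, hab, dvd_abs]

/-- Within a diamond of radius `2 ^ m` about the origin, the lattice is invariant under the vertical
translation by `2 ^ m`. -/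
lemma add_pow_mem_lattice {a b : ℤ} {m : ℕ} (ha : |a| < 2 ^ m) :
    (a, b + 2 ^ m) ∈ lattice ↔ (a, b) ∈ lattice := by
  by_cases h0 : a = 0
  · subst h0
    exact iff_of_true (zero_left_mem_lattice _) (zero_left_mem_lattice _)
  have hnd : ¬ (2 : ℤ) ^ m ∣ a := fun h => h0 (Int.eq_zero_of_abs_lt_dvd h ha)
  have key : ∀ b c : ℤ, (2 : ℤ) ^ m ∣ c - b → (∀ n : ℕ, (2 : ℤ) ^ n ∣ a ↔ (2 : ℤ) ^ n ∣ b) →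
      ∀ n : ℕ, (2 : ℤ) ^ n ∣ a ↔ (2 : ℤ) ^ n ∣ c := by
    intro b c hbc h n
    rcases le_or_gt n m with hn | hn
    · exact (h n).trans (dvd_iff_dvd_of_dvd_sub (dvd_sub_comm.1 ((pow_dvd_pow _ hn).trans hbc)))
    · refine iff_of_false (fun h' => hnd ((pow_dvd_pow _ hn.le).trans h')) fun h' => ?_
      have h1 := (pow_dvd_pow _ hn.le).trans h'
      rw [h m] at hnd
      exact hnd ((dvd_iff_dvd_of_dvd_sub hbc).1 h1)
  simp only [mem_lattice_iff, h0, false_and, or_false]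
  exact not_congr ⟨key _ _ (by simp), key _ _ (by simp)⟩

/-- The points of the lattice in the open diamond of radius `r` about the origin, and the upper and
lower corners of the diamond: for `r = 2 ^ (n + 1)`, the vertices of the finite tree
`kenyonFinite n`. -/
def diamond (r : ℤ) : Set (ℤ × ℤ) :=
  {p | p ∈ lattice ∧ (|p.1| + |p.2| < r ∨ p = (0, r) ∨ p = (0, -r))}

/-- The four closed quadrants bounded by the diagonals. -/
def sector : Fin 4 → ℤ × ℤ → Prop :=
  ![fun v => |v.1| ≤ v.2, fun v => |v.2| ≤ -v.1, fun v => |v.1| ≤ -v.2, fun v => |v.2| ≤ v.1]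

lemma copy_mem_diamond {m : ℕ} (k : Fin 4) {p : ℤ × ℤ} (hp : p ∈ diamond (2 ^ m))
    (h1 : copy (2 ^ m) k p ≠ (2 * 2 ^ m, 0)) (h2 : copy (2 ^ m) k p ≠ (-(2 * 2 ^ m), 0)) :
    copy (2 ^ m) k p ∈ diamond (2 * 2 ^ m) := by
  obtain ⟨a, b⟩ := p
  obtain ⟨hl, hd⟩ := hp
  have hr : (0 : ℤ) < 2 ^ m := by positivity
  have hlat : (a, b + 2 ^ m) ∈ lattice := by
    rcases hd with hd | hd | hd
    · have : |a| < 2 ^ m := lt_of_le_of_lt (le_add_of_nonneg_right (abs_nonneg b)) hd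
      exact (add_pow_mem_lattice this).2 hl
    all_goals
      obtain ⟨rfl, -⟩ := Prod.mk.inj hd
      exact zero_left_mem_lattice _
  have hlat' := mem_lattice_comm.1 hlat
  simp only [Prod.mk.injEq] at hd
  fin_cases k <;>
    simp only [Fin.zero_eta, Fin.mk_one, Fin.reduceFinMk, copy_zero, copy_one, copy_two,
      copy_three, ne_eq, Prod.mk.injEq] at h1 h2 ⊢
  · refine ⟨hlat, ?_⟩
    simp only [Prod.mk.injEq]
    generalize (2 : ℤ) ^ m = r at *
    rcases abs_cases a with h3 | h3 <;> rcases abs_cases b with h4 | h4 <;>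
      rcases abs_cases (b + r) with h5 | h5 <;> omega
  · refine ⟨neg_left_mem_lattice.2 hlat', ?_⟩
    simp only [Prod.mk.injEq, abs_neg]
    generalize (2 : ℤ) ^ m = r at *
    rcases abs_cases a with h3 | h3 <;> rcases abs_cases b with h4 | h4 <;>
      rcases abs_cases (b + r) with h5 | h5 <;> omega
  · refine ⟨neg_left_mem_lattice.2 (neg_right_mem_lattice.2 hlat), ?_⟩
    simp only [Prod.mk.injEq, abs_neg]
    generalize (2 : ℤ) ^ m = r at *
    rcases abs_cases a with h3 | h3 <;> rcases abs_cases b with h4 | h4 <;>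
      rcases abs_cases (b + r) with h5 | h5 <;> omega
  · refine ⟨neg_right_mem_lattice.2 hlat', ?_⟩
    simp only [Prod.mk.injEq, abs_neg]
    generalize (2 : ℤ) ^ m = r at *
    rcases abs_cases a with h3 | h3 <;> rcases abs_cases b with h4 | h4 <;>
      rcases abs_cases (b + r) with h5 | h5 <;> omega

/-- The part of the large diamond in the upper sector lies in the translated small diamond. -/
lemma sub_pow_mem_diamond {m : ℕ} {a b : ℤ} (h : (a, b) ∈ lattice) (hab : |a| ≤ b)
    (hd : |a| + |b| < 2 * 2 ^ m ∨ a = 0 ∧ b = 2 * 2 ^ m) : (a, b - 2 ^ m) ∈ diamond (2 ^ m) := by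
  have hr : (0 : ℤ) < 2 ^ m := by positivity
  have hlt : |a| = b → a = 0 ∧ b = 0 := fun h' => by
    refine eq_zero_of_abs_eq_of_mem_lattice ?_ h
    rw [h', abs_of_nonneg ((abs_nonneg a).trans hab)]
  have ha : |a| < 2 ^ m := by
    rcases hd with hd | hd
    · have := le_abs_self b
      linarith
    · rw [hd.1]
      simp
  refine ⟨?_, ?_⟩
  · rwa [← add_pow_mem_lattice ha, sub_add_cancel]
  · simp only [Prod.mk.injEq]
    generalize (2 : ℤ) ^ m = r at *
    rcases abs_cases a with h3 | h3 <;> rcases abs_cases b with h4 | h4 <;>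
      rcases abs_cases (b - r) with h5 | h5 <;> omega

lemma exists_copy_eq {m : ℕ} {k : Fin 4} {v : ℤ × ℤ} (hv : v ∈ diamond (2 * 2 ^ m))
    (hs : sector k v) : ∃ p ∈ diamond (2 ^ m), copy (2 ^ m) k p = v := by
  obtain ⟨x, y⟩ := v
  obtain ⟨hl, hd⟩ := hv
  have hr : (0 : ℤ) < 2 ^ m := by positivity
  have hl' := mem_lattice_comm.1 hl
  have hlx := neg_left_mem_lattice.2 hl
  simp only [Prod.mk.injEq] at hd
  fin_cases k <;> simp only [sector, Fin.zero_eta, Fin.mk_one, Fin.reduceFinMk,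
    Matrix.cons_val_zero, Matrix.cons_val_one, Matrix.cons_val] at hs
  · refine ⟨(x, y - 2 ^ m), sub_pow_mem_diamond hl hs ?_, by simp [copy_zero]⟩
    have := abs_nonneg x
    omega
  · refine ⟨(y, -x - 2 ^ m), sub_pow_mem_diamond (neg_right_mem_lattice.2 hl') hs ?_,
      by simp [copy_one]⟩
    rw [abs_neg]
    rcases abs_cases y with h | h <;> omega
  · refine ⟨(-x, -y - 2 ^ m), sub_pow_mem_diamond
      (neg_left_mem_lattice.2 (neg_right_mem_lattice.2 hl)) (by rwa [abs_neg]) ?_,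
      by simp [copy_two]⟩
    rw [abs_neg, abs_neg]
    have := abs_nonneg x
    omega
  · refine ⟨(-y, x - 2 ^ m), sub_pow_mem_diamond (neg_left_mem_lattice.2 hl') (by rwa [abs_neg]) ?_,
      by simp [copy_three]⟩
    rw [abs_neg]
    rcases abs_cases y with h | h <;> omega

lemma exists_sector (v : ℤ × ℤ) : ∃ k, sector k v := by
  have h : sector 0 v ∨ sector 1 v ∨ sector 2 v ∨ sector 3 v := by
    simp only [sector, Matrix.cons_val_zero, Matrix.cons_val_one, Matrix.cons_val]
    rcases abs_cases v.1 with h | h <;> rcases abs_cases v.2 with h' | h' <;> omega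
  rcases h with h | h | h | h
  exacts [⟨_, h⟩, ⟨_, h⟩, ⟨_, h⟩, ⟨_, h⟩]

/-- Two adjacent points of the lattice lie in a common sector. -/
lemma exists_common_sector {v w : ℤ × ℤ} (hv : v ∈ lattice) (h : grid.Adj v w) :
    ∃ k, sector k v ∧ sector k w := by
  obtain ⟨a, b⟩ := v
  obtain ⟨c, d⟩ := w
  by_cases h0 : a = 0 ∧ b = 0
  · obtain ⟨k, hk⟩ := exists_sector (c, d)
    refine ⟨k, ?_, hk⟩
    obtain ⟨rfl, rfl⟩ := h0
    fin_cases k <;> simp [sector]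
  · have hne : |a| ≠ |b| := fun h => h0 (eq_zero_of_abs_eq_of_mem_lattice h hv)
    have h' : (sector 0 (a, b) ∧ sector 0 (c, d)) ∨ (sector 1 (a, b) ∧ sector 1 (c, d)) ∨
        (sector 2 (a, b) ∧ sector 2 (c, d)) ∨ (sector 3 (a, b) ∧ sector 3 (c, d)) := by
      simp only [sector, Matrix.cons_val_zero, Matrix.cons_val_one, Matrix.cons_val]
      simp only [grid, mem_insert_iff, mem_singleton_iff, Prod.mk_sub_mk, Prod.mk.injEq] at h
      rcases abs_cases a with h1 | h1 <;> rcases abs_cases b with h2 | h2 <;>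
        rcases abs_cases c with h3 | h3 <;> rcases abs_cases d with h4 | h4 <;> omega
    rcases h' with h | h | h | h
    exacts [⟨_, h⟩, ⟨_, h⟩, ⟨_, h⟩, ⟨_, h⟩]

lemma kenyonSeed_verts : kenyonSeed.verts = diamond 2 := by
  ext ⟨a, b⟩
  have h0 := zero_left_mem_lattice b
  have h1 : b = 0 → (a, b) ∈ lattice := by
    rintro rfl
    exact mem_lattice_comm.1 (zero_left_mem_lattice a)
  simp only [kenyonSeed, SimpleGraph.Subgraph.induce_verts, Set.mem_insert_iff,
    Set.mem_singleton_iff, Prod.mk.injEq, diamond, mem_ofPred_eq]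
  constructor
  · intro h
    refine ⟨?_, ?_⟩
    · by_cases ha : a = 0
      · rwa [ha]
      · exact h1 (by omega)
    · rcases abs_cases a with h3 | h3 <;> rcases abs_cases b with h4 | h4 <;> omega
  · rintro ⟨-, h⟩
    rcases abs_cases a with h3 | h3 <;> rcases abs_cases b with h4 | h4 <;> omega

/-- The finite trees are induced subgraphs of the grid. The inductive step decomposes a diamond into
its four sectors, each of which is covered by a copy of the diamond of half the radius. -/
lemma kenyonFinite_spec (n : ℕ) : (kenyonFinite n).verts = diamond (2 ^ (n + 1)) ∧
    ∀ p q, p ∈ diamond (2 ^ (n + 1)) → q ∈ diamond (2 ^ (n + 1)) → grid.Adj p q →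
      (kenyonFinite n).Adj p q := by
  induction n with
  | zero =>
    simp only [kenyonFinite, zero_add, pow_one]
    refine ⟨kenyonSeed_verts, fun p q hp hq h => ?_⟩
    rw [← kenyonSeed_verts] at hp hq
    exact ⟨hp, hq, by simpa using h⟩
  | succ n ih =>
    obtain ⟨hv, ha⟩ := ih
    have hr : (0 : ℤ) < 2 ^ (n + 1) := by positivity
    have hends : ∀ v ∈ diamond (2 * 2 ^ (n + 1)),
        v ≠ (2 * 2 ^ (n + 1), 0) ∧ v ≠ (-(2 * 2 ^ (n + 1)), 0) := by
      rintro v ⟨-, hd⟩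
      constructor <;> rintro rfl <;> simp only [Prod.mk.injEq, abs_zero, abs_neg] at hd <;>
        rw [abs_of_pos (by positivity)] at hd <;> omega
    rw [pow_succ' (2 : ℤ) (n + 1), kenyonFinite]
    constructor
    · ext v
      rw [mem_kenyonStep, hv]
      constructor
      · rintro ⟨⟨k, p, hp, rfl⟩, h1, h2⟩
        exact copy_mem_diamond k hp h1 h2
      · intro h
        obtain ⟨k, hk⟩ := exists_sector v
        exact ⟨⟨k, exists_copy_eq h hk⟩, hends v h⟩
    · intro v w hv' hw' hvw
      obtain ⟨k, hk1, hk2⟩ := exists_common_sector hv'.1 hvw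
      obtain ⟨p, hp, rfl⟩ := exists_copy_eq hv' hk1
      obtain ⟨q, hq, rfl⟩ := exists_copy_eq hw' hk2
      have h1 := hends _ hv'
      have h2 := hends _ hw'
      refine adj_kenyonStep (ha p q hp hq ?_) h1.1 h1.2 h2.1 h2.2
      have h3 : grid.Adj (p + (0, 2 ^ (n + 1))) (q + (0, 2 ^ (n + 1))) :=
        (SimpleGraph.Iso.map_adj_iff (rot ^ (k : ℕ))).1 hvw
      simpa [grid_adj_iff] using h3

lemma exists_mem_diamond (p : ℤ × ℤ) (hp : p ∈ lattice) :
    ∃ N, ∀ n ≥ N, p ∈ diamond (2 ^ (n + 1)) := by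
  refine ⟨(|p.1| + |p.2|).toNat, fun n hn => ⟨hp, Or.inl ?_⟩⟩
  have h1 : n < 2 ^ (n + 1) := n.lt_two_pow_self.trans
    (Nat.pow_lt_pow_right (by norm_num) (by omega))
  have h2 : (n : ℤ) < 2 ^ (n + 1) := by exact_mod_cast h1
  omega

/-- The vertices of the Kenyon tree are the points whose coordinates have different `2`-adic
valuations, and the origin. -/
lemma mem_kenyonTree {p : ℤ × ℤ} : p ∈ kenyonTree.verts ↔ emb p ∈ sites ∨ p = 0 := by
  rw [kenyonTree, SimpleGraph.Subgraph.verts_iSup, mem_iUnion]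
  constructor
  · rintro ⟨n, hn⟩
    rw [(kenyonFinite_spec n).1] at hn
    exact hn.1
  · intro h
    obtain ⟨N, hN⟩ := exists_mem_diamond p h
    exact ⟨N, by rw [(kenyonFinite_spec N).1]; exact hN N le_rfl⟩

lemma kenyonTree_adj {p q : ℤ × ℤ} (hp : p ∈ kenyonTree.verts) (hq : q ∈ kenyonTree.verts)
    (h : grid.Adj p q) : kenyonTree.Adj p q := by
  obtain ⟨N, hN⟩ := exists_mem_diamond p (mem_kenyonTree.1 hp)
  obtain ⟨M, hM⟩ := exists_mem_diamond q (mem_kenyonTree.1 hq)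
  rw [kenyonTree, SimpleGraph.Subgraph.iSup_adj]
  exact ⟨max N M, (kenyonFinite_spec _).2 _ _ (hN _ (le_max_left _ _)) (hM _ (le_max_right _ _)) h⟩

/-! ### The Gromov-Hausdorff topology -/

namespace GHSpace

lemma mem_nhds_iff_ball {T : GHSpace} {s : Set GHSpace} :
    s ∈ 𝓝 T ↔ ∃ N, 1 ≤ N ∧ ∀ T' : GHSpace, T'.ball N = T.ball N → T' ∈ s := by
  rw [Metric.mem_nhds_iff]
  constructor
  · rintro ⟨ε, hε, hs⟩
    obtain ⟨n, hn⟩ := exists_nat_gt (-Real.log ε)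
    refine ⟨n + 1, by omega, fun T' h => hs ?_⟩
    have h1 := (le_agreement_iff (by omega)).2 h
    have h2 : ghDist T' T ≤ Real.exp (-((n + 1 : ℕ) : ℝ)) := by
      unfold ghDist
      split_ifs with ht
      · positivity
      · have := ENat.toNat_le_toNat h1 ht
        rw [ENat.toNat_natCast] at this
        have h3 : ((n + 1 : ℕ) : ℝ) ≤ (agreement T' T).toNat := by exact_mod_cast this
        gcongr
    refine lt_of_le_of_lt h2 ?_
    rw [← Real.lt_log_iff_exp_lt hε]
    push_cast
    linarith
  · rintro ⟨N, hN, hs⟩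
    refine ⟨Real.exp (-(N : ℝ)), by positivity, fun T' h => hs T' ?_⟩
    rw [← le_agreement_iff hN]
    by_contra! hlt
    have hne : agreement T' T ≠ ⊤ := hlt.ne_top
    have h1 : ghDist T' T < Real.exp (-(N : ℝ)) := h
    rw [ghDist, if_neg hne, Real.exp_lt_exp, neg_lt_neg_iff, Nat.cast_lt] at h1
    have h2 : ((agreement T' T).toNat : ℕ∞) = agreement T' T := ENat.natCast_toNat hne
    rw [← h2, Nat.cast_lt] at hlt
    omega

lemma eventually_mem_verts {T : GHSpace} {p : ℤ × ℤ} (hp : p ∈ T.graph.verts) :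
    ∀ᶠ T' in 𝓝 T, p ∈ T'.graph.verts := by
  refine mem_nhds_iff_ball.2 ⟨T.graph.spanningCoe.dist 0 p + 1, by omega, fun T' h => ?_⟩
  exact (dist_le_of_ball_eq h.symm _ p hp rfl (by omega)).1

lemma eventually_adj_iff {T : GHSpace} {p q : ℤ × ℤ} (hp : p ∈ T.graph.verts) :
    ∀ᶠ T' in 𝓝 T, (T'.graph.Adj p q ↔ T.graph.Adj p q) := by
  refine mem_nhds_iff_ball.2 ⟨T.graph.spanningCoe.dist 0 p + 1, by omega, fun T' h => ?_⟩
  have hd := (dist_le_of_ball_eq h.symm _ p hp rfl (by omega)).2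
  constructor
  · intro ha
    have : s(p, q) ∈ T'.ball (T.graph.spanningCoe.dist 0 p + 1) := ⟨ha, p, by simp, by omega⟩
    rw [h] at this
    exact this.1
  · intro ha
    have : s(p, q) ∈ T.ball (T.graph.spanningCoe.dist 0 p + 1) := ⟨ha, p, by simp, by omega⟩
    rw [← h] at this
    exact this.1

lemma dist_le_succ {T : GHSpace} {a b : ℤ × ℤ} (h : T.graph.Adj a b) :
    T.graph.spanningCoe.dist 0 b ≤ T.graph.spanningCoe.dist 0 a + 1 := by
  obtain ⟨w, hw⟩ := (T.reachable h.fst_mem).exists_walk_length_eq_dist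
  have hs : T.graph.spanningCoe.Adj a b := h
  have := SimpleGraph.dist_le (w.concat hs)
  rwa [SimpleGraph.Walk.length_concat, hw] at this

/-- If `T'` contains the edges of `T` at distance less than `M` from the origin, then it contains
the walks of `T` that stay within this distance. -/
lemma exists_walk_of_adj {T T' : GHSpace} {M : ℕ}
    (H : ∀ a b, T.graph.Adj a b → T.graph.spanningCoe.dist 0 a < M → a ∈ T'.graph.verts →
      T'.graph.Adj a b) {a b : ℤ × ℤ} (w : T.graph.spanningCoe.Walk a b) :
    a ∈ T'.graph.verts → T.graph.spanningCoe.dist 0 a + w.length ≤ M →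
      b ∈ T'.graph.verts ∧ ∃ w' : T'.graph.spanningCoe.Walk a b, w'.length = w.length := by
  induction w with
  | nil => exact fun h _ => ⟨h, SimpleGraph.Walk.nil, rfl⟩
  | @cons a c b h w ih =>
    intro ha hM
    rw [SimpleGraph.Walk.length_cons] at hM
    have hadj : T.graph.Adj a c := h
    have h' : T'.graph.Adj a c := H a c hadj (by omega) ha
    have hd := dist_le_succ hadj
    obtain ⟨hb, w', hw'⟩ := ih h'.snd_mem (by omega)
    have hs : T'.graph.spanningCoe.Adj a c := h'
    exact ⟨hb, SimpleGraph.Walk.cons hs w', by simp [hw']⟩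

lemma ball_subset_of_adj {T T' : GHSpace} {M : ℕ}
    (H : ∀ a b, T.graph.Adj a b → T.graph.spanningCoe.dist 0 a < M → a ∈ T'.graph.verts →
      T'.graph.Adj a b) : T.ball M ⊆ T'.ball M := by
  rintro e ⟨he, v, hv, hd⟩
  obtain ⟨u, rfl⟩ := Sym2.mem_iff_exists.1 hv
  obtain ⟨w, hw⟩ := (T.reachable (T.graph.mem_verts_of_mem_edge he hv)).exists_walk_length_eq_dist
  obtain ⟨hv', w', hw'⟩ := exists_walk_of_adj H w T'.zero_mem (by simp; omega)
  refine ⟨H v u he hd hv', v, hv, ?_⟩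
  have := SimpleGraph.dist_le w'
  omega

lemma eq_of_forall_ball_eq {T T' : GHSpace} (h : ∀ N, T.ball N = T'.ball N) : T = T' := by
  refine eq_of_agreement_eq_top (ENat.eq_top_iff_forall_ge.2 fun n => ?_)
  exact le_trans (by exact_mod_cast n.le_succ) ((le_agreement_iff (N := n + 1) (by omega)).2 (h _))

end GHSpace

lemma translate_adj {T : grid.Subgraph} {v p q : ℤ × ℤ} :
    (translate T v).Adj p q ↔ T.Adj (p - v) (q - v) := by
  constructor
  · rintro ⟨a, b, h, rfl, rfl⟩
    simpa [shift] using h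
  · intro h
    exact ⟨p - v, q - v, h, by simp [shift], by simp [shift]⟩

namespace GHSpace

/-- The subgraph `T - v`, for a vertex `v` of `T`. -/
def rebase (T : GHSpace) (v : ℤ × ℤ) (hv : v ∈ T.graph.verts) : GHSpace where
  graph := translate T.graph (-v)
  zero_mem := by rw [mem_verts_translate]; simpa using hv
  connected := by
    refine connected_of_reachable (by rw [mem_verts_translate]; simpa using hv) fun p hp => ?_
    rw [mem_verts_translate, sub_neg_eq_add] at hp
    have h := (T.reachable hv).symm.trans (T.reachable hp)
    have := h.map (G' := (translate T.graph (-v)).spanningCoe) ⟨fun p => p - v, fun {a b} h => by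
      have h' : T.graph.Adj a b := h
      rw [SimpleGraph.Subgraph.spanningCoe_adj, translate_adj]
      simpa using h'⟩
    simpa using this
  infinite := by
    have := T.infinite.image (f := fun p => p - v) (sub_left_injective.injOn)
    refine this.mono ?_
    rintro _ ⟨p, hp, rfl⟩
    rw [mem_verts_translate]
    simpa using hp

@[simp] lemma mem_rebase {T : GHSpace} {v p : ℤ × ℤ} (hv : v ∈ T.graph.verts) :
    p ∈ (T.rebase v hv).graph.verts ↔ p + v ∈ T.graph.verts := by
  rw [rebase, mem_verts_translate, sub_neg_eq_add]

@[simp] lemma rebase_adj {T : GHSpace} {v p q : ℤ × ℤ} (hv : v ∈ T.graph.verts) :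
    (T.rebase v hv).graph.Adj p q ↔ T.graph.Adj (p + v) (q + v) := by
  rw [rebase, translate_adj, sub_neg_eq_add, sub_neg_eq_add]

lemma leafRel_rebase {T : GHSpace} {v : ℤ × ℤ} (hv : v ∈ T.graph.verts) :
    leafRel T (T.rebase v hv) := ⟨v, hv, rfl⟩

lemma leafRel_iff {T T' : GHSpace} : leafRel T T' ↔ ∃ v, ∃ hv : v ∈ T.graph.verts,
    T' = T.rebase v hv := by
  constructor
  · rintro ⟨v, hv, h⟩
    exact ⟨v, hv, GHSpace.ext h⟩
  · rintro ⟨v, hv, rfl⟩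
    exact leafRel_rebase hv

lemma dist_le_of_rebase {T : GHSpace} {v p : ℤ × ℤ} (hv : v ∈ T.graph.verts)
    (hp : p + v ∈ T.graph.verts) : T.graph.spanningCoe.dist 0 (p + v) ≤
      T.graph.spanningCoe.dist 0 v + (T.rebase v hv).graph.spanningCoe.dist 0 p := by
  obtain ⟨w, hw⟩ := (T.reachable hv).exists_walk_length_eq_dist
  obtain ⟨w', hw'⟩ :=
    ((T.rebase v hv).reachable ((mem_rebase hv).2 hp)).exists_walk_length_eq_dist
  let f : (T.rebase v hv).graph.spanningCoe →g T.graph.spanningCoe :=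
    ⟨fun p => p + v, fun {a b} h => (rebase_adj hv).1 h⟩
  have h1 := SimpleGraph.dist_le (w.append ((w'.map f).copy (zero_add v) rfl))
  rw [SimpleGraph.Walk.length_append, SimpleGraph.Walk.length_copy,
    SimpleGraph.Walk.length_map, hw, hw'] at h1
  exact h1

lemma rebase_ball_eq {T T' : GHSpace} {v : ℤ × ℤ} {N : ℕ} (hv : v ∈ T.graph.verts)
    (hv' : v ∈ T'.graph.verts)
    (h : T'.ball (T.graph.spanningCoe.dist 0 v + N) = T.ball (T.graph.spanningCoe.dist 0 v + N)) :
    (T'.rebase v hv').ball N = (T.rebase v hv).ball N := by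
  set M := T.graph.spanningCoe.dist 0 v + N with hM
  have key : ∀ {S S' : GHSpace} (hS : v ∈ S.graph.verts) (hS' : v ∈ S'.graph.verts),
      S.ball M = S'.ball M → S.graph.spanningCoe.dist 0 v + N ≤ M →
        (S.rebase v hS).ball N ⊆ (S'.rebase v hS').ball N := by
    intro S S' hS hS' hb hle
    refine ball_subset_of_adj fun a b hab hd _ => ?_
    rw [rebase_adj] at hab ⊢
    have h1 := dist_le_of_rebase hS hab.fst_mem
    have h2 : s(a + v, b + v) ∈ S.ball M := ⟨hab, a + v, by simp, by omega⟩
    rw [hb] at h2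
    exact h2.1
  refine (key hv' hv h ?_).antisymm (key hv hv' h.symm le_rfl)
  have := (dist_le_of_ball_eq h.symm _ v hv rfl (by omega)).2
  omega

end GHSpace

/-! ### Addresses -/

/-- A point `z` of the plane is an address of `T` if `T` is a union of connected components of the
graph of sites translated by `-z`, up to the singular point `-z` of the lattice, if any. -/
structure IsAddress (T : GHSpace) (z : Plane) : Prop where
  mem_sites : ∀ p ∈ T.graph.verts, z + emb p ∈ sites ∨ z + emb p = 0
  adj : ∀ p ∈ T.graph.verts, ∀ q, grid.Adj p q → z + emb p ∈ sites → z + emb q ∈ sites →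
    T.graph.Adj p q

namespace IsAddress

lemma mem_of_reachable {T : GHSpace} {z : Plane} (h : IsAddress T z) {p q : ℤ × ℤ}
    (hp : p ∈ T.graph.verts) (hpq : (siteGraph z).Reachable p q) : q ∈ T.graph.verts := by
  obtain ⟨w⟩ := hpq
  induction w with
  | nil => exact hp
  | cons hab w ih => exact ih (h.adj _ hp _ hab.1 hab.2.1 hab.2.2).snd_mem

lemma rebase {T : GHSpace} {z : Plane} (h : IsAddress T z) {v : ℤ × ℤ}
    (hv : v ∈ T.graph.verts) : IsAddress (T.rebase v hv) (z + emb v) := by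
  have e : ∀ p, z + emb v + emb p = z + emb (p + v) := fun p => by
    rw [map_add, add_assoc, add_comm (emb v)]
  constructor
  · intro p hp
    rw [e]
    exact h.mem_sites _ ((GHSpace.mem_rebase hv).1 hp)
  · intro p hp q hpq h1 h2
    rw [e] at h1 h2
    rw [GHSpace.rebase_adj]
    refine h.adj _ ((GHSpace.mem_rebase hv).1 hp) _ ?_ h1 h2
    simpa [grid_adj_iff] using hpq

lemma exists_mem_sites {T : GHSpace} {z : Plane} (h : IsAddress T z) :
    ∃ p ∈ T.graph.verts, z + emb p ∈ sites := by
  rcases h.mem_sites 0 T.zero_mem with h0 | h0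
  · exact ⟨0, T.zero_mem, h0⟩
  · obtain ⟨u, hu⟩ := T.exists_adj T.zero_mem
    refine ⟨u, hu.snd_mem, (h.mem_sites u hu.snd_mem).resolve_right fun h1 => ?_⟩
    have : (0 : ℤ × ℤ) = u := emb_injective (add_left_cancel (h0.trans h1.symm))
    exact hu.ne this

/-- The address is locally determined modulo `2 ^ n`, because every point with an address contains
a pattern that recognizes the multiples of `2 ^ n`. -/
lemma eventually_deep_sub {T : GHSpace} {z : Plane} (h : IsAddress T z) (n : ℕ) :
    ∀ᶠ T' in 𝓝 T, ∀ z', IsAddress T' z' → Deep n (z' - z) := by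
  obtain ⟨p, hp, hps⟩ := h.exists_mem_sites
  obtain ⟨q, hpq, hqs, hqd⟩ := exists_reachable_deep hps n
  have hq := h.mem_of_reachable hp hpq
  have hseg : ∀ k < n, ∀ e ∈ units, q + 2 ^ k • e ∈ T.graph.verts := by
    intro k hk e he
    exact h.mem_of_reachable hq (siteGraph_reachable_of_deep he hqd hqs
      (Or.inl (Nat.pow_lt_pow_right (by norm_num) hk)))
  have e1 : ∀ k : ℕ, (2 ^ k • ((1 : ℤ), (0 : ℤ))) = (2 ^ k, 0) := fun k => by simp
  have e2 : ∀ k : ℕ, (2 ^ k • ((0 : ℤ), (1 : ℤ))) = (0, 2 ^ k) := fun k => by simp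
  have hev : ∀ e ∈ units, ∀ᶠ T' in 𝓝 T, ∀ k ∈ Finset.range n, q + 2 ^ k • e ∈ T'.graph.verts :=
    fun e he => (Finset.range n).eventually_all.2 fun k hk =>
      GHSpace.eventually_mem_verts (hseg k (Finset.mem_range.1 hk) e he)
  filter_upwards [GHSpace.eventually_mem_verts hq, hev (1, 0) (by simp [units]),
    hev (0, 1) (by simp [units])] with T' h0 h1 h2 z' hz'
  have hd : Deep n (z' + emb q) := by
    refine deep_of_pattern (hz'.mem_sites _ h0) (fun k hk => ?_) (fun k hk => ?_)
    · have := hz'.mem_sites _ (h1 k (Finset.mem_range.2 hk))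
      rwa [e1, map_add, ← add_assoc] at this
    · have := hz'.mem_sites _ (h2 k (Finset.mem_range.2 hk))
      rwa [e2, map_add, ← add_assoc] at this
  have := hd.sub hqd
  rwa [add_sub_add_right_eq_sub] at this

lemma unique {T : GHSpace} {z z' : Plane} (h : IsAddress T z) (h' : IsAddress T z') : z = z' := by
  have : z' - z = 0 := eq_zero_of_forall_deep fun n => (h.eventually_deep_sub n).self_of_nhds _ h'
  exact (sub_eq_zero.1 this).symm

end IsAddress

/-- The length of the shortest lattice path from the origin to `p`. -/
def normOne (p : ℤ × ℤ) : ℕ := p.1.natAbs + p.2.natAbs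

lemma normOne_le_succ {p q : ℤ × ℤ} (h : grid.Adj p q) : normOne q ≤ normOne p + 1 := by
  obtain ⟨a, b⟩ := p
  obtain ⟨c, d⟩ := q
  simp only [grid, mem_insert_iff, mem_singleton_iff, Prod.mk_sub_mk, Prod.mk.injEq] at h
  simp only [normOne]
  omega

lemma normOne_le_dist {T : GHSpace} {p : ℤ × ℤ} (hp : p ∈ T.graph.verts) :
    normOne p ≤ T.graph.spanningCoe.dist 0 p := by
  have key : ∀ {a b : ℤ × ℤ} (w : T.graph.spanningCoe.Walk a b),
      normOne b ≤ normOne a + w.length := by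
    intro a b w
    induction w with
    | nil => simp
    | cons h w ih =>
      have := normOne_le_succ (T.graph.adj_sub h)
      rw [SimpleGraph.Walk.length_cons]
      omega
  obtain ⟨w, hw⟩ := (T.reachable hp).exists_walk_length_eq_dist
  have := key w
  have h0 : normOne 0 = 0 := rfl
  omega

/-- The balls of two points agree if their addresses define the same sites in a large box. -/
lemma IsAddress.ball_eq {T T' : GHSpace} {z z' : Plane} (h : IsAddress T z) (h' : IsAddress T' z')
    {N : ℕ} (H : ∀ p, normOne p ≤ N →
      (z' + emb p ∈ sites ↔ z + emb p ∈ sites) ∧ z + emb p ≠ 0 ∧ z' + emb p ≠ 0) :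
    T'.ball N = T.ball N := by
  have key : ∀ {S S' : GHSpace} {w w' : Plane}, IsAddress S w → IsAddress S' w' →
      (∀ p, normOne p ≤ N → (w + emb p ∈ sites → w' + emb p ∈ sites) ∧ w + emb p ≠ 0) →
      S.ball N ⊆ S'.ball N := by
    intro S S' w w' hS hS' H
    refine GHSpace.ball_subset_of_adj fun a b hab hd ha => ?_
    have h1 := normOne_le_dist hab.fst_mem
    have h2 := normOne_le_succ (S.graph.adj_sub hab)
    have h3 := H a (by omega)
    have h4 := H b (by omega)
    exact hS'.adj a ha b (S.graph.adj_sub hab)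
      (h3.1 ((hS.mem_sites a hab.fst_mem).resolve_right h3.2))
      (h4.1 ((hS.mem_sites b hab.snd_mem).resolve_right h4.2))
  exact (key h' h fun p hp => ⟨(H p hp).1.1, (H p hp).2.2⟩).antisymm
    (key h h' fun p hp => ⟨(H p hp).1.2, (H p hp).2.1⟩)

lemma exists_forall_box {z : Plane} (hz : ∀ p, z + emb p ≠ 0) (N : ℕ) :
    ∃ n, ∀ z', Deep n (z' - z) → ∀ p, normOne p ≤ N →
      (z' + emb p ∈ sites ↔ z + emb p ∈ sites) ∧ z + emb p ≠ 0 ∧ z' + emb p ≠ 0 := by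
  choose f hf using fun p => exists_forall_mem_sites_iff (hz p)
  refine ⟨(Finset.Icc (-(N : ℤ)) N ×ˢ Finset.Icc (-(N : ℤ)) N).sup f, fun z' h p hp => ?_⟩
  have hmem : p ∈ Finset.Icc (-(N : ℤ)) N ×ˢ Finset.Icc (-(N : ℤ)) N := by
    simp only [normOne] at hp
    simp only [Finset.mem_product, Finset.mem_Icc]
    omega
  have h1 : Deep (f p) (z' + emb p - (z + emb p)) := by
    rw [add_sub_add_right_eq_sub]
    exact h.mono (Finset.le_sup hmem)
  exact ⟨(hf p _ h1).1, hz p, (hf p _ h1).2⟩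

lemma IsAddress.eq_of_forall_ne {T T' : GHSpace} {z : Plane} (h : IsAddress T z)
    (h' : IsAddress T' z) (hz : ∀ p, z + emb p ≠ 0) : T = T' :=
  GHSpace.eq_of_forall_ball_eq fun _ => (h'.ball_eq h fun p _ => ⟨Iff.rfl, hz p, hz p⟩)

/-! ### The Ghys-Kenyon minimal set -/

lemma mem_ghysKenyonSet {T : GHSpace} : T ∈ ghysKenyonSet ↔
    ∀ N, 1 ≤ N → ∃ T', GHSpace.leafRel kenyonPoint T' ∧ T'.ball N = T.ball N := by
  rw [ghysKenyonSet, mem_closure_iff_nhds]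
  constructor
  · intro h N hN
    obtain ⟨T', h1, h2⟩ := h _ (GHSpace.mem_nhds_iff_ball.2 ⟨N, hN, fun T' h => h⟩)
    exact ⟨T', h2, h1⟩
  · intro h s hs
    obtain ⟨N, hN, h1⟩ := GHSpace.mem_nhds_iff_ball.1 hs
    obtain ⟨T', h2, h3⟩ := h N hN
    exact ⟨T', h1 _ h3, h2⟩

lemma rebase_mem_ghysKenyonSet {T : GHSpace} (hT : T ∈ ghysKenyonSet) {v : ℤ × ℤ}
    (hv : v ∈ T.graph.verts) : T.rebase v hv ∈ ghysKenyonSet := by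
  rw [mem_ghysKenyonSet] at hT ⊢
  intro N hN
  obtain ⟨T', h1, h2⟩ := hT (T.graph.spanningCoe.dist 0 v + N) (by omega)
  have hv' : v ∈ T'.graph.verts := (GHSpace.dist_le_of_ball_eq h2.symm _ v hv rfl (by omega)).1
  exact ⟨T'.rebase v hv', GHSpace.leafRel.trans h1 (GHSpace.leafRel_rebase hv'),
    GHSpace.rebase_ball_eq hv hv' h2⟩

lemma isAddress_kenyonPoint : IsAddress kenyonPoint 0 := by
  constructor
  · intro p hp
    have := mem_kenyonTree.1 hp
    rw [zero_add]
    refine this.imp_right ?_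
    rintro rfl
    simp
  · intro p hp q hpq _ h2
    rw [zero_add] at h2
    exact kenyonTree_adj hp (mem_kenyonTree.2 (Or.inl h2)) hpq

lemma exists_isAddress_of_leafRel {T : GHSpace} (h : GHSpace.leafRel kenyonPoint T) :
    ∃ z, IsAddress T z := by
  obtain ⟨v, hv, rfl⟩ := GHSpace.leafRel_iff.1 h
  exact ⟨_, isAddress_kenyonPoint.rebase hv⟩

lemma setOf_deep_sub_mem_nhds (z : Plane) (n : ℕ) : {w : Plane | Deep n (w - z)} ∈ 𝓝 z := by
  have h1 : ∀ x : ℤ_[2], {y : ℤ_[2] | (2 : ℤ_[2]) ^ n ∣ y - x} ∈ 𝓝 x := by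
    intro x
    refine Filter.mem_of_superset (Metric.closedBall_mem_nhds x
      (ε := (2 : ℝ) ^ (-n : ℤ)) (by positivity)) fun y hy => ?_
    rw [mem_closedBall_iff_norm] at hy
    have := (PadicInt.norm_le_pow_iff_mem_span_pow (y - x) n).1 (by exact_mod_cast hy)
    simpa [Ideal.mem_span_singleton] using this
  have := prod_mem_nhds (h1 z.1) (h1 z.2)
  exact this

/-- Addresses exist throughout the minimal set, by compactness of the plane. -/
lemma exists_isAddress {T : GHSpace} (hT : T ∈ ghysKenyonSet) : ∃ z, IsAddress T z := by
  rw [mem_ghysKenyonSet] at hT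
  choose T' hT' hb using fun N : ℕ => hT (N + 1) (by omega)
  choose v hv using fun N => exists_isAddress_of_leafRel (hT' N)
  obtain ⟨z, φ, hφ, hlim⟩ := CompactSpace.tendsto_subseq v
  have hclose : ∀ n, ∀ᶠ k in atTop, Deep n (v (φ k) - z) := fun n =>
    hlim (setOf_deep_sub_mem_nhds z n)
  have hnhds : Tendsto (fun k => T' (φ k)) atTop (𝓝 T) := by
    intro s hs
    obtain ⟨N, hN, h⟩ := GHSpace.mem_nhds_iff_ball.1 hs
    rw [mem_map]
    filter_upwards [hφ.tendsto_atTop.eventually_ge_atTop N] with k hk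
    exact h _ (GHSpace.ball_eq_of_le (by omega) (hb (φ k)))
  have hsub : ∀ (w : Plane) (p : ℤ × ℤ), w + emb p - (z + emb p) = w - z := fun w p =>
    add_sub_add_right_eq_sub _ _ _
  have hne0 : ∀ s : Plane, s ∈ sites → s ≠ 0 := fun s hs h0 => zero_notMem_sites (h0 ▸ hs)
  refine ⟨z, ?_, ?_⟩
  · intro p hp
    by_contra! h
    obtain ⟨n, hn⟩ := exists_forall_mem_sites_iff h.2
    obtain ⟨k, h1, h2⟩ :=
      ((hclose n).and (hnhds.eventually (GHSpace.eventually_mem_verts hp))).exists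
    have h3 := hn (v (φ k) + emb p) (by rwa [hsub])
    rcases (hv (φ k)).mem_sites p h2 with h4 | h4
    · exact h.1 (h3.1.1 h4)
    · exact h3.2 h4
  · intro p hp q hpq h1 h2
    obtain ⟨n, hn⟩ := exists_forall_mem_sites_iff (hne0 _ h1)
    obtain ⟨m, hm⟩ := exists_forall_mem_sites_iff (hne0 _ h2)
    obtain ⟨k, ⟨h3, h4⟩, h5, h6⟩ := (((hclose n).and (hclose m)).and
      ((hnhds.eventually (GHSpace.eventually_mem_verts hp)).and
        (hnhds.eventually (GHSpace.eventually_adj_iff (q := q) hp)))).exists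
    refine h6.1 ((hv (φ k)).adj p h5 q hpq ?_ ?_)
    · exact (hn _ (by rwa [hsub])).1.2 h1
    · exact (hm _ (by rwa [hsub])).1.2 h2

/-! ### Generic points -/

/-- The points of the plane such that neither a coordinate nor the sum or the difference of the
coordinates is an integer. The last two conditions make the graph of sites connected, and the first
two make the digits of the coordinates not eventually constant. -/
def generic : Set Plane :=
  {z | (∀ m : ℤ, z.1 ≠ m) ∧ (∀ m : ℤ, z.2 ≠ m) ∧ (∀ m : ℤ, z.1 + z.2 ≠ m) ∧
    ∀ m : ℤ, z.1 - z.2 ≠ m}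

lemma add_emb_mem_generic {z : Plane} {v : ℤ × ℤ} : z + emb v ∈ generic ↔ z ∈ generic := by
  have key : ∀ (z : Plane) (v : ℤ × ℤ), z ∈ generic → z + emb v ∈ generic := by
    rintro z v ⟨h1, h2, h3, h4⟩
    refine ⟨fun m h => h1 (m - v.1) ?_, fun m h => h2 (m - v.2) ?_,
      fun m h => h3 (m - v.1 - v.2) ?_, fun m h => h4 (m - v.1 + v.2) ?_⟩ <;>
    · simp only [Prod.fst_add, Prod.snd_add, emb_fst, emb_snd] at h
      push_cast
      linear_combination h
  refine ⟨fun h => ?_, key z v⟩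
  have := key _ (-v) h
  rwa [map_neg, add_neg_cancel_right] at this

lemma add_emb_ne_zero_of_generic {z : Plane} (hz : z ∈ generic) (p : ℤ × ℤ) : z + emb p ≠ 0 := by
  intro h
  refine hz.1 (-p.1) ?_
  have := congrArg Prod.fst h
  simp only [Prod.fst_add, emb_fst, Prod.fst_zero] at this
  push_cast
  linear_combination this

/-- The generic sites: over these, the minimal set is a copy of the plane. -/
def goodSites : Set Plane := sites ∩ generic

/-- The graph of sites seen from a generic site is a point of the minimal set: its balls are those
of the Kenyon tree about a vertex that is close to the site. -/
lemma exists_mem_of_goodSites {z : Plane} (hz : z ∈ goodSites) :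
    ∃ T ∈ ghysKenyonSet, IsAddress T z := by
  obtain ⟨hs, hg⟩ := hz
  have hne := add_emb_ne_zero_of_generic hg
  have h0 : z + emb 0 ∈ sites := by simpa using hs
  let H : grid.Subgraph := (⊤ : grid.Subgraph).induce {p | z + emb p ∈ sites}
  have hadj : ∀ p q, grid.Adj p q → z + emb p ∈ sites → z + emb q ∈ sites → H.Adj p q :=
    fun p q h h1 h2 => ⟨h1, h2, by simpa using h⟩
  have hle : siteGraph z ≤ H.spanningCoe := fun p q h => hadj p q h.1 h.2.1 h.2.2
  let T : GHSpace :=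
    { graph := H
      zero_mem := h0
      connected := connected_of_reachable h0 fun p hp =>
        (siteGraph_reachable hs hg.2.2.1 hg.2.2.2 hp).mono hle
      infinite := by
        obtain ⟨n, hn⟩ := exists_forall_mem_sites_iff (z := z) (by simpa using hne 0)
        refine Set.infinite_of_injective_forall_mem (f := fun k : ℕ => ((2 : ℤ) ^ n * k, (0 : ℤ)))
          ?_ ?_
        · intro k l hkl
          simpa using hkl
        · intro k
          refine (hn _ ?_).1.2 hs
          simp [deep_emb] }
  have hT : IsAddress T z := ⟨fun p hp => Or.inl hp, fun p _ q h h1 h2 => hadj p q h h1 h2⟩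
  refine ⟨T, mem_ghysKenyonSet.2 fun N _ => ?_, hT⟩
  obtain ⟨n, hn⟩ := exists_forall_box hne N
  obtain ⟨v, hv⟩ := exists_emb_approx z n
  have hv' : Deep n (emb v - z) := by simpa using hv.neg
  have hv0 : emb v ∈ sites := by
    have := (hn _ hv' 0 (by simp [normOne])).1.2 h0
    simpa using this
  have hmem : v ∈ kenyonPoint.graph.verts := mem_kenyonTree.2 (Or.inl hv0)
  have haddr := isAddress_kenyonPoint.rebase hmem
  rw [zero_add] at haddr
  exact ⟨_, GHSpace.leafRel_rebase hmem, hT.ball_eq haddr fun p hp => hn _ hv' p hp⟩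

/-! ### The address map -/

/-- The address of a point of the minimal set, which is unique. -/
def address (x : ghysKenyonSet) : Plane := (exists_isAddress x.2).choose

lemma isAddress_address (x : ghysKenyonSet) : IsAddress x (address x) :=
  (exists_isAddress x.2).choose_spec

lemma address_eq {x : ghysKenyonSet} {z : Plane} (h : IsAddress x z) : address x = z :=
  (isAddress_address x).unique h

lemma continuous_of_forall_deep {X : Type*} [TopologicalSpace X] {f : X → Plane}
    (h : ∀ x n, ∀ᶠ y in 𝓝 x, Deep n (f y - f x)) : Continuous f := by
  have key : ∀ g : X → ℤ_[2], (∀ x n, ∀ᶠ y in 𝓝 x, (2 : ℤ_[2]) ^ n ∣ g y - g x) →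
      Continuous g := by
    intro g hg
    refine Metric.continuous_iff'.2 fun x ε hε => ?_
    obtain ⟨n, hn⟩ := PadicInt.exists_pow_neg_lt 2 hε
    filter_upwards [hg x n] with y hy
    rw [dist_eq_norm]
    refine lt_of_le_of_lt ((PadicInt.norm_le_pow_iff_mem_span_pow (g y - g x) n).2 ?_) hn
    simpa [Ideal.mem_span_singleton] using hy
  exact (key _ fun x n => (h x n).mono fun y hy => hy.1).prodMk
    (key _ fun x n => (h x n).mono fun y hy => hy.2)

lemma continuous_address : Continuous address := by
  refine continuous_of_forall_deep fun x n => ?_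
  have := continuous_subtype_val.continuousAt.eventually
    ((isAddress_address x).eventually_deep_sub n)
  filter_upwards [this] with y hy using hy _ (isAddress_address y)

lemma address_mem_sites_or (x : ghysKenyonSet) : address x ∈ sites ∨ address x = 0 := by
  simpa using (isAddress_address x).mem_sites 0 x.1.zero_mem

lemma mem_goodSites_of_generic {x : ghysKenyonSet} (h : address x ∈ generic) :
    address x ∈ goodSites := by
  refine ⟨(address_mem_sites_or x).resolve_right fun h0 => ?_, h⟩
  exact add_emb_ne_zero_of_generic h 0 (by simpa using h0)

lemma exists_address_eq_of_rel {x y : ghysKenyonSet} (h : ghysKenyonRel x y) :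
    ∃ v, address y = address x + emb v := by
  obtain ⟨v, hv, hy⟩ := GHSpace.leafRel_iff.1 h
  have := (isAddress_address x).rebase hv
  rw [← hy] at this
  exact ⟨v, address_eq this⟩

lemma rel_of_address_eq {x y : ghysKenyonSet} (hx : address x ∈ goodSites)
    (hy : address y ∈ goodSites) {v : ℤ × ℤ} (h : address y = address x + emb v) :
    ghysKenyonRel x y := by
  have hv : v ∈ x.1.graph.verts := by
    refine (isAddress_address x).mem_of_reachable x.1.zero_mem ?_
    exact siteGraph_reachable hx.1 hx.2.2.2.1 hx.2.2.2.2 (h ▸ hy.1)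
  refine GHSpace.leafRel_iff.2 ⟨v, hv, ?_⟩
  refine IsAddress.eq_of_forall_ne (h ▸ isAddress_address y) ((isAddress_address x).rebase hv)
    (add_emb_ne_zero_of_generic ?_)
  exact h ▸ hy.2

lemma address_injOn : InjOn address (address ⁻¹' generic) := by
  intro x hx y hy h
  have h1 := isAddress_address x
  rw [h] at h1
  exact Subtype.ext (h1.eq_of_forall_ne (isAddress_address y) (add_emb_ne_zero_of_generic hy))

/-- The point of the minimal set over a generic site. -/
def treeAt (z : goodSites) : ghysKenyonSet :=
  ⟨(exists_mem_of_goodSites z.2).choose, (exists_mem_of_goodSites z.2).choose_spec.1⟩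

lemma isAddress_treeAt (z : goodSites) : IsAddress (treeAt z) z :=
  (exists_mem_of_goodSites z.2).choose_spec.2

lemma address_treeAt (z : goodSites) : address (treeAt z) = z := address_eq (isAddress_treeAt z)

lemma treeAt_address {x : ghysKenyonSet} (hx : address x ∈ goodSites) :
    treeAt ⟨address x, hx⟩ = x :=
  address_injOn (by rw [mem_preimage, address_treeAt]; exact hx.2) hx.2 (address_treeAt _)

lemma continuous_treeAt : Continuous treeAt := by
  refine continuous_induced_rng.2 (continuous_iff_continuousAt.2 fun z s hs => ?_)
  obtain ⟨N, hN, h⟩ := GHSpace.mem_nhds_iff_ball.1 hs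
  obtain ⟨n, hn⟩ := exists_forall_box (add_emb_ne_zero_of_generic z.2.2) N
  have : ∀ᶠ w : goodSites in 𝓝 z, Deep n ((w : Plane) - z) :=
    continuous_subtype_val.continuousAt.eventually (setOf_deep_sub_mem_nhds z n)
  rw [mem_map]
  filter_upwards [this] with w hw
  exact h _ ((isAddress_treeAt z).ball_eq (isAddress_treeAt w) fun p hp => hn _ hw p hp)

/-! ### Cylinders of the plane -/

/-- The residue class of `a` modulo `2 ^ n`. -/
def cylinder (n : ℕ) (a : ℤ × ℤ) : Set Plane := {z | Deep n (z - emb a)}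

lemma emb_mem_cylinder (n : ℕ) (a : ℤ × ℤ) : emb a ∈ cylinder n a := by
  simp [cylinder, Deep]

lemma cylinder_eq_of_mem {n : ℕ} {a b : ℤ × ℤ} {z : Plane} (ha : z ∈ cylinder n a)
    (hb : z ∈ cylinder n b) : cylinder n a = cylinder n b := by
  ext w
  have hab : Deep n (emb a - emb b) := by
    have := Deep.sub hb ha
    rwa [sub_sub_sub_cancel_left] at this
  constructor
  · intro h
    have := Deep.add h hab
    rwa [sub_add_sub_cancel] at this
  · intro h
    have := Deep.sub h hab
    rwa [sub_sub_sub_cancel_right] at this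

lemma cylinder_eq {n : ℕ} {a b : ℤ × ℤ} (h : Deep n (emb (a - b))) :
    cylinder n a = cylinder n b :=
  cylinder_eq_of_mem (emb_mem_cylinder n a) (by rwa [map_sub] at h)

lemma cylinder_subset {m n : ℕ} {a b : ℤ × ℤ} {z : Plane} (hmn : m ≤ n) (ha : z ∈ cylinder m a)
    (hb : z ∈ cylinder n b) : cylinder n b ⊆ cylinder m a := by
  intro w hw
  have h1 : z ∈ cylinder m b := Deep.mono hmn hb
  rw [cylinder_eq_of_mem ha h1]
  exact Deep.mono hmn hw

lemma exists_mem_cylinder (n : ℕ) (z : Plane) : ∃ a, z ∈ cylinder n a := exists_emb_approx z n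

lemma isOpen_cylinder (n : ℕ) (a : ℤ × ℤ) : IsOpen (cylinder n a) := by
  rw [isOpen_iff_mem_nhds]
  intro z hz
  filter_upwards [setOf_deep_sub_mem_nhds z n] with w hw
  have := Deep.add hw hz
  rwa [sub_add_sub_cancel] at this

lemma measurableSet_cylinder (n : ℕ) (a : ℤ × ℤ) : MeasurableSet (cylinder n a) :=
  (isOpen_cylinder n a).measurableSet

lemma isTopologicalBasis_cylinder :
    TopologicalSpace.IsTopologicalBasis {s | ∃ n a, s = cylinder n a} := by
  refine TopologicalSpace.isTopologicalBasis_of_isOpen_of_nhds ?_ ?_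
  · rintro _ ⟨n, a, rfl⟩
    exact isOpen_cylinder n a
  · intro z u hz hu
    obtain ⟨ε, hε, hball⟩ := Metric.isOpen_iff.1 hu z hz
    obtain ⟨n, hn⟩ := PadicInt.exists_pow_neg_lt 2 hε
    obtain ⟨a, ha⟩ := exists_mem_cylinder n z
    refine ⟨_, ⟨n, a, rfl⟩, ha, fun w hw => hball ?_⟩
    have h : Deep n (w - z) := by
      have := Deep.sub hw ha
      rwa [sub_sub_sub_cancel_right] at this
    have key : ∀ x : ℤ_[2], (2 : ℤ_[2]) ^ n ∣ x → ‖x‖ < ε := fun x hx =>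
      lt_of_le_of_lt ((PadicInt.norm_le_pow_iff_mem_span_pow x n).2
        (by simpa [Ideal.mem_span_singleton] using hx)) hn
    rw [mem_ball_iff_norm, Prod.norm_def]
    exact max_lt (key _ h.1) (key _ h.2)

lemma measure_ext_of_cylinder {ρ ρ' : Measure Plane} [IsProbabilityMeasure ρ]
    [IsProbabilityMeasure ρ'] (h : ∀ n a, ρ (cylinder n a) = ρ' (cylinder n a)) : ρ = ρ' := by
  refine ext_of_generate_finite {s | ∃ n a, s = cylinder n a} ?_ ?_ ?_ (by simp)
  · rw [← isTopologicalBasis_cylinder.borel_eq_generateFrom]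
    exact BorelSpace.measurable_eq
  · rintro _ ⟨m, a, rfl⟩ _ ⟨n, b, rfl⟩ ⟨z, hz1, hz2⟩
    rcases le_total m n with hmn | hmn
    · exact ⟨n, b, inter_eq_right.2 (cylinder_subset hmn hz1 hz2)⟩
    · exact ⟨m, a, inter_eq_left.2 (cylinder_subset hmn hz2 hz1)⟩
  · rintro _ ⟨n, a, rfl⟩
    exact h n a

/-- Representatives of the residue classes modulo `2 ^ n`. -/
def box (n : ℕ) : Finset (ℤ × ℤ) := Finset.Ico 0 (2 ^ n) ×ˢ Finset.Ico 0 (2 ^ n)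

lemma exists_mem_box (n : ℕ) (z : Plane) : ∃ a ∈ box n, z ∈ cylinder n a := by
  obtain ⟨a, ha⟩ := exists_mem_cylinder n z
  have hr : (0 : ℤ) < 2 ^ n := by positivity
  refine ⟨(a.1 % 2 ^ n, a.2 % 2 ^ n), ?_, ?_⟩
  · simp only [box, Finset.mem_product, Finset.mem_Ico]
    exact ⟨⟨Int.emod_nonneg _ hr.ne', Int.emod_lt_of_pos _ hr⟩,
      Int.emod_nonneg _ hr.ne', Int.emod_lt_of_pos _ hr⟩
  · rwa [← cylinder_eq (a := a)]
    rw [deep_emb]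
    exact ⟨Int.dvd_self_sub_emod, Int.dvd_self_sub_emod⟩

lemma pairwiseDisjoint_box (n : ℕ) : (box n : Set (ℤ × ℤ)).PairwiseDisjoint (cylinder n) := by
  intro a ha b hb hab
  refine Set.disjoint_left.2 fun z hza hzb => hab ?_
  have h1 : emb a ∈ cylinder n b := cylinder_eq_of_mem hza hzb ▸ emb_mem_cylinder n a
  have h2 : Deep n (emb (a - b)) := by rw [map_sub]; exact h1
  rw [deep_emb] at h2
  simp only [box, Finset.coe_product, Finset.coe_Ico, mem_prod, mem_Ico] at ha hb
  refine Prod.ext ?_ ?_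
  · exact sub_eq_zero.1 (Int.eq_zero_of_abs_lt_dvd h2.1 (by rw [abs_lt]; omega))
  · exact sub_eq_zero.1 (Int.eq_zero_of_abs_lt_dvd h2.2 (by rw [abs_lt]; omega))

lemma measure_eq_sum_box (ρ : Measure Plane) (n : ℕ) {s : Set Plane} (hs : MeasurableSet s) :
    ρ s = ∑ a ∈ box n, ρ (s ∩ cylinder n a) := by
  rw [← measure_biUnion_finset]
  · congr 1
    ext z
    simp only [mem_iUnion, mem_inter_iff, exists_prop]
    refine ⟨fun h => ?_, fun ⟨a, _, h, _⟩ => h⟩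
    obtain ⟨a, ha, hz⟩ := exists_mem_box n z
    exact ⟨a, ha, h, hz⟩
  · exact (pairwiseDisjoint_box n).mono fun a => inter_subset_right
  · exact fun a _ => hs.inter (measurableSet_cylinder n a)

lemma isOpen_sites : IsOpen sites := by
  rw [isOpen_iff_mem_nhds]
  intro z hz
  obtain ⟨n, hn⟩ := exists_forall_mem_sites_iff (z := z)
    fun h => zero_notMem_sites (h ▸ hz)
  filter_upwards [setOf_deep_sub_mem_nhds z n] with w hw using (hn w hw).1.2 hz

lemma measurableSet_sites : MeasurableSet sites := isOpen_sites.measurableSet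

lemma mem_sites_of_deep_sub {n : ℕ} {z w : Plane} (hz : z ∈ sites) (hn : ¬ Deep n z)
    (h : Deep n (w - z)) : w ∈ sites := by
  obtain ⟨k, hk⟩ := not_forall.1 hz
  obtain ⟨m, hm, hk⟩ : ∃ m ≤ n, ¬ ((2 : ℤ_[2]) ^ m ∣ z.1 ↔ (2 : ℤ_[2]) ^ m ∣ z.2) := by
    rcases le_or_gt k n with hkn | hkn
    · exact ⟨k, hkn, hk⟩
    · refine ⟨n, le_rfl, fun h' => hk ?_⟩
      by_cases h1 : (2 : ℤ_[2]) ^ n ∣ z.1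
      · exact absurd ⟨h1, h'.1 h1⟩ hn
      · exact iff_of_false (fun h2 => h1 ((pow_dvd_pow _ hkn.le).trans h2))
          (fun h2 => h1 (h'.2 ((pow_dvd_pow _ hkn.le).trans h2)))
  have h' := h.mono hm
  have e1 : (2 : ℤ_[2]) ^ m ∣ w.1 ↔ (2 : ℤ_[2]) ^ m ∣ z.1 := dvd_iff_dvd_of_dvd_sub h'.1
  have e2 : (2 : ℤ_[2]) ^ m ∣ w.2 ↔ (2 : ℤ_[2]) ^ m ∣ z.2 := dvd_iff_dvd_of_dvd_sub h'.2
  exact fun h2 => hk (by rw [← e1, ← e2]; exact h2 m)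

lemma not_deep_of_deep_sub {n : ℕ} {z w : Plane} (hn : ¬ Deep n z) (h : Deep n (w - z)) :
    ¬ Deep n w := by
  intro hw
  have := hw.sub h
  rw [sub_sub_cancel] at this
  exact hn this

/-- The point `a` is a site and is not a multiple of `2 ^ n`; then its class modulo `2 ^ n` consists
of sites. -/
def Resolved (n : ℕ) (a : ℤ × ℤ) : Prop := emb a ∈ sites ∧ ¬ Deep n (emb a)

lemma Resolved.subset {n : ℕ} {a : ℤ × ℤ} (h : Resolved n a) : cylinder n a ⊆ sites :=
  fun _ hz => mem_sites_of_deep_sub h.1 h.2 hz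

lemma Resolved.not_deep {n : ℕ} {a : ℤ × ℤ} (h : Resolved n a) {z : Plane}
    (hz : z ∈ cylinder n a) : ¬ Deep n z := not_deep_of_deep_sub h.2 hz

lemma cylinder_inter_sites_of_not_resolved {n : ℕ} {a : ℤ × ℤ} (h : ¬ Resolved n a)
    (hd : ¬ Deep n (emb a)) : cylinder n a ∩ sites = ∅ := by
  rw [← disjoint_iff_inter_eq_empty, Set.disjoint_left]
  intro z hz hs
  refine h ⟨?_, hd⟩
  refine mem_sites_of_deep_sub hs (not_deep_of_deep_sub hd hz) ?_
  have := Deep.neg hz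
  rwa [neg_sub] at this

/-! ### Locally invariant measures -/

/-- Invariance under the unit translations, between subsets of the set of sites. -/
def LocallyInvariant (ρ : Measure Plane) : Prop :=
  ∀ e ∈ units, ∀ C : Set Plane, MeasurableSet C → (∀ z ∈ C, z ∈ sites ∧ z - emb e ∈ sites) →
    ρ {z | z + emb e ∈ C} = ρ C

namespace LocallyInvariant

lemma measure_cylinder_add {ρ : Measure Plane} (h : LocallyInvariant ρ) {n : ℕ} {a e : ℤ × ℤ}
    (he : e ∈ units) (ha : Resolved n a) (hb : Resolved n (a + e)) :
    ρ (cylinder n a) = ρ (cylinder n (a + e)) := by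
  have key : ∀ z : Plane, z + emb e - emb (a + e) = z - emb a := fun z => by
    rw [map_add, add_sub_add_right_eq_sub]
  rw [← h e he _ (measurableSet_cylinder n (a + e)) fun z hz => ⟨hb.subset hz, ha.subset ?_⟩]
  · congr 1
    ext z
    simp only [cylinder, mem_ofPred_eq, key]
  · have h1 := key (z - emb e)
    rw [sub_add_cancel] at h1
    change Deep n _ at hz
    rwa [h1] at hz

lemma measure_cylinder_segment {ρ : Measure Plane} (h : LocallyInvariant ρ) {n : ℕ}
    {a e : ℤ × ℤ} (he : e ∈ units) (k : ℕ) (hk : ∀ i ≤ k, Resolved n (a + i • e)) :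
    ρ (cylinder n a) = ρ (cylinder n (a + k • e)) := by
  induction k with
  | zero => simp
  | succ k ih =>
    have e1 : a + (k + 1) • e = a + k • e + e := by rw [succ_nsmul]; abel
    have h1 := hk (k + 1) le_rfl
    rw [ih fun i hi => hk i (by omega)]
    rw [e1] at h1 ⊢
    exact h.measure_cylinder_add he (hk k (by omega)) h1

/-- Cylinders at the ends of a segment of length `2 ^ k` have the same measure. -/
lemma measure_cylinder_move {ρ : Measure Plane} (h : LocallyInvariant ρ) {k n : ℕ} (hkn : k < n)
    {a e : ℤ × ℤ} (he : e ∈ units) (ha : Resolved n a) (hd : Deep k (emb a))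
    (hb : Resolved n (a + 2 ^ k • e)) :
    ρ (cylinder n a) = ρ (cylinder n (a + 2 ^ k • e)) := by
  refine h.measure_cylinder_segment he _ fun i hi => ?_
  rcases Nat.eq_zero_or_pos i with rfl | hpos
  · simpa using ha
  rcases hi.lt_or_eq with hlt | rfl
  · rw [Resolved, map_add]
    refine ⟨deep_add_nsmul_mem_sites he hd hpos.ne' hlt, fun hdn => ?_⟩
    have h1 := (hdn.mono hkn.le).sub hd
    rw [add_sub_cancel_left, deep_emb] at h1
    have h2 : (2 : ℤ) ^ k ∣ i := by
      simp only [units, mem_insert_iff, mem_singleton_iff] at he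
      rcases he with rfl | rfl | rfl | rfl
      · simpa using h1.1
      · simpa using h1.1
      · simpa using h1.2
      · simpa using h1.2
    have h3 := Nat.le_of_dvd hpos (by exact_mod_cast h2 : 2 ^ k ∣ i)
    omega
  · exact hb

/-- Resolved cylinders can be moved to resolved cylinders divisible by larger powers of two. -/
lemma exists_climb_cylinder {ρ : Measure Plane} (h : LocallyInvariant ρ) {k n : ℕ}
    (hkn : k + 1 < n) {a : ℤ × ℤ} (ha : Resolved n a) (hd : Deep k (emb a)) :
    ∃ b, Resolved n b ∧ Deep (k + 1) (emb b) ∧ ρ (cylinder n a) = ρ (cylinder n b) := by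
  by_cases hd' : Deep (k + 1) (emb a)
  · exact ⟨a, ha, hd', rfl⟩
  obtain ⟨e, he, hs, hd1⟩ := exists_climb hd ha.1 hd'
  rw [← map_add] at hs hd1
  by_cases hn : Deep n (emb (a + 2 ^ k • e))
  · -- This end of the segment is not resolved, and the opposite one differs by `2 ^ (k + 1)`.
    have e1 : a + 2 ^ k • (-e) = a + 2 ^ k • e + 2 ^ (k + 1) • (-e) := by
      rw [pow_succ, mul_nsmul, two_nsmul, smul_neg]
      abel
    have hdeep : ¬ Deep n (emb (2 ^ (k + 1) • (-e))) := by
      rw [deep_emb]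
      have hnd : ¬ (2 : ℤ) ^ n ∣ 2 ^ (k + 1) := by
        rw [pow_dvd_pow_iff two_ne_zero (by decide)]
        omega
      rintro ⟨h1, h2⟩
      simp only [units, mem_insert_iff, mem_singleton_iff] at he
      rcases he with rfl | rfl | rfl | rfl
      · exact hnd (by simpa using h1)
      · exact hnd (by simpa using h1)
      · exact hnd (by simpa using h2)
      · exact hnd (by simpa using h2)
    have hb : Resolved n (a + 2 ^ k • (-e)) := by
      rw [e1, Resolved, map_add]
      refine ⟨deep_add_nsmul_mem_sites (neg_mem_units he) hn (by positivity)
        (Nat.pow_lt_pow_right (by norm_num) hkn), fun h1 => hdeep ?_⟩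
      have := h1.sub hn
      rwa [add_sub_cancel_left] at this
    refine ⟨_, hb, ?_, h.measure_cylinder_move (by omega) (neg_mem_units he) ha hd hb⟩
    rw [e1, map_add]
    refine hd1.add ?_
    rw [deep_emb]
    simp
  · exact ⟨_, ⟨hs, hn⟩, hd1, h.measure_cylinder_move (by omega) he ha hd ⟨hs, hn⟩⟩

/-- A resolved cylinder can be moved to the cylinder of `(2 ^ m, 0)` or to that of `(0, 2 ^ m)`. -/
lemma measure_cylinder_eq_or {ρ : Measure Plane} (h : LocallyInvariant ρ) {m : ℕ} {a : ℤ × ℤ}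
    (ha : Resolved (m + 1) a) : ρ (cylinder (m + 1) a) = ρ (cylinder (m + 1) (2 ^ m, 0)) ∨
      ρ (cylinder (m + 1) a) = ρ (cylinder (m + 1) (0, 2 ^ m)) := by
  have key : ∀ k ≤ m, ∃ b, Resolved (m + 1) b ∧ Deep k (emb b) ∧
      ρ (cylinder (m + 1) a) = ρ (cylinder (m + 1) b) := by
    intro k
    induction k with
    | zero => exact fun _ => ⟨a, ha, deep_zero _, rfl⟩
    | succ k ih =>
      intro hk
      obtain ⟨b, hb, hd, e1⟩ := ih (by omega)
      obtain ⟨c, hc, hd', e2⟩ := h.exists_climb_cylinder (by omega) hb hd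
      exact ⟨c, hc, hd', e1.trans e2⟩
  obtain ⟨b, hb, hd, e1⟩ := key m le_rfl
  have hnd := not_pow_succ_dvd_pow m
  by_cases h1 : (2 : ℤ_[2]) ^ (m + 1) ∣ (emb b).1
  · right
    have h2 : ¬ (2 : ℤ_[2]) ^ (m + 1) ∣ (emb b).2 := fun h2 => hb.2 ⟨h1, h2⟩
    rw [e1, cylinder_eq]
    rw [map_sub]
    refine ⟨by simpa using h1, ?_⟩
    simpa using pow_succ_dvd_sub hd.2 dvd_rfl h2 hnd
  · left
    have h2 : (2 : ℤ_[2]) ^ (m + 1) ∣ (emb b).2 := by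
      by_contra h2
      exact notMem_sites_of_deep hd h1 h2 hb.1
    rw [e1, cylinder_eq]
    rw [map_sub]
    refine ⟨?_, by simpa using h2⟩
    simpa using pow_succ_dvd_sub hd.1 dvd_rfl h1 hnd

lemma swap {ρ : Measure Plane} (h : LocallyInvariant ρ) : LocallyInvariant (ρ.map Prod.swap) := by
  intro e he C hC hCs
  have hm : Measurable fun z : Plane => z + emb e := measurable_add_const _
  change ρ.map Prod.swap ((fun z : Plane => z + emb e) ⁻¹' C) = _
  rw [Measure.map_apply measurable_swap hC, Measure.map_apply measurable_swap (hm hC)]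
  have he' : e.swap ∈ units := by
    simp only [units, mem_insert_iff, mem_singleton_iff] at he ⊢
    rcases he with rfl | rfl | rfl | rfl <;> simp
  refine h e.swap he' _ (measurable_swap hC) fun z hz => ?_
  have := hCs _ hz
  exact ⟨swap_mem_sites.1 this.1, swap_mem_sites.1 this.2⟩

end LocallyInvariant

lemma map_swap_cylinder (ρ : Measure Plane) (n : ℕ) (a b : ℤ) :
    ρ.map Prod.swap (cylinder n (a, b)) = ρ (cylinder n (b, a)) := by
  rw [Measure.map_apply measurable_swap (measurableSet_cylinder _ _)]
  congr 1
  ext z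
  exact and_comm

lemma measure_cylinder_eq_add (ρ : Measure Plane) (n : ℕ) (a b : ℤ) :
    ρ (cylinder n (a, b)) = ρ (cylinder (n + 1) (a, b)) + ρ (cylinder (n + 1) (a + 2 ^ n, b)) +
      ρ (cylinder (n + 1) (a, b + 2 ^ n)) + ρ (cylinder (n + 1) (a + 2 ^ n, b + 2 ^ n)) := by
  have hnd := not_pow_succ_dvd_pow n
  have hsplit : ∀ x : ℤ_[2], (2 : ℤ_[2]) ^ n ∣ x ↔
      (2 : ℤ_[2]) ^ (n + 1) ∣ x ∨ (2 : ℤ_[2]) ^ (n + 1) ∣ x - 2 ^ n := by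
    intro x
    constructor
    · intro h
      by_cases h1 : (2 : ℤ_[2]) ^ (n + 1) ∣ x
      · exact Or.inl h1
      · exact Or.inr (pow_succ_dvd_sub h dvd_rfl h1 hnd)
    · rintro (h | h)
      · exact (pow_dvd_pow _ n.le_succ).trans h
      · have := dvd_add ((pow_dvd_pow _ n.le_succ).trans h) (dvd_refl ((2 : ℤ_[2]) ^ n))
        rwa [sub_add_cancel] at this
  have hdisj : ∀ x : ℤ_[2], (2 : ℤ_[2]) ^ (n + 1) ∣ x → ¬ (2 : ℤ_[2]) ^ (n + 1) ∣ x - 2 ^ n :=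
    fun x h h' => hnd ((dvd_sub_right h).1 h')
  have hm := measurableSet_cylinder (n + 1)
  have e : ∀ c : ℤ, ∀ x : ℤ_[2], x - ((c + 2 ^ n : ℤ) : ℤ_[2]) = x - c - 2 ^ n := by
    intro c x
    push_cast
    ring
  rw [← measure_union _ (hm _), ← measure_union _ (hm _), ← measure_union _ (hm _)]
  · congr 1
    ext z
    simp only [cylinder, mem_union, mem_ofPred_eq, Deep, Prod.fst_sub, Prod.snd_sub, emb_fst,
      emb_snd, e, hsplit]
    tauto
  all_goals
    refine Set.disjoint_left.2 fun z => ?_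
    have h1 := hdisj (z.1 - a)
    have h2 := hdisj (z.2 - b)
    simp only [cylinder, mem_union, mem_ofPred_eq, Deep, Prod.fst_sub, Prod.snd_sub, emb_fst,
      emb_snd, e]
    tauto

lemma pow_succ_dvd_pow_mul {m : ℕ} {u : ℤ} :
    (2 : ℤ_[2]) ^ (m + 1) ∣ ((2 ^ m * u : ℤ) : ℤ_[2]) ↔ (2 : ℤ) ∣ u := by
  rw [pow_dvd_intCast, pow_succ]
  exact mul_dvd_mul_iff_left (by positivity)

lemma resolved_of_odd_even {m n : ℕ} (hmn : m < n) {u v : ℤ} (hu : ¬ (2 : ℤ) ∣ u)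
    (hv : (2 : ℤ) ∣ v) : Resolved n (2 ^ m * u, 2 ^ m * v) := by
  have h1 : ¬ (2 : ℤ_[2]) ^ (m + 1) ∣ (emb (2 ^ m * u, 2 ^ m * v)).1 := by
    rwa [emb_fst, pow_succ_dvd_pow_mul]
  refine ⟨mem_sites_of_dvd' h1 ?_, fun h => h1 (h.mono hmn).1⟩
  rwa [emb_snd, pow_succ_dvd_pow_mul]

lemma resolved_of_even_odd {m n : ℕ} (hmn : m < n) {u v : ℤ} (hu : (2 : ℤ) ∣ u)
    (hv : ¬ (2 : ℤ) ∣ v) : Resolved n (2 ^ m * u, 2 ^ m * v) := by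
  have h1 : ¬ (2 : ℤ_[2]) ^ (m + 1) ∣ (emb (2 ^ m * u, 2 ^ m * v)).2 := by
    rwa [emb_snd, pow_succ_dvd_pow_mul]
  refine ⟨mem_sites_of_dvd ?_ h1, fun h => h1 (h.mono hmn).2⟩
  rwa [emb_fst, pow_succ_dvd_pow_mul]

namespace LocallyInvariant

/-- Of the four parts of the cylinder of `(2 ^ m, 0)`, two can be moved to `(2 ^ (m + 1), 0)` and
two to `(0, 2 ^ (m + 1))`. -/
lemma measure_cylinder_horizontal {ρ : Measure Plane} (h : LocallyInvariant ρ) (m : ℕ) :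
    ρ (cylinder (m + 1) (2 ^ m, 0)) = 2 * ρ (cylinder (m + 2) (2 ^ (m + 1), 0)) +
      2 * ρ (cylinder (m + 2) (0, 2 ^ (m + 1))) := by
  have move : ∀ u v s t : ℤ, (¬ (2 : ℤ) ∣ u) → (s = 1 ∨ s = -1) → u + s = 2 * t →
      Resolved (m + 2) (2 ^ (m + 1) * t, 2 ^ (m + 1) * v) →
      ρ (cylinder (m + 2) (2 ^ m * u, 2 ^ (m + 1) * v)) =
        ρ (cylinder (m + 2) (2 ^ (m + 1) * t, 2 ^ (m + 1) * v)) := by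
    intro u v s t hu hs ht hr
    have he : (s, (0 : ℤ)) ∈ units := by rcases hs with rfl | rfl <;> simp [units]
    have e : ((2 ^ m * u, 2 ^ (m + 1) * v) : ℤ × ℤ) + 2 ^ m • (s, 0) =
        (2 ^ (m + 1) * t, 2 ^ (m + 1) * v) := by
      refine Prod.ext ?_ ?_
      · rw [Prod.fst_add, Prod.smul_fst, nsmul_eq_mul]
        push_cast
        linear_combination 2 ^ m * ht
      · simp
    have hstart : Resolved (m + 2) (2 ^ m * u, 2 ^ (m + 1) * v) := by
      rw [pow_succ, mul_assoc]
      exact resolved_of_odd_even (by omega) hu (dvd_mul_right 2 v)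
    have hd : Deep m (emb (2 ^ m * u, 2 ^ (m + 1) * v)) :=
      deep_emb.2 ⟨dvd_mul_right _ _, ⟨2 * v, by simp only; ring⟩⟩
    have := h.measure_cylinder_move (k := m) (n := m + 2) (by omega) he hstart hd (e ▸ hr)
    rwa [e] at this
  have h1 := move 1 0 1 1 (by decide) (Or.inl rfl) rfl
    (resolved_of_odd_even (by omega) (by decide) (by decide))
  have h2 := move 3 0 (-1) 1 (by decide) (Or.inr rfl) rfl
    (resolved_of_odd_even (by omega) (by decide) (by decide))
  have h3 := move 1 1 (-1) 0 (by decide) (Or.inr rfl) rfl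
    (resolved_of_even_odd (by omega) (by decide) (by decide))
  have h4 := move 3 1 1 2 (by decide) (Or.inl rfl) rfl
    (resolved_of_even_odd (by omega) (by decide) (by decide))
  have h5 : cylinder (m + 2) (2 ^ (m + 1) * 2, 2 ^ (m + 1) * 1) =
      cylinder (m + 2) (0, 2 ^ (m + 1)) := by
    refine cylinder_eq (deep_emb.2 ⟨?_, ?_⟩)
    · exact ⟨1, by simp only [Prod.fst_sub]; ring⟩
    · exact ⟨0, by simp only [Prod.snd_sub]; ring⟩
  rw [h5] at h4
  have r1 : (2 : ℤ) ^ m + 2 ^ (m + 1) = 2 ^ m * 3 := by ring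
  simp only [mul_one, mul_zero] at h1 h2 h3 h4
  rw [measure_cylinder_eq_add, r1, zero_add, h1, h2, h3, h4]
  ring

/-- The formula of `measure_cylinder_horizontal` is symmetric in the two coordinates. -/
lemma measure_cylinder_vertical {ρ : Measure Plane} (h : LocallyInvariant ρ) (m : ℕ) :
    ρ (cylinder (m + 1) (2 ^ m, 0)) = ρ (cylinder (m + 1) (0, 2 ^ m)) := by
  have h1 := h.measure_cylinder_horizontal m
  have h2 := h.swap.measure_cylinder_horizontal m
  rw [map_swap_cylinder, map_swap_cylinder, map_swap_cylinder] at h2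
  rw [h1, h2, add_comm]

/-- All resolved cylinders of the same size have the same measure. -/
lemma measure_cylinder {ρ : Measure Plane} (h : LocallyInvariant ρ) {m : ℕ} {a : ℤ × ℤ}
    (ha : Resolved (m + 1) a) : 4 ^ m * ρ (cylinder (m + 1) a) = ρ (cylinder 1 (1, 0)) := by
  have h1 : ∀ m, 4 ^ m * ρ (cylinder (m + 1) (2 ^ m, 0)) = ρ (cylinder 1 (1, 0)) := by
    intro m
    induction m with
    | zero => simp
    | succ m ih =>
      rw [← ih, h.measure_cylinder_horizontal m, ← h.measure_cylinder_vertical (m + 1), pow_succ]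
      ring
  rw [← h1 m]
  rcases h.measure_cylinder_eq_or ha with h2 | h2
  · rw [h2]
  · rw [h2, h.measure_cylinder_vertical]

end LocallyInvariant

open Classical in
lemma LocallyInvariant.measure_sites_not_deep {ρ : Measure Plane} (h : LocallyInvariant ρ) (m : ℕ) :
    4 ^ m * ρ {z | z ∈ sites ∧ ¬ Deep (m + 1) z} =
      ((box (m + 1)).filter (Resolved (m + 1))).card * ρ (cylinder 1 (1, 0)) := by
  have hopen : ∀ n, {z | Deep n z} = cylinder n 0 := by intro n; simp [cylinder]
  have hmeas : MeasurableSet {z | z ∈ sites ∧ ¬ Deep (m + 1) z} := by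
    have := measurableSet_sites.inter (measurableSet_cylinder (m + 1) 0).compl
    rwa [← hopen] at this
  rw [measure_eq_sum_box ρ (m + 1) hmeas, Finset.mul_sum, ← nsmul_eq_mul, ← Finset.sum_const,
    Finset.sum_filter]
  refine Finset.sum_congr rfl fun a _ => ?_
  split_ifs with ha
  · have hsub : cylinder (m + 1) a ⊆ {z | z ∈ sites ∧ ¬ Deep (m + 1) z} :=
      fun z hz => ⟨ha.subset hz, ha.not_deep hz⟩
    rw [← h.measure_cylinder ha, inter_eq_right.2 hsub]
  · convert mul_zero _
    convert measure_empty (μ := ρ)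
    by_cases hd : Deep (m + 1) (emb a)
    · refine eq_empty_of_forall_notMem fun z hz => hz.1.2 ?_
      have := Deep.add hz.2 hd
      rwa [sub_add_cancel] at this
    · have := cylinder_inter_sites_of_not_resolved ha hd
      refine eq_empty_of_forall_notMem fun z hz => ?_
      have : z ∈ cylinder (m + 1) a ∩ sites := ⟨hz.2, hz.1.1⟩
      simp_all

/-- There is at most one locally invariant probability measure on the set of sites. -/
theorem LocallyInvariant.unique {ρ ρ' : Measure Plane} [IsProbabilityMeasure ρ]
    [IsProbabilityMeasure ρ'] (h : LocallyInvariant ρ) (h' : LocallyInvariant ρ')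
    (hs : ρ sitesᶜ = 0) (hs' : ρ' sitesᶜ = 0) : ρ = ρ' := by
  classical
  have hlim : ∀ (τ : Measure Plane) [IsProbabilityMeasure τ], τ sitesᶜ = 0 →
      Tendsto (fun m => τ {z | z ∈ sites ∧ ¬ Deep (m + 1) z}) atTop (𝓝 1) := by
    intro τ _ hτ
    have hmono : Monotone fun m : ℕ => {z | z ∈ sites ∧ ¬ Deep (m + 1) z} :=
      fun m n hmn z hz => ⟨hz.1, fun hd => hz.2 (hd.mono (by omega))⟩
    have := tendsto_measure_iUnion_atTop (μ := τ) hmono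
    have hU : ⋃ m : ℕ, {z | z ∈ sites ∧ ¬ Deep (m + 1) z} = sites := by
      ext z
      simp only [mem_iUnion, mem_ofPred_eq]
      refine ⟨fun ⟨_, hz, _⟩ => hz, fun hz => ?_⟩
      by_contra! hcon
      have : z = 0 := eq_zero_of_forall_deep fun n => (hcon n hz).mono n.le_succ
      exact zero_notMem_sites (this ▸ hz)
    rw [hU, (prob_compl_eq_zero_iff measurableSet_sites).1 hτ] at this
    exact this
  -- Both measures of the set of resolved points are proportional to its number of cylinders.
  have hprop : ∀ m : ℕ, ρ {z | z ∈ sites ∧ ¬ Deep (m + 1) z} * ρ' (cylinder 1 (1, 0)) =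
      ρ' {z | z ∈ sites ∧ ¬ Deep (m + 1) z} * ρ (cylinder 1 (1, 0)) := by
    intro m
    have e1 := h.measure_sites_not_deep m
    have e2 := h'.measure_sites_not_deep m
    refine (ENNReal.mul_right_inj (a := 4 ^ m) (by simp) (by finiteness)).1 ?_
    rw [← mul_assoc, ← mul_assoc, e1, e2]
    ring
  have hfirst : ρ' (cylinder 1 (1, 0)) = ρ (cylinder 1 (1, 0)) := by
    have l1 := ENNReal.Tendsto.mul_const (b := ρ' (cylinder 1 (1, 0))) (hlim ρ hs)
      (Or.inl one_ne_zero)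
    have l2 := ENNReal.Tendsto.mul_const (b := ρ (cylinder 1 (1, 0))) (hlim ρ' hs')
      (Or.inl one_ne_zero)
    simp only [hprop] at l1
    simpa using tendsto_nhds_unique l1 l2
  have hres : ∀ n a, Resolved n a → ρ (cylinder n a) = ρ' (cylinder n a) := by
    intro n a ha
    rcases n with _ | m
    · exact absurd (deep_zero _) ha.2
    · refine (ENNReal.mul_right_inj (a := 4 ^ m) (by simp) (by finiteness)).1 ?_
      rw [h.measure_cylinder ha, h'.measure_cylinder ha, hfirst]
  -- A cylinder is resolved, or contains the origin, or does not meet the set of sites.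
  refine measure_ext_of_cylinder fun n a => ?_
  by_cases ha : Resolved n a
  · exact hres n a ha
  by_cases hd : Deep n (emb a)
  · rcases n with _ | m
    · have : cylinder 0 a = univ := eq_univ_of_forall fun z => deep_zero _
      rw [this, measure_univ, measure_univ]
    · have e0 : ρ {z | z ∈ sites ∧ ¬ Deep (m + 1) z} = ρ' {z | z ∈ sites ∧ ¬ Deep (m + 1) z} := by
        refine (ENNReal.mul_right_inj (a := 4 ^ m) (by simp) (by finiteness)).1 ?_
        rw [h.measure_sites_not_deep, h'.measure_sites_not_deep, hfirst]
      have hset : {z | z ∈ sites ∧ ¬ Deep (m + 1) z} = (cylinder (m + 1) a)ᶜ ∩ sites := by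
        ext z
        have : z ∈ cylinder (m + 1) a ↔ Deep (m + 1) z := by
          refine ⟨fun hz => ?_, fun hz => Deep.sub hz hd⟩
          have := Deep.add hz hd
          rwa [sub_add_cancel] at this
        simp only [mem_inter_iff, mem_compl_iff, this, mem_ofPred_eq, and_comm]
      have hc := (measurableSet_cylinder (m + 1) a).compl
      rw [hset, measure_inter_conull hs, measure_inter_conull hs',
        prob_compl_eq_one_sub (measurableSet_cylinder _ _),
        prob_compl_eq_one_sub (measurableSet_cylinder _ _)] at e0
      exact (ENNReal.sub_right_inj ENNReal.one_ne_top prob_le_one prob_le_one).1 e0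
  · have hsub : cylinder n a ⊆ sitesᶜ := fun z hz hzs => by
      have : z ∈ cylinder n a ∩ sites := ⟨hz, hzs⟩
      rw [cylinder_inter_sites_of_not_resolved ha hd] at this
      exact this
    rw [measure_mono_null hsub hs, measure_mono_null hsub hs']

/-! ### Haar measure on the plane -/

instance : haarTwoAdic.IsAddHaarMeasure := by unfold haarTwoAdic; infer_instance

instance : IsProbabilityMeasure haarTwoAdic := by
  refine ⟨?_⟩
  have := Measure.addHaarMeasure_self (K₀ := (⊤ : TopologicalSpace.PositiveCompacts ℤ_[2]))
  simpa [haarTwoAdic] using this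

lemma setOf_pow_dvd_sub_mem_nhds (x : ℤ_[2]) (n : ℕ) : {y | (2 : ℤ_[2]) ^ n ∣ y - x} ∈ 𝓝 x := by
  have h := setOf_deep_sub_mem_nhds (x, x) n
  have hc : Continuous fun y : ℤ_[2] => ((y, y) : Plane) := by fun_prop
  filter_upwards [hc.continuousAt.preimage_mem_nhds h] with y hy using hy.1

lemma measurableSet_pow_dvd_sub (x : ℤ_[2]) (n : ℕ) :
    MeasurableSet {y | (2 : ℤ_[2]) ^ n ∣ y - x} := by
  refine IsOpen.measurableSet (isOpen_iff_mem_nhds.2 fun y hy => ?_)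
  filter_upwards [setOf_pow_dvd_sub_mem_nhds y n] with w hw
  have := dvd_add hw hy
  rwa [sub_add_sub_cancel] at this

lemma haarTwoAdic_pow_dvd_sub (n : ℕ) (x : ℤ_[2]) :
    2 ^ n * haarTwoAdic {y | (2 : ℤ_[2]) ^ n ∣ y - x} = 1 := by
  have htrans : ∀ n x, haarTwoAdic {y | (2 : ℤ_[2]) ^ n ∣ y - x} =
      haarTwoAdic {y | (2 : ℤ_[2]) ^ n ∣ y} := by
    intro n x
    rw [← measure_preimage_add_right haarTwoAdic (-x) {y | (2 : ℤ_[2]) ^ n ∣ y}]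
    simp [sub_eq_add_neg]
  induction n generalizing x with
  | zero => simp
  | succ n ih =>
    have hsplit : {y | (2 : ℤ_[2]) ^ n ∣ y - x} = {y | (2 : ℤ_[2]) ^ (n + 1) ∣ y - x} ∪
        {y | (2 : ℤ_[2]) ^ (n + 1) ∣ y - (x + 2 ^ n)} := by
      ext y
      simp only [mem_union, mem_ofPred_eq, ← sub_sub]
      constructor
      · intro h
        by_cases h1 : (2 : ℤ_[2]) ^ (n + 1) ∣ y - x
        · exact Or.inl h1
        · exact Or.inr (pow_succ_dvd_sub h dvd_rfl h1 (not_pow_succ_dvd_pow n))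
      · rintro (h | h)
        · exact (pow_dvd_pow _ n.le_succ).trans h
        · exact (dvd_sub_left dvd_rfl).1 ((pow_dvd_pow _ n.le_succ).trans h)
    have hdisj : Disjoint {y | (2 : ℤ_[2]) ^ (n + 1) ∣ y - x}
        {y | (2 : ℤ_[2]) ^ (n + 1) ∣ y - (x + 2 ^ n)} := by
      refine Set.disjoint_left.2 fun y h1 h2 => not_pow_succ_dvd_pow n ?_
      simp only [mem_ofPred_eq, ← sub_sub] at h1 h2
      exact (dvd_sub_right h1).1 h2
    have := ih x
    rw [hsplit, measure_union hdisj (measurableSet_pow_dvd_sub _ _), htrans (n + 1) (x + 2 ^ n),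
      ← htrans (n + 1) x, ← two_mul, ← mul_assoc, ← pow_succ] at this
    exact this

lemma haarTwoAdic_singleton (x : ℤ_[2]) : haarTwoAdic {x} = 0 := by
  have hle : ∀ n : ℕ, haarTwoAdic {x} ≤ (2⁻¹ : ENNReal) ^ n := by
    intro n
    have h1 : haarTwoAdic {x} ≤ haarTwoAdic {y | (2 : ℤ_[2]) ^ n ∣ y - x} :=
      measure_mono (by simp)
    have h2 := haarTwoAdic_pow_dvd_sub n x
    refine h1.trans (le_of_eq ?_)
    rw [← ENNReal.inv_pow]
    exact ENNReal.eq_inv_of_mul_eq_one_left (by rwa [mul_comm])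
  have hlim : Tendsto (fun n : ℕ => (2⁻¹ : ENNReal) ^ n) atTop (𝓝 0) :=
    ENNReal.tendsto_pow_atTop_nhds_zero_of_lt_one (by norm_num)
  exact le_antisymm (ge_of_tendsto' hlim hle) (zero_le)

/-- The Haar probability measure of the plane. -/
def haarPlane : Measure Plane := haarTwoAdic.prod haarTwoAdic

instance : IsProbabilityMeasure haarPlane := by unfold haarPlane; infer_instance

instance : haarPlane.IsAddRightInvariant := by unfold haarPlane; infer_instance

instance : haarPlane.IsOpenPosMeasure := by unfold haarPlane; infer_instance

lemma measurableSet_generic : MeasurableSet generic := by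
  have h : ∀ f : Plane → ℤ_[2], Measurable f → MeasurableSet {z | ∀ m : ℤ, f z ≠ m} := by
    intro f hf
    rw [ofPred_forall]
    exact MeasurableSet.iInter fun m => (hf (measurableSet_singleton _)).compl
  exact (h _ measurable_fst).inter ((h _ measurable_snd).inter
    ((h (fun z => z.1 + z.2) (by fun_prop)).inter (h (fun z => z.1 - z.2) (by fun_prop))))

lemma haarPlane_compl_generic : haarPlane genericᶜ = 0 := by
  have hfib : ∀ f : Plane → ℤ_[2], Measurable f →
      (∀ᵐ x ∂haarTwoAdic, ∀ m : ℤ, ∃ c, ∀ y, f (x, y) = m → y = c) →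
      ∀ᵐ z ∂haarPlane, ∀ m : ℤ, f z ≠ m := by
    intro f hf h
    refine ae_all_iff.2 fun m => ?_
    have hm : MeasurableSet {z | ¬ f z ≠ m} := by
      have e : {z | ¬ f z ≠ m} = f ⁻¹' {(m : ℤ_[2])} := by ext; simp
      rw [e]
      exact hf (measurableSet_singleton _)
    rw [ae_iff, haarPlane, Measure.measure_prod_null hm]
    filter_upwards [h] with x hx
    obtain ⟨c, hc⟩ := hx m
    refine measure_mono_null (t := {c}) (fun y hy => hc y ?_) (haarTwoAdic_singleton c)
    simpa using hy
  have h1 := hfib Prod.fst measurable_fst (by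
    have : ∀ᵐ x ∂haarTwoAdic, ∀ m : ℤ, x ≠ (m : ℤ_[2]) := ae_all_iff.2 fun m => by
      rw [ae_iff]; simpa using haarTwoAdic_singleton (m : ℤ_[2])
    filter_upwards [this] with x hx m
    exact ⟨0, fun y hy => absurd hy (hx m)⟩)
  have h2 := hfib Prod.snd measurable_snd (ae_of_all _ fun x m => ⟨m, fun y hy => hy⟩)
  have h3 := hfib (fun z => z.1 + z.2) (by fun_prop) (ae_of_all _ fun x m =>
    ⟨m - x, fun y hy => by linear_combination hy⟩)
  have h4 := hfib (fun z => z.1 - z.2) (by fun_prop) (ae_of_all _ fun x m =>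
    ⟨x - m, fun y hy => by linear_combination -hy⟩)
  have : ∀ᵐ z ∂haarPlane, z ∈ generic := by
    filter_upwards [h1, h2, h3, h4] with z a b c d using ⟨a, b, c, d⟩
  exact ae_iff.1 this

lemma measurableSet_goodSites : MeasurableSet goodSites :=
  measurableSet_sites.inter measurableSet_generic

lemma haarPlane_goodSites_ne_zero : haarPlane goodSites ≠ 0 := by
  rw [goodSites, measure_inter_conull haarPlane_compl_generic]
  refine (isOpen_sites.measure_pos haarPlane ⟨emb (1, 0), ?_⟩).ne'
  refine mem_sites_of_dvd' (n := 1) ?_ (by simp)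
  simpa using not_pow_succ_dvd_pow 0

/-! ### Binary digits -/

lemma pow_dvd_sub_appr (x : ℤ_[2]) (n : ℕ) : (2 : ℤ_[2]) ^ n ∣ x - (x.appr n : ℕ) := by
  have h := PadicInt.appr_spec n x
  rw [Ideal.mem_span_singleton] at h
  exact_mod_cast h

lemma appr_eq_of_dvd {x : ℤ_[2]} {n c : ℕ} (hc : c < 2 ^ n) (h : (2 : ℤ_[2]) ^ n ∣ x - (c : ℕ)) :
    x.appr n = c := by
  have h1 := dvd_sub h (pow_dvd_sub_appr x n)
  rw [sub_sub_sub_cancel_left] at h1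
  have h2 : (2 : ℤ) ^ n ∣ (x.appr n : ℤ) - c := pow_dvd_intCast.1 (by push_cast; exact h1)
  have h3 := PadicInt.appr_lt x n
  have h4 : |(x.appr n : ℤ) - c| < 2 ^ n := by
    rw [abs_lt]
    have h5 : (c : ℤ) < 2 ^ n := by exact_mod_cast hc
    have h6 : (x.appr n : ℤ) < 2 ^ n := by exact_mod_cast h3
    omega
  have := Int.eq_zero_of_abs_lt_dvd h2 h4
  omega

lemma appr_eq_appr_iff {x y : ℤ_[2]} {n : ℕ} :
    x.appr n = y.appr n ↔ (2 : ℤ_[2]) ^ n ∣ x - y := by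
  constructor
  · intro h
    have := dvd_sub (pow_dvd_sub_appr x n) (pow_dvd_sub_appr y n)
    rwa [h, sub_sub_sub_cancel_right] at this
  · intro h
    refine appr_eq_of_dvd (PadicInt.appr_lt y n) ?_
    have := dvd_add h (pow_dvd_sub_appr y n)
    rwa [sub_add_sub_cancel] at this

/-- The binary digits of a `2`-adic integer. -/
def digits (x : ℤ_[2]) (k : ℕ) : Fin 2 :=
  ⟨x.appr (k + 1) / 2 ^ k, by
    rw [Nat.div_lt_iff_lt_mul (by positivity), ← pow_succ']
    exact PadicInt.appr_lt x (k + 1)⟩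

lemma appr_succ (x : ℤ_[2]) (k : ℕ) :
    x.appr (k + 1) = x.appr k + 2 ^ k * (digits x k : ℕ) := by
  have h1 : x.appr (k + 1) % 2 ^ k = x.appr k := by
    refine (appr_eq_of_dvd (Nat.mod_lt _ (by positivity)) ?_).symm
    have h2 := (pow_dvd_pow (2 : ℤ_[2]) k.le_succ).trans (pow_dvd_sub_appr x (k + 1))
    have h3 : ((x.appr (k + 1) : ℕ) : ℤ_[2]) = ((2 ^ k * (x.appr (k + 1) / 2 ^ k) +
      x.appr (k + 1) % 2 ^ k : ℕ) : ℤ_[2]) := by rw [Nat.div_add_mod]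
    rw [h3] at h2
    push_cast at h2
    rw [add_comm, ← sub_sub] at h2
    exact (dvd_sub_left (dvd_mul_right _ _)).1 h2
  have h2 := Nat.mod_add_div (x.appr (k + 1)) (2 ^ k)
  rw [h1] at h2
  exact h2.symm

lemma digits_eq_iff {x y : ℤ_[2]} {n : ℕ} :
    (∀ k < n, digits x k = digits y k) ↔ (2 : ℤ_[2]) ^ n ∣ x - y := by
  constructor
  · intro h
    rw [← appr_eq_appr_iff]
    induction n with
    | zero => rfl
    | succ n ih => rw [appr_succ, appr_succ, ih fun k hk => h k (by omega), h n (by omega)]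
  · intro h k hk
    have := appr_eq_appr_iff.2 ((pow_dvd_pow _ (by omega : k + 1 ≤ n)).trans h)
    exact Fin.ext (by simp only [digits, this])

lemma digits_injective : Function.Injective digits := fun _ _ h =>
  sub_eq_zero.1 (eq_zero_of_forall_pow_dvd fun _ => digits_eq_iff.1 fun k _ => congrFun h k)

lemma continuous_digits : Continuous digits := by
  refine continuous_pi fun k => continuous_iff_continuousAt.2 fun x => ?_
  refine ContinuousAt.congr (f := fun _ => digits x k) continuousAt_const ?_
  filter_upwards [setOf_pow_dvd_sub_mem_nhds x (k + 1)] with y hy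
  exact (digits_eq_iff.2 hy k (by omega)).symm

lemma digits_surjective : Function.Surjective digits := by
  intro f
  let a : ℕ → ℕ := fun n => ∑ k ∈ Finset.range n, 2 ^ k * (f k : ℕ)
  have ha : ∀ n, a n < 2 ^ n := by
    intro n
    induction n with
    | zero => simp [a]
    | succ n ih =>
      have h1 : a (n + 1) = a n + 2 ^ n * (f n : ℕ) := Finset.sum_range_succ _ _
      have h2 : (f n : ℕ) ≤ 1 := by omega
      have h3 := Nat.mul_le_mul_left (2 ^ n) h2
      rw [h1, pow_succ]
      omega
  have hdvd : ∀ m n, m ≤ n → (2 : ℤ_[2]) ^ m ∣ (a n : ℤ_[2]) - a m := by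
    intro m n hmn
    induction n, hmn using Nat.le_induction with
    | base => simp
    | succ n hmn ih =>
      have h1 : a (n + 1) = a n + 2 ^ n * (f n : ℕ) := Finset.sum_range_succ _ _
      rw [h1]
      push_cast
      rw [add_sub_right_comm]
      exact dvd_add ih ((pow_dvd_pow _ hmn).mul_right _)
  obtain ⟨x, φ, hφ, hlim⟩ := CompactSpace.tendsto_subseq fun n => (a n : ℤ_[2])
  have happr : ∀ n, x.appr n = a n := by
    intro n
    refine appr_eq_of_dvd (ha n) ?_
    obtain ⟨k, h1, h2⟩ := ((hlim.eventually (setOf_pow_dvd_sub_mem_nhds x n)).and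
      (hφ.tendsto_atTop.eventually_ge_atTop n)).exists
    have := dvd_sub (hdvd n _ h2) h1
    simpa using this
  refine ⟨x, funext fun k => Fin.ext ?_⟩
  have h1 := appr_succ x k
  rw [happr, happr, show a (k + 1) = a k + 2 ^ k * (f k : ℕ) from Finset.sum_range_succ _ _] at h1
  exact (Nat.eq_of_mul_eq_mul_left (by positivity) (Nat.add_left_cancel h1)).symm

/-- The binary expansion, as a homeomorphism. -/
def digitsHomeo : ℤ_[2] ≃ₜ (ℕ → Fin 2) :=
  Continuous.homeoOfEquivCompactToT2
    (f := Equiv.ofBijective digits ⟨digits_injective, digits_surjective⟩) continuous_digits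

/-- The binary expansion, as a Borel isomorphism. -/
def digitsEquiv : ℤ_[2] ≃ᵐ (ℕ → Fin 2) := digitsHomeo.toMeasurableEquiv

lemma haarTwoAdic_digits_cylinder (f : ℕ → Fin 2) (n : ℕ) :
    2 ^ n * haarTwoAdic {x | ∀ k < n, digits x k = f k} = 1 := by
  obtain ⟨x, rfl⟩ := digits_surjective f
  rw [← haarTwoAdic_pow_dvd_sub n x]
  simp only [digits_eq_iff]

/-! ### The Bernoulli measure -/

lemma coinMeasure_cylinder (f : ℕ → Fin 2) (n : ℕ) :
    2 ^ n * coinMeasure (PiNat.cylinder f n) = 1 := by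
  have h1 : PiNat.cylinder f n = (Finset.range n : Set ℕ).pi fun i => {f i} := by
    ext g
    simp [PiNat.cylinder]
  rw [h1, coinMeasure, Measure.infinitePi_pi _ fun i _ => measurableSet_singleton _]
  simp only [ProbabilityTheory.uniformOn_univ, Measure.count_singleton, Fintype.card_fin,
    Finset.prod_const, Finset.card_range]
  rw [← mul_pow]
  convert one_pow n
  rw [← mul_div_assoc, mul_one]
  exact ENNReal.div_self (by norm_num) (by norm_num)

/-- The Bernoulli measure is determined by the measures of the cylinders. -/
lemma eq_coinMeasure {P : Measure (ℕ → Fin 2)} [IsProbabilityMeasure P]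
    (h : ∀ f n, 2 ^ n * P (PiNat.cylinder f n) = 1) : P = coinMeasure := by
  have : IsProbabilityMeasure coinMeasure := by unfold coinMeasure; infer_instance
  refine ext_of_generate_finite {s | ∃ (f : ℕ → Fin 2) (n : ℕ), s = PiNat.cylinder f n} ?_ ?_ ?_
    (by simp)
  · rw [← (PiNat.isTopologicalBasis_cylinders _).borel_eq_generateFrom]
    exact BorelSpace.measurable_eq
  · rintro _ ⟨f, m, rfl⟩ _ ⟨g, n, rfl⟩ ⟨x, hx1, hx2⟩
    rw [PiNat.mem_cylinder_iff_eq] at hx1 hx2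
    rw [← hx1, ← hx2]
    rcases le_total m n with hmn | hmn
    · exact ⟨x, n, inter_eq_right.2 (PiNat.cylinder_anti x hmn)⟩
    · exact ⟨x, m, inter_eq_left.2 (PiNat.cylinder_anti x hmn)⟩
  · rintro _ ⟨f, n, rfl⟩
    refine (ENNReal.mul_right_inj (a := 2 ^ n) (by simp) (by finiteness)).1 ?_
    rw [h, coinMeasure_cylinder]

lemma map_digitsEquiv : haarTwoAdic.map digitsEquiv = coinMeasure := by
  have := Measure.isProbabilityMeasure_map (μ := haarTwoAdic) digitsEquiv.measurable.aemeasurable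
  refine eq_coinMeasure fun f n => ?_
  rw [digitsEquiv.map_apply]
  exact haarTwoAdic_digits_cylinder f n

/-- The interleaved binary digits of the two coordinates. -/
def interleave (z : Plane) (n : ℕ) : Fin 2 :=
  if Even n then digits z.1 (n / 2) else digits z.2 (n / 2)

lemma interleave_two_mul (z : Plane) (k : ℕ) : interleave z (2 * k) = digits z.1 k := by
  simp [interleave]

lemma interleave_two_mul_add_one (z : Plane) (k : ℕ) :
    interleave z (2 * k + 1) = digits z.2 k := by
  have h : (2 * k + 1) / 2 = k := by omega
  simp [interleave, h]

lemma forall_interleave {P : ℕ → Fin 2 → Prop} {z : Plane} :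
    (∀ n, P n (interleave z n)) ↔
      (∀ k, P (2 * k) (digits z.1 k)) ∧ ∀ k, P (2 * k + 1) (digits z.2 k) := by
  constructor
  · intro h
    exact ⟨fun k => interleave_two_mul z k ▸ h _, fun k => interleave_two_mul_add_one z k ▸ h _⟩
  · rintro ⟨h1, h2⟩ n
    rcases Nat.even_or_odd' n with ⟨k, rfl | rfl⟩
    · rw [interleave_two_mul]; exact h1 k
    · rw [interleave_two_mul_add_one]; exact h2 k

lemma continuous_interleave : Continuous interleave := by
  refine continuous_pi fun n => ?_
  unfold interleave
  split_ifs
  · exact (continuous_apply _).comp (continuous_digits.comp continuous_fst)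
  · exact (continuous_apply _).comp (continuous_digits.comp continuous_snd)

lemma interleave_bijective : Function.Bijective interleave := by
  constructor
  · intro z w h
    have := (forall_interleave (P := fun n b => b = interleave w n) (z := z)).1 (congrFun h)
    simp only [interleave_two_mul, interleave_two_mul_add_one] at this
    exact Prod.ext (digits_injective (funext this.1)) (digits_injective (funext this.2))
  · intro f
    obtain ⟨x, hx⟩ := digits_surjective fun k => f (2 * k)
    obtain ⟨y, hy⟩ := digits_surjective fun k => f (2 * k + 1)
    refine ⟨(x, y), funext ?_⟩
    exact (forall_interleave (P := fun n b => b = f n)).2 ⟨congrFun hx, congrFun hy⟩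

/-- The interleaved binary expansion, as a Borel isomorphism. -/
def interleaveEquiv : Plane ≃ᵐ (ℕ → Fin 2) :=
  (Continuous.homeoOfEquivCompactToT2
    (f := Equiv.ofBijective interleave interleave_bijective)
    continuous_interleave).toMeasurableEquiv

lemma map_interleaveEquiv : haarPlane.map interleaveEquiv = coinMeasure := by
  have := Measure.isProbabilityMeasure_map (μ := haarPlane) interleaveEquiv.measurable.aemeasurable
  refine eq_coinMeasure fun f n => ?_
  rw [interleaveEquiv.map_apply]
  have hset : interleaveEquiv ⁻¹' PiNat.cylinder f n =
      {x | ∀ k < (n + 1) / 2, digits x k = f (2 * k)} ×ˢ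
        {y | ∀ k < n / 2, digits y k = f (2 * k + 1)} := by
    ext z
    have h1 := forall_interleave (P := fun m b => m < n → b = f m) (z := z)
    have h2 : ∀ k, 2 * k < n ↔ k < (n + 1) / 2 := fun k => by omega
    have h3 : ∀ k, 2 * k + 1 < n ↔ k < n / 2 := fun k => by omega
    simp only [h2, h3] at h1
    exact h1
  have hpow : (2 : ENNReal) ^ n = 2 ^ ((n + 1) / 2) * 2 ^ (n / 2) := by
    rw [← pow_add]
    congr 1
    omega
  rw [hset, haarPlane, Measure.prod_prod, hpow, mul_mul_mul_comm,
    haarTwoAdic_digits_cylinder fun k => f (2 * k),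
    haarTwoAdic_digits_cylinder fun k => f (2 * k + 1), one_mul]

/-! ### Cofinal digits and integer translations -/

lemma exists_int_of_cofinal {x y : ℤ_[2]} (h : cofinalRel (digits x) (digits y)) :
    ∃ m : ℤ, y = x + m := by
  obtain ⟨n, hn⟩ := h
  have key : ∀ m ≥ n, (y.appr m : ℤ) = x.appr m + (y.appr n - x.appr n) := by
    intro m hm
    induction m, hm using Nat.le_induction with
    | base => ring
    | succ m hm ih =>
      rw [appr_succ, appr_succ, hn m hm]
      push_cast
      linarith
  refine ⟨y.appr n - x.appr n, sub_eq_zero.1 (eq_zero_of_forall_pow_dvd fun m => ?_)⟩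
  have h1 := dvd_sub (pow_dvd_sub_appr y (max m n)) (pow_dvd_sub_appr x (max m n))
  have h2 : ((y.appr (max m n) : ℤ) : ℤ_[2]) = _ := congrArg _ (key (max m n) (le_max_right _ _))
  push_cast at h2
  rw [h2] at h1
  refine (pow_dvd_pow _ (le_max_left m n)).trans ?_
  convert h1 using 1
  push_cast
  ring

lemma cofinal_add_one {x : ℤ_[2]} (hx : x ≠ -1) :
    cofinalRel (digits x) (digits (x + 1)) := by
  -- Some digit of `x` vanishes, and the carry stops there.
  obtain ⟨k, hk⟩ : ∃ k, x.appr k + 1 < 2 ^ k := by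
    by_contra! h
    refine hx (eq_neg_of_add_eq_zero_left (eq_zero_of_forall_pow_dvd fun n => ?_))
    have h1 : x.appr n + 1 = 2 ^ n := le_antisymm (PadicInt.appr_lt x n) (h n)
    have h2 : ((x.appr n : ℕ) : ℤ_[2]) + 1 = 2 ^ n := by exact_mod_cast h1
    have h3 := dvd_add (pow_dvd_sub_appr x n) (dvd_of_eq h2.symm)
    convert h3 using 1
    ring
  have hlt : ∀ m ≥ k, x.appr m + 1 < 2 ^ m := by
    intro m hm
    induction m, hm using Nat.le_induction with
    | base => exact hk
    | succ m hm ih =>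
      have h1 : (digits x m : ℕ) ≤ 1 := by omega
      have h2 := Nat.mul_le_mul_left (2 ^ m) h1
      rw [appr_succ, pow_succ]
      omega
  have happr : ∀ m ≥ k, (x + 1).appr m = x.appr m + 1 := by
    intro m hm
    refine appr_eq_of_dvd (hlt m hm) ?_
    push_cast
    rw [add_sub_add_right_eq_sub]
    exact pow_dvd_sub_appr x m
  refine ⟨k, fun m hm => Fin.ext ?_⟩
  have h1 := appr_succ x m
  have h2 := appr_succ (x + 1) m
  rw [happr m hm, happr (m + 1) (by omega), h1] at h2
  have h3 : 2 ^ m * (digits x m : ℕ) = 2 ^ m * (digits (x + 1) m : ℕ) := by omega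
  exact Nat.eq_of_mul_eq_mul_left (by positivity) h3

lemma cofinal_add_nat {x : ℤ_[2]} {n : ℕ} (hx : ∀ k < n, x + k ≠ -1) :
    cofinalRel (digits x) (digits (x + n)) := by
  induction n with
  | zero => rw [Nat.cast_zero, add_zero]
  | succ n ih =>
    have := cofinal_add_one (hx n (by omega))
    push_cast
    rw [← add_assoc]
    exact cofinalRel.trans (ih fun k hk => hx k (by omega)) this

/-- Translation by an integer changes finitely many digits, unless the carries do not stop. -/
lemma cofinal_iff {x y : ℤ_[2]} (hx : ∀ m : ℤ, x ≠ m) :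
    cofinalRel (digits x) (digits y) ↔ ∃ m : ℤ, y = x + m := by
  refine ⟨exists_int_of_cofinal, ?_⟩
  rintro ⟨m, rfl⟩
  obtain ⟨n, rfl | rfl⟩ := m.eq_nat_or_neg
  · have := cofinal_add_nat (x := x) (n := n) fun k _ h => hx (-1 - k) (by
      push_cast; linear_combination h)
    exact_mod_cast this
  · have := cofinal_add_nat (x := x - n) (n := n) fun k _ h => hx (n - 1 - k) (by
      push_cast; linear_combination h)
    rw [sub_add_cancel] at this
    push_cast
    rw [← sub_eq_add_neg]
    exact cofinalRel.symm this

lemma digits_zero : digits 0 = fun _ => 0 := by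
  funext k
  have : (0 : ℤ_[2]).appr (k + 1) = 0 := appr_eq_of_dvd (by positivity) (by simp)
  exact Fin.ext (by simp [digits, this])

lemma digits_neg_one : digits (-1) = fun _ => 1 := by
  funext k
  have h : ∀ n, (-1 : ℤ_[2]).appr n + 1 = 2 ^ n := by
    intro n
    have h1 : 1 ≤ 2 ^ n := Nat.one_le_two_pow
    have : (-1 : ℤ_[2]).appr n = 2 ^ n - 1 := by
      refine appr_eq_of_dvd (by omega) ?_
      rw [Nat.cast_sub h1]
      push_cast
      exact ⟨-1, by ring⟩
    omega
  have h1 := appr_succ (-1) k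
  have h2 := h k
  have h3 := h (k + 1)
  have h4 : 2 ^ k * (digits (-1) k : ℕ) = 2 ^ k * 1 := by rw [pow_succ] at h3; omega
  exact Fin.ext (Nat.eq_of_mul_eq_mul_left (by positivity) h4)

/-- The integers are the `2`-adic integers whose digits are eventually constant. -/
lemma exists_int_iff {x : ℤ_[2]} :
    (∃ m : ℤ, x = m) ↔ ∃ c, cofinalRel (digits x) fun _ => c := by
  constructor
  · rintro ⟨m, rfl⟩
    rcases le_or_gt 0 m with hm | hm
    · obtain ⟨n, rfl⟩ := Int.eq_ofNat_of_zero_le hm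
      refine ⟨0, cofinalRel.symm ?_⟩
      have := cofinal_add_nat (x := 0) (n := n) fun k _ h => by
        have h1 : ((k : ℤ) : ℤ_[2]) = ((-1 : ℤ) : ℤ_[2]) := by push_cast; linear_combination h
        have h2 : (k : ℤ) = -1 := by exact_mod_cast h1
        omega
      rw [digits_zero, zero_add] at this
      exact_mod_cast this
    · obtain ⟨n, hn⟩ := Int.eq_ofNat_of_zero_le (show 0 ≤ -1 - m by omega)
      obtain rfl : m = -1 - n := by omega
      refine ⟨1, ?_⟩
      have := cofinal_add_nat (x := ((-1 - n : ℤ) : ℤ_[2])) (n := n) fun k hk h => by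
        have h1 : ((-1 - n + k : ℤ) : ℤ_[2]) = ((-1 : ℤ) : ℤ_[2]) := by
          push_cast at h ⊢
          linear_combination h
        have h2 : (-1 - n + k : ℤ) = -1 := by exact_mod_cast h1
        omega
      have e : ((-1 - n : ℤ) : ℤ_[2]) + (n : ℤ_[2]) = -1 := by push_cast; ring
      rwa [e, digits_neg_one] at this
  · rintro ⟨c, hc⟩
    have : c = 0 ∨ c = 1 := by omega
    rcases this with rfl | rfl
    · rw [← digits_zero] at hc
      obtain ⟨m, hm⟩ := exists_int_of_cofinal hc
      exact ⟨-m, by push_cast; linear_combination -hm⟩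
    · rw [← digits_neg_one] at hc
      obtain ⟨m, hm⟩ := exists_int_of_cofinal hc
      exact ⟨-1 - m, by push_cast; linear_combination -hm⟩

lemma odometerRel_iff {x y : ℤ_[2]} : odometerRel x y ↔ ∃ m : ℤ, y = x + m := by
  constructor
  · intro h
    induction h with
    | rel x y h => exact ⟨1, by simpa using h⟩
    | refl x => exact ⟨0, by simp⟩
    | symm x y _ ih =>
      obtain ⟨m, rfl⟩ := ih
      exact ⟨-m, by simp⟩
    | trans x y z _ _ ih1 ih2 =>
      obtain ⟨m, rfl⟩ := ih1
      obtain ⟨n, rfl⟩ := ih2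
      exact ⟨m + n, by push_cast; ring⟩
  · have key : ∀ (n : ℕ) (x : ℤ_[2]), odometerRel x (x + n) := by
      intro n x
      induction n with
      | zero => rw [Nat.cast_zero, add_zero]
      | succ n ih =>
        refine odometerRel.trans ih (Relation.EqvGen.rel _ _ ?_)
        push_cast
        ring
    rintro ⟨m, rfl⟩
    obtain ⟨n, rfl | rfl⟩ := m.eq_nat_or_neg
    · exact_mod_cast key n x
    · have := odometerRel.symm (key n (x - n))
      rw [sub_add_cancel] at this
      push_cast
      rwa [← sub_eq_add_neg]

lemma cofinal_interleave_iff {z w : Plane} :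
    cofinalRel (interleave z) (interleave w) ↔
      cofinalRel (digits z.1) (digits w.1) ∧ cofinalRel (digits z.2) (digits w.2) := by
  constructor
  · rintro ⟨n, hn⟩
    refine ⟨⟨n, fun m hm => ?_⟩, ⟨n, fun m hm => ?_⟩⟩
    · simpa only [interleave_two_mul] using hn (2 * m) (by omega)
    · simpa only [interleave_two_mul_add_one] using hn (2 * m + 1) (by omega)
  · rintro ⟨⟨n, hn⟩, ⟨m, hm⟩⟩
    refine ⟨2 * (n + m), ?_⟩
    refine forall_interleave (P := fun i b => 2 * (n + m) ≤ i → b = interleave w i).2 ⟨?_, ?_⟩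
    · intro k hk
      rw [interleave_two_mul]
      exact hn k (by omega)
    · intro k hk
      rw [interleave_two_mul_add_one]
      exact hm k (by omega)

/-- On generic points, cofinality of the interleaved digits is the orbit relation of `ℤ²`. -/
lemma cofinal_interleave_iff_exists {z w : Plane} (hz : z ∈ generic) :
    cofinalRel (interleave z) (interleave w) ↔ ∃ v, w = z + emb v := by
  rw [cofinal_interleave_iff, cofinal_iff hz.1, cofinal_iff hz.2.1]
  constructor
  · rintro ⟨⟨m, hm⟩, ⟨n, hn⟩⟩
    exact ⟨(m, n), Prod.ext hm hn⟩
  · rintro ⟨v, rfl⟩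
    exact ⟨⟨v.1, rfl⟩, ⟨v.2, rfl⟩⟩

/-- The plane is Borel isomorphic to the `2`-adic integers by interleaving binary digits. -/
def mergeEquiv : Plane ≃ᵐ ℤ_[2] := interleaveEquiv.trans digitsEquiv.symm

lemma digits_mergeEquiv (z : Plane) : digits (mergeEquiv z) = interleave z :=
  digitsEquiv.apply_symm_apply (interleave z)

lemma map_mergeEquiv : haarPlane.map mergeEquiv = haarTwoAdic := by
  have h : (haarPlane.map mergeEquiv).map digitsEquiv = haarTwoAdic.map digitsEquiv := by
    rw [map_digitsEquiv, Measure.map_map digitsEquiv.measurable mergeEquiv.measurable,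
      ← map_interleaveEquiv]
    congr 1
    funext z
    exact digits_mergeEquiv z
  exact digitsEquiv.map_measurableEquiv_injective h

/-- On generic points, the merged digits are not eventually constant, and hence the orbit relation
of the odometer is the cofinality of digits. -/
lemma odometer_merge_iff {z w : Plane} (hz : z ∈ generic) :
    odometerRel (mergeEquiv z) (mergeEquiv w) ↔ ∃ v, w = z + emb v := by
  rw [odometerRel_iff, ← cofinal_interleave_iff_exists hz, ← digits_mergeEquiv,
    ← digits_mergeEquiv, cofinal_iff]
  by_contra! h
  obtain ⟨c, n, hn⟩ := exists_int_iff.1 h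
  refine absurd (exists_int_iff.2 ⟨c, n, fun k hk => ?_⟩) (not_exists.2 hz.1)
  rw [← interleave_two_mul, ← digits_mergeEquiv]
  exact hn (2 * k) (by omega)

/-! ### The invariant measure -/

/-- The part over the generic sites of the image of `S` under the address map. -/
def goodImage (S : Set ghysKenyonSet) : Set Plane := Subtype.val '' (treeAt ⁻¹' S)

lemma mem_goodImage {S : Set ghysKenyonSet} {z : Plane} :
    z ∈ goodImage S ↔ z ∈ goodSites ∧ ∃ x ∈ S, address x = z := by
  constructor
  · rintro ⟨w, hw, rfl⟩
    exact ⟨w.2, treeAt w, hw, address_treeAt w⟩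
  · rintro ⟨hz, x, hx, rfl⟩
    exact ⟨⟨_, hz⟩, by rwa [mem_preimage, treeAt_address hz], rfl⟩

lemma measurableSet_goodImage {S : Set ghysKenyonSet} (hS : MeasurableSet S) :
    MeasurableSet (goodImage S) :=
  measurableSet_goodSites.subtype_image (continuous_treeAt.measurable hS)

lemma goodImage_preimage (C : Set Plane) : goodImage (address ⁻¹' C) = C ∩ goodSites := by
  ext z
  rw [mem_goodImage]
  constructor
  · rintro ⟨hz, x, hx, rfl⟩
    exact ⟨hx, hz⟩
  · rintro ⟨hC, hz⟩
    refine ⟨hz, treeAt ⟨z, hz⟩, ?_, address_treeAt _⟩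
    rwa [mem_preimage, address_treeAt]

/-- The normalized image of the Haar measure of the generic sites. -/
def treeMeasure : Measure ghysKenyonSet :=
  (haarPlane goodSites)⁻¹ •
    (haarPlane.comap (Subtype.val : goodSites → Plane)).map treeAt

lemma treeMeasure_apply {S : Set ghysKenyonSet} (hS : MeasurableSet S) :
    treeMeasure S = (haarPlane goodSites)⁻¹ * haarPlane (goodImage S) := by
  rw [treeMeasure, Measure.smul_apply, smul_eq_mul,
    Measure.map_apply continuous_treeAt.measurable hS,
    (MeasurableEmbedding.subtype_coe measurableSet_goodSites).comap_apply, goodImage]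

lemma treeMeasure_preimage_address {C : Set Plane} (hC : MeasurableSet C) :
    treeMeasure (address ⁻¹' C) = (haarPlane goodSites)⁻¹ * haarPlane (C ∩ goodSites) := by
  rw [treeMeasure_apply (continuous_address.measurable hC), goodImage_preimage]

instance : IsProbabilityMeasure treeMeasure := by
  refine ⟨?_⟩
  have := treeMeasure_preimage_address MeasurableSet.univ
  rw [preimage_univ, univ_inter] at this
  rw [this]
  exact ENNReal.inv_mul_cancel haarPlane_goodSites_ne_zero (measure_ne_top _ _)

lemma treeMeasure_compl_good : treeMeasure (address ⁻¹' goodSites)ᶜ = 0 := by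
  rw [← preimage_compl, treeMeasure_preimage_address measurableSet_goodSites.compl]
  simp

/-- Invariance holds because a partial transformation of the leaves acts on addresses piecewise
by integer translations. -/
lemma isInvariant_treeMeasure : IsInvariant ghysKenyonRel treeMeasure := by
  intro A B hA hB φ hφ B' hB' hsub
  have haddr := continuous_address.measurable
  let Av : ℤ × ℤ → Set ghysKenyonSet := fun v => Subtype.val ''
    {x : A | (φ x : ghysKenyonSet) ∈ B' ∧ address (φ x) = address x + emb v}
  let Bv : ℤ × ℤ → Set ghysKenyonSet := fun v => Subtype.val ''
    {y : B | (y : ghysKenyonSet) ∈ B' ∧ address y = address (φ.symm y) + emb v}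
  have hAv : ∀ v, MeasurableSet (Av v) := fun v => by
    refine hA.subtype_image ((measurable_subtype_coe.comp φ.measurable hB').inter ?_)
    exact measurableSet_eq_fun (haddr.comp (measurable_subtype_coe.comp φ.measurable))
      ((haddr.comp measurable_subtype_coe).add_const _)
  have hBv : ∀ v, MeasurableSet (Bv v) := fun v => by
    refine hB.subtype_image ((measurable_subtype_coe hB').inter ?_)
    exact measurableSet_eq_fun (haddr.comp measurable_subtype_coe)
      ((haddr.comp (measurable_subtype_coe.comp φ.symm.measurable)).add_const _)
  have hAU : Subtype.val '' {x : A | (φ x : ghysKenyonSet) ∈ B'} = ⋃ v, Av v := by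
    ext x
    simp only [mem_iUnion]
    constructor
    · rintro ⟨x, hx, rfl⟩
      obtain ⟨v, hv⟩ := exists_address_eq_of_rel (hφ x)
      exact ⟨v, x, ⟨hx, hv⟩, rfl⟩
    · rintro ⟨v, x, ⟨hx, -⟩, rfl⟩
      exact ⟨x, hx, rfl⟩
  have hBU : B' = ⋃ v, Bv v := by
    ext y
    simp only [mem_iUnion]
    constructor
    · intro hy
      obtain ⟨v, hv⟩ := exists_address_eq_of_rel (hφ (φ.symm ⟨y, hsub hy⟩))
      rw [φ.apply_symm_apply] at hv
      exact ⟨v, ⟨y, hsub hy⟩, ⟨hy, hv⟩, rfl⟩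
    · rintro ⟨v, y, ⟨hy, -⟩, rfl⟩
      exact hy
  have hAd : Pairwise (Function.onFun Disjoint Av) := by
    intro v w hvw
    refine Set.disjoint_left.2 ?_
    rintro _ ⟨x, ⟨-, hx⟩, rfl⟩ ⟨x', ⟨-, hx'⟩, h⟩
    obtain rfl := Subtype.ext h
    exact hvw (emb_injective (add_left_cancel (hx.symm.trans hx')))
  have hBd : Pairwise (Function.onFun Disjoint Bv) := by
    intro v w hvw
    refine Set.disjoint_left.2 ?_
    rintro _ ⟨x, ⟨-, hx⟩, rfl⟩ ⟨x', ⟨-, hx'⟩, h⟩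
    obtain rfl := Subtype.ext h
    exact hvw (emb_injective (add_left_cancel (hx.symm.trans hx')))
  rw [hAU, hBU, measure_iUnion hAd hAv, measure_iUnion hBd hBv]
  refine tsum_congr fun v => ?_
  rw [treeMeasure_apply (hAv v), treeMeasure_apply (hBv v)]
  congr 1
  rw [← measure_preimage_add_right haarPlane (emb v) (goodImage (Bv v))]
  congr 1
  ext z
  simp only [mem_preimage, mem_goodImage]
  constructor
  · rintro ⟨hz, _, ⟨x, ⟨hx, hxv⟩, rfl⟩, rfl⟩
    rw [← hxv]
    refine ⟨mem_goodSites_of_generic (hxv ▸ add_emb_mem_generic.2 hz.2), _, ⟨φ x, ⟨hx, ?_⟩, rfl⟩,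
      rfl⟩
    rwa [φ.symm_apply_apply]
  · rintro ⟨hz, _, ⟨y, ⟨hy, hyv⟩, rfl⟩, h⟩
    have hx : address (φ.symm y) = z := add_right_cancel (hyv.symm.trans h)
    rw [← hx]
    refine ⟨mem_goodSites_of_generic (hx ▸ add_emb_mem_generic.1 hz.2), _,
      ⟨φ.symm y, ⟨?_, ?_⟩, rfl⟩, rfl⟩
    · rwa [φ.apply_symm_apply]
    · rwa [φ.apply_symm_apply]

/-! ### Unique ergodicity -/

/-- The points of the minimal set that contain the edge from the origin to `e`. -/
def edgeSet (e : ℤ × ℤ) : Set ghysKenyonSet := {x | x.1.graph.Adj 0 e}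

lemma measurableSet_edgeSet (e : ℤ × ℤ) : MeasurableSet (edgeSet e) := by
  refine IsOpen.measurableSet (isOpen_iff_mem_nhds.2 fun x hx => ?_)
  have := continuous_subtype_val.continuousAt.eventually
    (GHSpace.eventually_adj_iff (q := e) x.1.zero_mem)
  filter_upwards [this] with y hy using hy.2 hx

/-- The displacement of the base point along the edge from the origin to `e`. -/
def crossEdge {e e' : ℤ × ℤ} (h : e + e' = 0) (x : edgeSet e) : edgeSet e' :=
  ⟨⟨x.1.1.rebase e x.2.snd_mem, rebase_mem_ghysKenyonSet x.1.2 _⟩, by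
    change (x.1.1.rebase e x.2.snd_mem).graph.Adj 0 e'
    rw [GHSpace.rebase_adj, zero_add, add_comm e', h]
    exact x.2.symm⟩

lemma crossEdge_crossEdge {e e' : ℤ × ℤ} (h : e + e' = 0) (h' : e' + e = 0) (x : edgeSet e) :
    crossEdge h' (crossEdge h x) = x := by
  refine Subtype.ext (Subtype.ext (GHSpace.ext ?_))
  change translate (translate x.1.1.graph (-e)) (-e') = x.1.1.graph
  have : -e + -e' = 0 := by rw [← neg_add, h, neg_zero]
  rw [translate_translate, this, translate_zero]

lemma measurable_crossEdge {e e' : ℤ × ℤ} (h : e + e' = 0) : Measurable (crossEdge h) := by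
  refine Continuous.measurable (continuous_induced_rng.2 (continuous_induced_rng.2
    (continuous_iff_continuousAt.2 fun x s hs => ?_)))
  obtain ⟨N, hN, hball⟩ := GHSpace.mem_nhds_iff_ball.1 hs
  have hmem : {T : GHSpace | T.ball (x.1.1.graph.spanningCoe.dist 0 e + N) =
      x.1.1.ball (x.1.1.graph.spanningCoe.dist 0 e + N)} ∈ 𝓝 x.1.1 :=
    GHSpace.mem_nhds_iff_ball.2 ⟨_, by omega, fun T hT => hT⟩
  have hc : Continuous fun y : edgeSet e => y.1.1 :=
    continuous_subtype_val.comp continuous_subtype_val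
  rw [mem_map]
  filter_upwards [hc.continuousAt.preimage_mem_nhds hmem] with y hy
  exact hball _ (GHSpace.rebase_ball_eq x.2.snd_mem y.2.snd_mem hy)

/-- The displacement of the base point along an edge, as a Borel isomorphism. -/
def crossEdgeEquiv {e e' : ℤ × ℤ} (h : e + e' = 0) : edgeSet e ≃ᵐ edgeSet e' where
  toFun := crossEdge h
  invFun := crossEdge ((add_comm e' e).trans h)
  left_inv := crossEdge_crossEdge h ((add_comm e' e).trans h)
  right_inv := crossEdge_crossEdge ((add_comm e' e).trans h) h
  measurable_toFun := measurable_crossEdge h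
  measurable_invFun := measurable_crossEdge ((add_comm e' e).trans h)

lemma address_crossEdge {e e' : ℤ × ℤ} (h : e + e' = 0) (x : edgeSet e) :
    address (crossEdge h x) = address x + emb e :=
  address_eq ((isAddress_address x.1).rebase x.2.snd_mem)

lemma measure_edgeSet_inter {ν : Measure ghysKenyonSet} (hν : IsInvariant ghysKenyonRel ν)
    (e : ℤ × ℤ) {C : Set Plane} (hC : MeasurableSet C) :
    ν {x | x ∈ edgeSet e ∧ address x + emb e ∈ C} = ν (edgeSet (-e) ∩ address ⁻¹' C) := by
  have h0 : e + -e = 0 := add_neg_cancel e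
  rw [← hν (edgeSet e) (edgeSet (-e)) (measurableSet_edgeSet _) (measurableSet_edgeSet _)
    (crossEdgeEquiv h0) (fun x => GHSpace.leafRel_rebase x.2.snd_mem) _
    ((measurableSet_edgeSet _).inter (continuous_address.measurable hC)) inter_subset_left]
  congr 1
  ext x
  have key : ∀ hx : x ∈ edgeSet e, ((crossEdgeEquiv h0 ⟨x, hx⟩ : ghysKenyonSet) ∈
      edgeSet (-e) ∩ address ⁻¹' C) ↔ address x + emb e ∈ C := by
    intro hx
    have := address_crossEdge h0 ⟨x, hx⟩
    change _ ∧ address (crossEdge h0 ⟨x, hx⟩) ∈ C ↔ _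
    rw [this]
    exact and_iff_right (crossEdge h0 ⟨x, hx⟩).2
  constructor
  · rintro ⟨hx, hxC⟩
    exact ⟨⟨x, hx⟩, (key hx).2 hxC, rfl⟩
  · rintro ⟨⟨x, hx⟩, hxC, rfl⟩
    exact ⟨hx, (key hx).1 hxC⟩

/-- If two neighbouring points are sites, every point of the minimal set whose address is one of
them contains the edge to the other, and its base point can be displaced along this edge. -/
lemma IsInvariant.locallyInvariant {ν : Measure ghysKenyonSet}
    (hν : IsInvariant ghysKenyonRel ν) : LocallyInvariant (ν.map address) := by
  intro e he C hC hCs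
  have haddr := continuous_address.measurable
  have hm : Measurable fun z : Plane => z + emb e := measurable_add_const _
  change ν.map address ((fun z : Plane => z + emb e) ⁻¹' C) = _
  rw [Measure.map_apply haddr hC, Measure.map_apply haddr (hm hC)]
  have h1 : edgeSet (-e) ∩ address ⁻¹' C = address ⁻¹' C := by
    refine inter_eq_right.2 fun x hx => ?_
    have := hCs _ hx
    refine (isAddress_address x).adj 0 x.1.zero_mem (-e) ?_ (by simpa using this.1) ?_
    · rw [grid_adj_iff, sub_zero]
      exact neg_mem_units he
    · rw [map_neg, ← sub_eq_add_neg]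
      exact this.2
  have h2 : {x | x ∈ edgeSet e ∧ address x + emb e ∈ C} =
      address ⁻¹' ((fun z : Plane => z + emb e) ⁻¹' C) := by
    ext x
    refine ⟨fun h => h.2, fun h => ⟨?_, h⟩⟩
    have := hCs _ h
    refine (isAddress_address x).adj 0 x.1.zero_mem e ?_ ?_ this.1
    · rw [grid_adj_iff, sub_zero]
      exact he
    · simpa using this.2
  rw [← h1, ← h2]
  exact measure_edgeSet_inter hν e hC

/-- The nonzero integral points of a half-axis are infinitely many atoms of the same mass for a
locally invariant measure. -/
lemma LocallyInvariant.measure_singleton_unit {ρ : Measure Plane} [IsFiniteMeasure ρ]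
    (h : LocallyInvariant ρ) {e : ℤ × ℤ} (he : e ∈ units) : ρ {emb e} = 0 := by
  have hs : ∀ k : ℕ, emb ((k + 1) • e) ∈ sites := fun k => by
    have := deep_add_nsmul_mem_sites (w := 0) (n := k + 1) he (by simp [Deep]) k.succ_ne_zero
      Nat.lt_two_pow_self
    rwa [zero_add] at this
  have hconst : ∀ k : ℕ, ρ {emb ((k + 1) • e)} = ρ {emb e} := by
    intro k
    induction k with
    | zero => simp
    | succ k ih =>
      rw [← ih]
      have e1 : ((k + 1 + 1) • e) = (k + 1) • e + e := succ_nsmul _ _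
      rw [← h e he {emb ((k + 1 + 1) • e)} (measurableSet_singleton _)]
      · congr 1
        ext z
        rw [e1, map_add]
        exact add_left_inj (emb e)
      · rintro _ rfl
        refine ⟨hs (k + 1), ?_⟩
        rw [e1, map_add, add_sub_cancel_right]
        exact hs k
  have hinj : Function.Injective fun k : ℕ => emb ((k + 1) • e) := by
    intro k l hkl
    have h1 := emb_injective hkl
    simp only [units, mem_insert_iff, mem_singleton_iff] at he
    rcases he with rfl | rfl | rfl | rfl <;> simpa using h1
  by_contra hne
  have htop : ρ (⋃ k : ℕ, {emb ((k + 1) • e)}) = ⊤ := by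
    rw [measure_iUnion (fun k l hkl => disjoint_singleton.2 fun h => hkl (hinj h))
      fun _ => measurableSet_singleton _]
    simp only [hconst]
    exact ENNReal.tsum_const_eq_top_of_ne_zero hne
  exact measure_ne_top _ _ htop

/-- The only address that is not a site is the origin. It is not an atom, since its mass can be
moved along the edges at the base point to points of the axes. -/
lemma IsInvariant.map_address_compl_sites {ν : Measure ghysKenyonSet} [IsProbabilityMeasure ν]
    (hν : IsInvariant ghysKenyonRel ν) : ν.map address sitesᶜ = 0 := by
  have haddr := continuous_address.measurable
  have hfin : IsProbabilityMeasure (ν.map address) :=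
    Measure.isProbabilityMeasure_map haddr.aemeasurable
  rw [Measure.map_apply haddr measurableSet_sites.compl]
  have hcover : address ⁻¹' sitesᶜ ⊆
      ⋃ e ∈ units, {x | x ∈ edgeSet e ∧ address x + emb e ∈ ({emb e} : Set Plane)} := by
    intro x hx
    have h0 : address x = 0 := (address_mem_sites_or x).resolve_left hx
    obtain ⟨e, he⟩ := x.1.exists_adj x.1.zero_mem
    have hu : e ∈ units := by
      have := grid_adj_iff.1 (x.1.graph.adj_sub he)
      rwa [sub_zero] at this
    refine mem_iUnion₂.2 ⟨e, hu, he, ?_⟩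
    rw [h0, zero_add]
    rfl
  refine measure_mono_null hcover ((measure_biUnion_null_iff (Set.to_countable _)).2 fun e he => ?_)
  rw [measure_edgeSet_inter hν e (measurableSet_singleton _)]
  refine measure_mono_null inter_subset_right ?_
  rw [← Measure.map_apply haddr (measurableSet_singleton _)]
  exact hν.locallyInvariant.measure_singleton_unit he

/-- Invariant probability measures have the same image under the address map, and this map is
injective over the generic sites, which have full measure. -/
lemma IsInvariant.eq_treeMeasure {ν : Measure ghysKenyonSet} [IsProbabilityMeasure ν]
    (hν : IsInvariant ghysKenyonRel ν) : ν = treeMeasure := by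
  have haddr := continuous_address.measurable
  have h1 : IsProbabilityMeasure (ν.map address) :=
    Measure.isProbabilityMeasure_map haddr.aemeasurable
  have h2 : IsProbabilityMeasure (treeMeasure.map address) :=
    Measure.isProbabilityMeasure_map haddr.aemeasurable
  have hμ := isInvariant_treeMeasure
  have heq : ν.map address = treeMeasure.map address :=
    hν.locallyInvariant.unique hμ.locallyInvariant hν.map_address_compl_sites
      hμ.map_address_compl_sites
  have hpre : ∀ C, MeasurableSet C → ν (address ⁻¹' C) = treeMeasure (address ⁻¹' C) := by
    intro C hC
    rw [← Measure.map_apply haddr hC, heq, Measure.map_apply haddr hC]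
  have hnull : ν (address ⁻¹' goodSites)ᶜ = 0 := by
    rw [← preimage_compl, hpre _ measurableSet_goodSites.compl, preimage_compl,
      treeMeasure_compl_good]
  ext S hS
  have hset : S ∩ address ⁻¹' goodSites = address ⁻¹' goodImage S := by
    ext x
    rw [mem_preimage, mem_goodImage]
    constructor
    · rintro ⟨hx, hg⟩
      exact ⟨hg, x, hx, rfl⟩
    · rintro ⟨hg, y, hy, hxy⟩
      have : y = x := address_injOn (by rw [mem_preimage, hxy]; exact hg.2) hg.2 hxy
      exact ⟨this ▸ hy, hg⟩
  rw [← measure_inter_conull hnull, ← measure_inter_conull treeMeasure_compl_good, hset,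
    hpre _ (measurableSet_goodImage hS)]

/-! ### Stable orbit equivalence -/

/-- The minimal set over the generic sites is Borel isomorphic to the set of generic sites. -/
def addressEquiv : (address ⁻¹' goodSites : Set ghysKenyonSet) ≃ᵐ goodSites where
  toFun x := ⟨address x, x.2⟩
  invFun z := ⟨treeAt z, by rw [mem_preimage, address_treeAt]; exact z.2⟩
  left_inv x := Subtype.ext (treeAt_address x.2)
  right_inv z := Subtype.ext (address_treeAt z)
  measurable_toFun :=
    (continuous_address.measurable.comp measurable_subtype_coe).subtype_mk
  measurable_invFun := Measurable.subtype_mk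
    (h := fun z => by rw [mem_preimage, address_treeAt]; exact z.2) continuous_treeAt.measurable

/-- Every Borel model of the plane in which the orbits of `ℤ²` through generic points are the
classes of a relation is stably orbit equivalent to the minimal set. -/
theorem stablyOrbitEquivalent_of_model {Y : Type*} [MeasurableSpace Y] {s : Setoid Y}
    {ν : Measure Y} (θ : Plane ≃ᵐ Y) (hθ : haarPlane.map θ = ν)
    (hs : ∀ z ∈ generic, ∀ w, s (θ z) (θ w) ↔ ∃ v, w = z + emb v) :
    StablyOrbitEquivalent ghysKenyonRel treeMeasure s ν := by
  have haddr := continuous_address.measurable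
  have hA : MeasurableSet (address ⁻¹' goodSites) := haddr measurableSet_goodSites
  have hB : MeasurableSet (θ.symm ⁻¹' goodSites) := θ.symm.measurable measurableSet_goodSites
  have hνC : ∀ C : Set Plane, ν (θ.symm ⁻¹' C) = haarPlane C := by
    intro C
    rw [← hθ, θ.map_apply, ← preimage_comp, θ.symm_comp_self, preimage_id]
  have hmem : ∀ x : (address ⁻¹' goodSites : Set ghysKenyonSet),
      θ (address x) ∈ θ.symm ⁻¹' goodSites := fun x => by
    rw [mem_preimage, θ.symm_apply_apply]
    exact x.2
  let E : (address ⁻¹' goodSites : Set ghysKenyonSet) ≃ᵐ (θ.symm ⁻¹' goodSites : Set Y) :=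
    { toFun := fun x => ⟨θ (address x), hmem x⟩
      invFun := fun y => addressEquiv.symm ⟨θ.symm y, y.2⟩
      left_inv := fun x => by
        refine (MeasurableEquiv.symm_apply_eq _).2 (Subtype.ext ?_)
        exact θ.symm_apply_apply _
      right_inv := fun y => by
        have h1 := address_treeAt ⟨θ.symm y, y.2⟩
        refine Subtype.ext ?_
        change θ (address (treeAt ⟨θ.symm y, y.2⟩)) = y
        rw [h1, θ.apply_symm_apply]
      measurable_toFun := Measurable.subtype_mk (h := hmem)
        (θ.measurable.comp (haddr.comp measurable_subtype_coe))
      measurable_invFun := addressEquiv.symm.measurable.comp (Measurable.subtype_mk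
        (h := fun y => y.2) (θ.symm.measurable.comp measurable_subtype_coe)) }
  have hErel : ∀ x y, ghysKenyonRel x.1 y.1 ↔ s (E x).1 (E y).1 := by
    intro x y
    change _ ↔ s (θ (address x)) (θ (address y))
    rw [hs _ x.2.2]
    exact ⟨exists_address_eq_of_rel, fun ⟨v, hv⟩ => rel_of_address_eq x.2 y.2 hv⟩
  refine ⟨_, _, hA, hB, ?_, ?_, univ, univ, MeasurableSet.univ, MeasurableSet.univ, ?_, ?_,
    by simp, by simp,
    (MeasurableEquiv.Set.univ _).trans (E.trans (MeasurableEquiv.Set.univ _).symm),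
    ae_of_all _ fun x => ?_, ?_⟩
  · refine measure_mono_null (compl_subset_compl.2 fun x hx => ?_) treeMeasure_compl_good
    exact ⟨x, hx, ghysKenyonRel.refl x⟩
  · -- The orbit of every generic point contains a site.
    refine measure_mono_null (t := θ.symm ⁻¹' genericᶜ) ?_ (by rw [hνC, haarPlane_compl_generic])
    refine compl_subset_comm.2 fun y hy => ?_
    have hy' : θ.symm y ∈ generic := by simpa using hy
    obtain ⟨v, hv⟩ : ∃ v, θ.symm y + emb v ∈ sites := by
      rcases mem_sites_or_add_horizontal (deep_zero (θ.symm y)) with h | h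
      · exact ⟨0, by simpa using h⟩
      · exact ⟨_, h⟩
    refine ⟨θ (θ.symm y + emb v), ?_, ?_⟩
    · rw [mem_preimage, θ.symm_apply_apply]
      exact ⟨hv, add_emb_mem_generic.2 hy'⟩
    · have := s.symm ((hs _ hy' (θ.symm y + emb v)).2 ⟨v, rfl⟩)
      rwa [θ.apply_symm_apply] at this
  · exact eq_univ_of_forall fun x => ⟨x, mem_univ x, Setoid.refl' _ x⟩
  · exact eq_univ_of_forall fun x => ⟨x, mem_univ x, Setoid.refl' _ x⟩
  · ext ⟨y, hy⟩
    constructor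
    · rintro ⟨⟨z, hz⟩, hxz, h⟩
      have hzy : E z = y := congrArg Subtype.val h
      rw [← hzy]
      exact (hErel _ _).1 hxz
    · intro h
      refine ⟨⟨E.symm y, mem_univ _⟩, ?_, Subtype.ext (E.apply_symm_apply y)⟩
      refine (hErel _ _).2 ?_
      rw [E.apply_symm_apply]
      exact h
  · -- The two measures differ by a constant factor.
    have hc0 : (haarPlane goodSites)⁻¹ ≠ 0 := ENNReal.inv_ne_zero.2 (measure_ne_top _ _)
    have key : ∀ S : Set (univ : Set (θ.symm ⁻¹' goodSites : Set Y)), MeasurableSet S →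
        (((treeMeasure.comap Subtype.val).comap Subtype.val).map
          ((MeasurableEquiv.Set.univ _).trans (E.trans (MeasurableEquiv.Set.univ _).symm))) S =
        (haarPlane goodSites)⁻¹ * ((ν.comap Subtype.val).comap Subtype.val) S := by
      intro S hS
      have hS' : MeasurableSet (Subtype.val '' (Subtype.val '' S)) :=
        hB.subtype_image (MeasurableSet.univ.subtype_image hS)
      rw [MeasurableEquiv.map_apply,
        (MeasurableEmbedding.subtype_coe MeasurableSet.univ).comap_apply,
        (MeasurableEmbedding.subtype_coe hA).comap_apply,
        (MeasurableEmbedding.subtype_coe MeasurableSet.univ).comap_apply,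
        (MeasurableEmbedding.subtype_coe hB).comap_apply, ← hθ, θ.map_apply]
      have hsub : θ ⁻¹' (Subtype.val '' (Subtype.val '' S)) ⊆ goodSites := by
        rintro z ⟨y, -, hy⟩
        have := y.2
        rw [hy, mem_preimage, θ.symm_apply_apply] at this
        exact this
      rw [← inter_eq_left.2 hsub, ← treeMeasure_preimage_address (θ.measurable hS')]
      congr 1
      ext x
      constructor
      · rintro ⟨_, ⟨⟨x, hx⟩, hxS, rfl⟩, rfl⟩
        exact ⟨_, ⟨_, hxS, rfl⟩, rfl⟩
      · rintro ⟨_, ⟨⟨y, hy⟩, hyS, rfl⟩, hyx⟩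
        have hx : address x ∈ goodSites := by
          have := y.2
          rw [hyx, mem_preimage, θ.symm_apply_apply] at this
          exact this
        refine ⟨⟨x, hx⟩, ⟨⟨⟨x, hx⟩, mem_univ _⟩, ?_, rfl⟩, rfl⟩
        have hEx : E ⟨x, hx⟩ = y := Subtype.ext hyx.symm
        have : (⟨E ⟨x, hx⟩, mem_univ _⟩ : (univ : Set (θ.symm ⁻¹' goodSites : Set Y))) = ⟨y, hy⟩ :=
          Subtype.ext hEx
        change (⟨E ⟨x, hx⟩, mem_univ _⟩ : (univ : Set (θ.symm ⁻¹' goodSites : Set Y))) ∈ S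
        rwa [this]
    refine ⟨Measure.AbsolutelyContinuous.mk fun S hS h0 => ?_,
      Measure.AbsolutelyContinuous.mk fun S hS h0 => ?_⟩
    · rw [key S hS, h0, mul_zero]
    · rw [key S hS] at h0
      exact (mul_eq_zero.1 h0).resolve_left hc0

end GhysKenyon

end

theorem mainTheorem1 :
    ∃ μ : MeasureTheory.Measure GhysKenyon.ghysKenyonSet,
      MeasureTheory.IsProbabilityMeasure μ ∧
      GhysKenyon.IsInvariant GhysKenyon.ghysKenyonRel μ ∧
      (∀ ν : MeasureTheory.Measure GhysKenyon.ghysKenyonSet,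
        MeasureTheory.IsProbabilityMeasure ν →
          GhysKenyon.IsInvariant GhysKenyon.ghysKenyonRel ν → ν = μ) ∧
      GhysKenyon.StablyOrbitEquivalent GhysKenyon.ghysKenyonRel μ
        GhysKenyon.cofinalRel GhysKenyon.coinMeasure ∧
      GhysKenyon.StablyOrbitEquivalent GhysKenyon.ghysKenyonRel μ
        GhysKenyon.odometerRel GhysKenyon.haarTwoAdic :=
  ⟨GhysKenyon.treeMeasure, inferInstance, GhysKenyon.isInvariant_treeMeasure,
    fun _ _ hν => hν.eq_treeMeasure,
    GhysKenyon.stablyOrbitEquivalent_of_model GhysKenyon.interleaveEquiv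
      GhysKenyon.map_interleaveEquiv fun _ hz _ => GhysKenyon.cofinal_interleave_iff_exists hz,
    GhysKenyon.stablyOrbitEquivalent_of_model GhysKenyon.mergeEquiv
      GhysKenyon.map_mergeEquiv fun _ hz _ => GhysKenyon.odometer_merge_iff hz⟩
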